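/- Let $q$ be a prime power, let $E=\mathbb{A}^2_q=\mathbb{F}_q^2$ be the affine plane (so $|E|=q^2$), and let $C_q=\mathrm{RM}_q(2,2)\subseteq\mathbb{F}_q^{E}$ be the Reed–Muller code consisting of all vectors $(f(P))_{P\in E}$ with $f\in\mathbb{F}_q[x,y]$ of total degree at most $2$. Let $M_q$ be the parity check matroid of $C_q$: its ground set is $E$, and $\sigma\subseteq E$ is independent if and only if the columns indexed by $\sigma$ of a parity check matrix $H$ of $C_q$ are linearly independent (the choice of $H$ does not matter). For $\sigma\subseteq E$ let $r(\sigma)$ be its rank, $n(\sigma)=|\sigma|-r(\sigma)$ its nullity, and let $N_i=\{\sigma\subseteq E: n(\sigma)=i\}$. "Minimal" means inclusion-minimal in $N_i$, and "complement" means complement in $E$. A conic is given by a nonzero homogeneous polynomial $Q\in\mathbb{F}_q[x,y,z]$ of degree $2$. Its affine zero set is $\{(x,y)\in E: Q(x,y,1)=0\}$. Let $L$ be the line $z=0$ in $\mathbb{P}^2_q$. An irreducible conic is one whose equation is irreducible over $\overline{\mathbb{F}}_q$. Consider the affine zero sets of the following types of conics: - type $(d)$: pairs of distinct $\mathbb{F}_q$-lines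 meeting in a point outside $L$; - type $(e)$: pairs of distinct $\mathbb{F}_q$-lines, both different from $L$, meeting in a point of $L$ (pairs of parallel lines); - types $(f)$, $(g)$, $(h)$: irreducible conics with exactly $2$, $1$, $0$ rational points on $L$, respectively. **Theorem 5.2.** The matroid $M_q$ satisfies the following. $(a)$ For $q\ge 3$ the minimal elements of $N_1$ are exactly the complements of the inclusion-maximal affine zero sets of conics; for $q=2$ they are exactly the complements of the affine zero sets of conics that are inclusion-maximal among those different from $E$. Explicitly, the minimal elements of $N_1$ are exactly the complements of the affine zero sets of the conics of the following types: - for $q\ge 7$: $(d),(e),(f),(g),(h)$; - for $q=5$: $(d),(e),(g),(h)$; - for $q=4$: $(d),(e),(h)$; - for $q=3$: $(d),(e)$; - for $q=2$: $(d),(h)$. For every $q\ge2$ the affine zero sets of types $(d),(e),(f),(g),(h)$ have $2q-1$, $2q$, $q-1$, $q$, $q+1$ elements, respectively. The number of distinct affine zero sets (equivalently, of their complements) is $\frac{q^4+q^3}{2}$ for type $(d)$ and $\frac{q(q^2-1)}{2}$ for type $(e)$ when $q\ge3$, $\frac{q^3(q-1)^2}{2}$ for type $(h)$ when $q\ge4$,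 $q^2(q^2-1)$ for type $(g)$ when $q\ge 5$, and $\frac{q^3(q^2-1)}{2}$ for type $(f)$ when $q\ge7$. $(b)$ Assume $q\ge3$. - The minimal elements of $N_2$ are exactly the $(q^2+q)(q^2-q)$ complements of sets consisting of all $q$ points of a line of $E$ and one point outside that line, and the $\frac{q^2(q^2-1)(q^2-q)(q^2-3q+3)}{24}$ complements of sets of four points no three of which are collinear. - The minimal elements of $N_3$ are exactly the $q^2+q$ complements of lines of $E$ and the $\frac{q^2(q^2-1)(q^2-q)}{6}$ complements of sets of three non-collinear points. - The minimal elements of $N_4$ are exactly the $\binom{q^2}{2}$ complements of sets of two points. - The minimal elements of $N_5$ are exactly the $q^2$ complements of single points. - The only element of $N_6$, hence its only minimal element, is $E$. $(c)$ For $q=2$ and $i=0,1,2,3,4$, the minimal elements of $N_i$ are exactly the subsets of $E=\mathbb{F}_2^2$ of cardinality $i$. -/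

import Mathlib

namespace RM22

/-! ### Codes and matroids -/

/-- The affine plane over `F`. -/
abbrev Plane (F : Type*) : Type _ := Fin 2 → F

/-- The linear map evaluating a polynomial in two variables at all points of the affine plane. -/
noncomputable def evalMap (F : Type*) [Field F] :
    MvPolynomial (Fin 2) F →ₗ[F] (Plane F → F) :=
  LinearMap.pi fun p => (MvPolynomial.aeval p).toLinearMap

/-- The Reed-Muller code `RM_q(2,2)`, with coordinates indexed by the points of the affine plane:
all evaluation vectors of polynomials in two variables of total degree at most `2`. -/
noncomputable def reedMuller (F : Type*) [Field F] : Submodule F (Plane F → F) :=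
  (MvPolynomial.restrictTotalDegree (Fin 2) F 2).map (evalMap F)

/-- `H` is a parity check matrix of the code `C`: the codewords are the vectors killed by `H`. -/
def IsParityCheckMatrix {F ι κ : Type*} [Field F] [Fintype ι]
    (H : Matrix κ ι F) (C : Submodule F (ι → F)) : Prop :=
  ∀ c : ι → F, c ∈ C ↔ H.mulVec c = 0

theorem vector_augmentation {F ι κ : Type*} [Field F] [Finite ι] (v : ι → κ → F)
    {I J : Set ι} (hI : LinearIndepOn F v I) (hJ : LinearIndepOn F v J)
    (hIJ : I.ncard < J.ncard) : ∃ e ∈ J, e ∉ I ∧ LinearIndepOn F v (insert e I) := by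
  classical
  have : Fintype ι := Fintype.ofFinite ι
  by_contra! hcon
  have hsub : ∀ e ∈ J, v e ∈ Submodule.span F (v '' I) := by
    intro e he
    by_contra hns
    by_cases heI : e ∈ I
    · exact hns (Submodule.subset_span ⟨e, heI, rfl⟩)
    · exact hcon e he heI (hI.insert hns)
  have hle : Submodule.span F (v '' J) ≤ Submodule.span F (v '' I) := by
    rw [Submodule.span_le]
    rintro _ ⟨e, he, rfl⟩
    exact hsub e he
  have key : ∀ K : Set ι, LinearIndepOn F v K →
      Module.finrank F (Submodule.span F (v '' K)) = K.ncard := by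
    intro K hK
    have h := finrank_span_eq_card (R := F) (b := fun x : K => v x) hK
    rw [← Set.image_eq_range] at h
    rw [h, Set.ncard_eq_toFinset_card', Set.toFinset_card]
  have : Module.Finite F (Submodule.span F (v '' I)) :=
    Module.Finite.span_of_finite F (Set.toFinite _)
  have h := Submodule.finrank_mono hle
  rw [key I hI, key J hJ] at h
  omega

/-- The vector matroid of a matrix: the ground set is the set of column indices, and a set of
indices is independent when the corresponding family of columns is linearly independent. -/
noncomputable def vectorMatroid {F ι κ : Type*} [Field F] [Finite ι] (H : Matrix κ ι F) :
    Matroid ι :=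
  (IndepMatroid.ofFinite (E := Set.univ) Set.finite_univ
    (fun I => LinearIndepOn F H.col I)
    (linearIndepOn_empty F _)
    (fun _ _ hJ hIJ => hJ.mono hIJ)
    (fun _ _ hI hJ h => vector_augmentation _ hI hJ h)
    (fun _ _ => Set.subset_univ _)).matroid

/-- The nullity `n(σ) = |σ| - r(σ)`. -/
noncomputable def nullity {ι : Type*} (M : Matroid ι) (σ : Set ι) : ℕ :=
  σ.ncard - (M.eRk σ).toNat

/-- `N_i`: the subsets of the ground set of nullity `i`. -/
def nullSets {ι : Type*} (M : Matroid ι) (i : ℕ) : Set (Set ι) :=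
  {σ | σ ⊆ M.E ∧ nullity M σ = i}

/-- The inclusion-minimal elements of `N_i`. -/
def minNullSets {ι : Type*} (M : Matroid ι) (i : ℕ) : Set (Set ι) :=
  {σ | Minimal (· ∈ nullSets M i) σ}

/-! ### Projective conics and their affine parts -/

/-- The `F`-rational points of the projective plane at which a form vanishes. -/
def projZeros {F : Type*} [Field F] (Q : MvPolynomial (Fin 3) F) :
    Set (Projectivization F (Fin 3 → F)) :=
  {P | MvPolynomial.eval P.rep Q = 0}

/-- The line at infinity `z = 0`. -/
def lineAtInfinity (F : Type*) [Field F] : Set (Projectivization F (Fin 3 → F)) :=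
  {P | P.rep 2 = 0}

/-- The zeros of a form in the affine plane, whose points `(x, y)` are the points `(x : y : 1)`. -/
def affineZeros {F : Type*} [Field F] (Q : MvPolynomial (Fin 3) F) : Set (Plane F) :=
  {p | MvPolynomial.eval ![p 0, p 1, 1] Q = 0}

/-- Nonzero quadratic forms in three variables, i.e. equations of projective conics. -/
def IsConicForm {F : Type*} [Field F] (Q : MvPolynomial (Fin 3) F) : Prop :=
  Q.IsHomogeneous 2 ∧ Q ≠ 0

/-- Nonzero linear forms in three variables, i.e. equations of projective lines. -/
def IsLineForm {F : Type*} [Field F] (l : MvPolynomial (Fin 3) F) : Prop :=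
  l.IsHomogeneous 1 ∧ l ≠ 0

/-- `Q` is the equation of the pair of distinct lines `l = 0` and `m = 0`. -/
def IsLinePair {F : Type*} [Field F] (Q l m : MvPolynomial (Fin 3) F) : Prop :=
  IsLineForm l ∧ IsLineForm m ∧ projZeros l ≠ projZeros m ∧ Q = l * m

/-- `Q` is the equation of an irreducible conic (irreducible over the algebraic closure). -/
def IsIrredConic {F : Type*} [Field F] (Q : MvPolynomial (Fin 3) F) : Prop :=
  IsConicForm Q ∧
    Irreducible (MvPolynomial.map (algebraMap F (AlgebraicClosure F)) Q)

/-- The zero sets of all conics in the affine plane. -/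
def conicZeroSets (F : Type*) [Field F] : Set (Set (Plane F)) :=
  {X | ∃ Q : MvPolynomial (Fin 3) F, IsConicForm Q ∧ X = affineZeros Q}

/-- Affine zero sets of pairs of distinct lines meeting outside the line at infinity. -/
def crossingPairs (F : Type*) [Field F] : Set (Set (Plane F)) :=
  {X | ∃ Q l m : MvPolynomial (Fin 3) F, IsLinePair Q l m ∧
    Disjoint (projZeros l ∩ projZeros m) (lineAtInfinity F) ∧ X = affineZeros Q}

/-- Affine zero sets of pairs of distinct lines, both different from the line at infinity,
which meet on the line at infinity. -/
def parallelPairs (F : Type*) [Field F] : Set (Set (Plane F)) :=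
  {X | ∃ Q l m : MvPolynomial (Fin 3) F, IsLinePair Q l m ∧
    projZeros l ≠ lineAtInfinity F ∧ projZeros m ≠ lineAtInfinity F ∧
    projZeros l ∩ projZeros m ⊆ lineAtInfinity F ∧ X = affineZeros Q}

/-- Affine zero sets of irreducible conics with exactly `k` rational points at infinity. -/
def irredConicSets (F : Type*) [Field F] (k : ℕ) : Set (Set (Plane F)) :=
  {X | ∃ Q : MvPolynomial (Fin 3) F, IsIrredConic Q ∧
    (projZeros Q ∩ lineAtInfinity F).ncard = k ∧ X = affineZeros Q}

/-- Hyperbolas: two rational points at infinity. -/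
def hyperbolas (F : Type*) [Field F] : Set (Set (Plane F)) := irredConicSets F 2

/-- Parabolas: tangent to the line at infinity, i.e. a single rational point at infinity. -/
def parabolas (F : Type*) [Field F] : Set (Set (Plane F)) := irredConicSets F 1

/-- Ellipses: no rational point at infinity. -/
def ellipses (F : Type*) [Field F] : Set (Set (Plane F)) := irredConicSets F 0

/-! ### Lines and point configurations in the affine plane -/

/-- The lines of the affine plane, as point sets. -/
def affineLines (F : Type*) [Field F] : Set (Set (Plane F)) :=
  {S | ∃ L : AffineSubspace F (Plane F), Module.finrank F L.direction = 1 ∧ S = L}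

/-- All points on a line together with one point outside it. -/
def linePlusPoint (F : Type*) [Field F] : Set (Set (Plane F)) :=
  {S | ∃ L ∈ affineLines F, ∃ p, p ∉ L ∧ S = insert p L}

/-- Four distinct points, no three of which are collinear. -/
def quadrilaterals (F : Type*) [Field F] : Set (Set (Plane F)) :=
  {S | S.ncard = 4 ∧ ∀ T ⊆ S, T.ncard = 3 → ¬ Collinear F T}

/-- Three non-collinear points. -/
def triangles (F : Type*) [Field F] : Set (Set (Plane F)) :=
  {S | S.ncard = 3 ∧ ¬ Collinear F S}

/-- The complements of the members of a family of subsets of the plane. -/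
def complements {F : Type*} (𝒜 : Set (Set (Plane F))) : Set (Set (Plane F)) :=
  compl '' 𝒜

end RM22

namespace RM22

section Nullity

variable {F ι κ W : Type*} [Field F] [AddCommGroup W] [Module F W]

/-- The parameters whose associated vector vanishes on `X`. -/
def vanishing (ev : W →ₗ[F] (ι → F)) (X : Set ι) : Submodule F W where
  carrier := {w | ∀ p ∈ X, ev w p = 0}
  add_mem' := fun ha hb p hp => by simp [ha p hp, hb p hp]
  zero_mem' := fun p _ => by simp
  smul_mem' := fun c w hw p hp => by simp [hw p hp]

theorem mem_vanishing {ev : W →ₗ[F] (ι → F)} {X : Set ι} {w : W} :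
    w ∈ vanishing ev X ↔ ∀ p ∈ X, ev w p = 0 := Iff.rfl

theorem vanishing_anti (ev : W →ₗ[F] (ι → F)) {X Y : Set ι} (h : X ⊆ Y) :
    vanishing ev Y ≤ vanishing ev X := fun _ hw p hp => hw p (h hp)

theorem vanishing_insert_le (ev : W →ₗ[F] (ι → F)) (X : Set ι) (p : ι) :
    vanishing ev (insert p X) ≤ vanishing ev X := vanishing_anti ev (Set.subset_insert _ _)

theorem finrank_vanishing_le_insert [FiniteDimensional F W] (ev : W →ₗ[F] (ι → F)) (X : Set ι)
    (p : ι) :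
    Module.finrank F (vanishing ev X) ≤ Module.finrank F (vanishing ev (insert p X)) + 1 := by
  let φ : vanishing ev X →ₗ[F] F := (LinearMap.proj p ∘ₗ ev) ∘ₗ (vanishing ev X).subtype
  have h1 := LinearMap.finrank_range_add_finrank_ker φ
  have h2 : Module.finrank F (LinearMap.range φ) ≤ 1 := by
    simpa using Submodule.finrank_le (LinearMap.range φ)
  have h3 : Module.finrank F (LinearMap.ker φ) ≤
      Module.finrank F (vanishing ev (insert p X)) := by
    rw [← Submodule.finrank_map_subtype_eq]
    apply Submodule.finrank_mono
    rintro _ ⟨w, hw, rfl⟩ r hr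
    rcases Set.mem_insert_iff.1 hr with rfl | hr
    · exact hw
    · exact w.2 r hr
  omega

theorem finrank_vanishing_insert [FiniteDimensional F W] (ev : W →ₗ[F] (ι → F)) {X : Set ι}
    {p : ι} (h : ∃ w ∈ vanishing ev X, ev w p ≠ 0) :
    Module.finrank F (vanishing ev (insert p X)) + 1 = Module.finrank F (vanishing ev X) := by
  refine le_antisymm ?_ (finrank_vanishing_le_insert ev X p)
  refine Nat.succ_le_of_lt (Submodule.finrank_lt_finrank_of_lt
    (lt_of_le_of_ne (vanishing_insert_le ev X p) fun he => ?_))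
  obtain ⟨w, hw, hp⟩ := h
  rw [← he] at hw
  exact hp (hw p (Set.mem_insert _ _))

theorem vectorMatroid_indep [Finite ι] (H : Matrix κ ι F) (I : Set ι) :
    (vectorMatroid H).Indep I ↔ LinearIndepOn F H.col I := by
  simp [vectorMatroid, IndepMatroid.ofFinite_indep]

theorem vectorMatroid_ground [Finite ι] (H : Matrix κ ι F) :
    (vectorMatroid H).E = Set.univ := rfl

theorem toNat_eRk_vectorMatroid [Finite ι] (H : Matrix κ ι F) (σ : Set ι) :
    ((vectorMatroid H).eRk σ).toNat = Module.finrank F (Submodule.span F (H.col '' σ)) := by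
  have : Fintype ι := Fintype.ofFinite ι
  classical
  obtain ⟨I, hI⟩ := (vectorMatroid H).exists_isBasis σ (Set.subset_univ _)
  rw [← hI.encard_eq_eRk]
  rw [Matroid.isBasis_iff (Set.subset_univ _)] at hI
  obtain ⟨hind, hsub, hmax⟩ := hI
  rw [vectorMatroid_indep] at hind
  have hspan : Submodule.span F (H.col '' σ) = Submodule.span F (H.col '' I) := by
    refine le_antisymm ?_ (Submodule.span_mono (Set.image_mono hsub))
    rw [Submodule.span_le]
    rintro _ ⟨e, he, rfl⟩
    by_contra hns
    have := hmax (insert e I) ((vectorMatroid_indep H _).2 (hind.insert hns))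
      (Set.subset_insert _ _) (Set.insert_subset he hsub)
    exact hns (Submodule.subset_span ⟨e, this ▸ Set.mem_insert _ _, rfl⟩)
  rw [hspan]
  have h := finrank_span_eq_card (R := F) (b := fun x : I => H.col x) hind
  rw [← Set.image_eq_range] at h
  rw [h, ← Set.ncard_def, Set.ncard_eq_toFinset_card', Set.toFinset_card]

theorem nullity_vectorMatroid [Fintype ι] {H : Matrix κ ι F} {ev : W →ₗ[F] (ι → F)}
    (hH : IsParityCheckMatrix H (LinearMap.range ev)) (hev : Function.Injective ev)
    (σ : Set ι) :
    nullity (vectorMatroid H) σ = Module.finrank F (vanishing ev σᶜ) := by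
  classical
  let φ : (σ → F) →ₗ[F] (κ → F) := Fintype.linearCombination F (fun i : σ => H.col i)
  have hφ : LinearMap.range φ = Submodule.span F (H.col '' σ) := by
    rw [Fintype.range_linearCombination, Set.image_eq_range]
  have hext : ∀ c : ι → F, (∀ i ∉ σ, c i = 0) → H.mulVec c = φ (fun i => c i) := by
    intro c hc
    ext k
    simp only [Matrix.mulVec, dotProduct, φ, Fintype.linearCombination_apply, Finset.sum_apply,
      Pi.smul_apply, smul_eq_mul, Matrix.col_apply]
    rw [← Finset.sum_subtype (Finset.univ.filter (· ∈ σ)) (by simp) (fun i => c i * H k i),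
      Finset.sum_filter_of_ne (fun i _ hi => by_contra fun h => hi (by simp [hc i h]))]
    exact Finset.sum_congr rfl fun i _ => mul_comm _ _
  let ψ : vanishing ev σᶜ →ₗ[F] LinearMap.ker φ :=
    LinearMap.codRestrict _ ((LinearMap.pi fun i : σ => LinearMap.proj (i : ι)) ∘ₗ ev ∘ₗ
      (vanishing ev σᶜ).subtype) (by
        rintro ⟨w, hw⟩
        have := (hH (ev w)).1 ⟨w, rfl⟩
        rw [hext _ hw] at this
        exact this)
  have hψ : Function.Bijective ψ := by
    constructor
    · rintro ⟨w, hw⟩ ⟨w', hw'⟩ h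
      apply Subtype.ext
      apply hev
      ext i
      by_cases hi : i ∈ σ
      · exact congrFun (congrArg Subtype.val h) ⟨i, hi⟩
      · exact (hw i hi).trans (hw' i hi).symm
    · rintro ⟨c, hc⟩
      have h0 : ∀ i ∉ σ, (fun i => if h : i ∈ σ then c ⟨i, h⟩ else 0) i = 0 := by
        intro i hi; simp [hi]
      have h1 := hext _ h0
      have h2 : (fun i : σ => (fun i => if h : i ∈ σ then c ⟨i, h⟩ else 0) (i : ι)) = c := by
        ext i; simp
      rw [h2, LinearMap.mem_ker.1 hc] at h1
      obtain ⟨w, hw⟩ := (hH _).2 h1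
      refine ⟨⟨w, fun i hi => ?_⟩, ?_⟩
      · rw [hw]; exact h0 i hi
      · apply Subtype.ext
        ext i
        change ev w i = _
        rw [hw]; simp
  have h1 := LinearMap.finrank_range_add_finrank_ker φ
  rw [hφ, ← toNat_eRk_vectorMatroid, ← (LinearEquiv.ofBijective ψ hψ).finrank_eq,
    Module.finrank_fintype_fun_eq_card, ← Set.toFinset_card, ← Set.ncard_eq_toFinset_card'] at h1
  rw [nullity]
  omega

theorem minNullSets_eq_complements {F W κ : Type*} [Field F] [Fintype F] [AddCommGroup W]
    [Module F W] [FiniteDimensional F W] {H : Matrix κ (Plane F) F}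
    {ev : W →ₗ[F] (Plane F → F)}
    (hH : IsParityCheckMatrix H (LinearMap.range ev)) (hev : Function.Injective ev) (i : ℕ) :
    minNullSets (vectorMatroid H) i = complements {X | Module.finrank F (vanishing ev X) = i ∧
      ∀ p ∉ X, ∃ w ∈ vanishing ev X, ev w p ≠ 0} := by
  have hN : ∀ σ, σ ∈ nullSets (vectorMatroid H) i ↔
      Module.finrank F (vanishing ev σᶜ) = i := fun σ => by
    simp [nullSets, vectorMatroid_ground, nullity_vectorMatroid hH hev]
  have key : ∀ X : Set (Plane F), Xᶜ ∈ minNullSets (vectorMatroid H) i ↔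
      Module.finrank F (vanishing ev X) = i ∧
      ∀ p ∉ X, ∃ w ∈ vanishing ev X, ev w p ≠ 0 := by
    intro X
    change (Xᶜ ∈ nullSets (vectorMatroid H) i ∧ ∀ ⦃τ⦄, τ ∈ nullSets (vectorMatroid H) i →
      τ ⊆ Xᶜ → Xᶜ ⊆ τ) ↔ _
    simp only [hN]
    rw [compl_compl]
    refine and_congr_right fun hi => ⟨fun h p hp => ?_, fun h => ?_⟩
    · by_contra! hcon
      have he : vanishing ev (insert p X) = vanishing ev X := by
        refine le_antisymm (vanishing_insert_le ev X p) fun w hw r hr => ?_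
        rcases Set.mem_insert_iff.1 hr with rfl | hr
        · exact hcon w hw
        · exact hw r hr
      have := h (τ := (insert p X)ᶜ) (by rw [compl_compl, he, hi])
        (Set.compl_subset_compl.2 (Set.subset_insert _ _))
      exact this hp (Set.mem_insert _ _)
    · intro τ hτ hle p hp
      by_contra hpt
      have h1 := finrank_vanishing_insert ev (h p hp)
      have h2 : insert p X ⊆ τᶜ := by
        refine Set.insert_subset hpt fun r hr hrt => hle hrt hr
      have h3 := Submodule.finrank_mono (vanishing_anti ev h2)
      omega
  ext σ
  rw [← compl_compl σ, key, complements, Set.mem_image]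
  refine ⟨fun h => ⟨_, h, rfl⟩, ?_⟩
  rintro ⟨X, hX, h⟩
  rwa [← compl_injective h]

theorem finrank_vanishing_eq_one_iff_maximal {F W : Type*} [Field F] [AddCommGroup W]
    [Module F W] [FiniteDimensional F W] {ev : W →ₗ[F] (ι → F)}
    (hev : Function.Injective ev) (X : Set ι) :
    (Module.finrank F (vanishing ev X) = 1 ∧ ∀ p ∉ X, ∃ w ∈ vanishing ev X, ev w p ≠ 0) ↔
      Maximal (fun Y => ∃ w, w ≠ 0 ∧ Y = {p | ev w p = 0}) X := by
  constructor
  · rintro ⟨h1, h2⟩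
    obtain ⟨⟨w, hw⟩, hw0, hspan⟩ := finrank_eq_one_iff'.1 h1
    have hw0' : w ≠ 0 := fun h => hw0 (Subtype.ext h)
    have hm : ∀ w' ∈ vanishing ev X, ∃ c : F, c • w = w' := fun w' hw' => by
      obtain ⟨c, hc⟩ := hspan ⟨w', hw'⟩
      exact ⟨c, congrArg Subtype.val hc⟩
    refine ⟨⟨w, hw0', ?_⟩, ?_⟩
    · refine Set.Subset.antisymm (fun p hp => hw p hp) fun p hp => ?_
      by_contra hpX
      obtain ⟨w', hw', hne⟩ := h2 p hpX
      obtain ⟨c, rfl⟩ := hm w' hw'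
      apply hne
      have : ev w p = 0 := hp
      simp [this]
    · rintro Y ⟨w', hw0'', rfl⟩ hXY p hp
      by_contra hpX
      obtain ⟨c, hc⟩ := hm w' fun r hr => hXY hr
      have hc0 : c ≠ 0 := by rintro rfl; simp at hc; exact hw0'' hc.symm
      obtain ⟨u, hu, hne⟩ := h2 p hpX
      obtain ⟨c', rfl⟩ := hm u hu
      apply hne
      have : ev w' p = 0 := hp
      rw [← hc] at this
      have h3 : ev w p = 0 := by simpa [hc0] using this
      simp [h3]
  · rintro ⟨⟨w, hw0, rfl⟩, hmax⟩
    have hw : w ∈ vanishing ev {p | ev w p = 0} := fun p hp => hp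
    refine ⟨?_, fun p hp => ⟨w, hw, hp⟩⟩
    obtain ⟨p, hp⟩ : ∃ p, ev w p ≠ 0 := by
      by_contra! h
      exact hw0 (hev (by ext p; simp [h p]))
    rw [finrank_eq_one_iff']
    refine ⟨⟨w, hw⟩, fun h => hw0 (congrArg Subtype.val h), ?_⟩
    rintro ⟨w', hw'⟩
    refine ⟨ev w' p / ev w p, Subtype.ext ?_⟩
    by_contra hne
    have hu0 : (ev w' p / ev w p) • w - w' ≠ 0 := sub_ne_zero.2 hne
    refine hp (hmax ⟨_, hu0, rfl⟩ (fun r hr => ?_) (a := p) ?_)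
    · have h1 := hw' r hr
      have h2 : ev w r = 0 := hr
      simp [h1, h2]
    · simp [hp]

end Nullity

/-- Coefficients of a quadratic polynomial `a x² + b x y + c y² + d x + e y + g`, grouped as
`((a, b, c), (d, e, g))`. -/
abbrev Coef (F : Type*) := (F × F × F) × (F × F × F)

section Forms

variable {F : Type*} [Field F]

/-- Evaluation of quadratic polynomials at the points of the affine plane. -/
def quadEval (F : Type*) [Field F] : Coef F →ₗ[F] (Plane F → F) where
  toFun w p := w.1.1 * p 0 ^ 2 + w.1.2.1 * p 0 * p 1 + w.1.2.2 * p 1 ^ 2 + w.2.1 * p 0 +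
    w.2.2.1 * p 1 + w.2.2.2
  map_add' w w' := by ext p; simp; ring
  map_smul' c w := by ext p; simp; ring

theorem quadEval_apply (w : Coef F) (p : Plane F) : quadEval F w p =
    w.1.1 * p 0 ^ 2 + w.1.2.1 * p 0 * p 1 + w.1.2.2 * p 1 ^ 2 + w.2.1 * p 0 +
    w.2.2.1 * p 1 + w.2.2.2 := rfl

/-- The zero set of a quadratic polynomial. -/
def quadZeros (w : Coef F) : Set (Plane F) := {p | quadEval F w p = 0}

theorem mem_quadZeros {w : Coef F} {p : Plane F} : p ∈ quadZeros w ↔ quadEval F w p = 0 := Iff.rfl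

/-- The value of the affine function with coefficients `u` at a point. -/
def linEval (u : F × F × F) (p : Plane F) : F := u.1 * p 0 + u.2.1 * p 1 + u.2.2

/-- The zero set of an affine function. -/
def lineSet (u : F × F × F) : Set (Plane F) := {p | linEval u p = 0}

theorem mem_lineSet {u : F × F × F} {p : Plane F} : p ∈ lineSet u ↔ linEval u p = 0 := Iff.rfl

/-- The coefficients of the product of two affine functions. -/
def mulCoef (u v : F × F × F) : Coef F :=
  ((u.1 * v.1, u.1 * v.2.1 + u.2.1 * v.1, u.2.1 * v.2.1),
    (u.1 * v.2.2 + u.2.2 * v.1, u.2.1 * v.2.2 + u.2.2 * v.2.1, u.2.2 * v.2.2))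

theorem quadEval_mulCoef (u v : F × F × F) (p : Plane F) :
    quadEval F (mulCoef u v) p = linEval u p * linEval v p := by
  simp only [quadEval_apply, mulCoef, linEval]; ring

theorem quadZeros_mulCoef (u v : F × F × F) :
    quadZeros (mulCoef u v) = lineSet u ∪ lineSet v := by
  ext p
  simp [mem_quadZeros, quadEval_mulCoef, mem_lineSet]

/-- Half the determinant of a ternary quadratic form. -/
def conicDet (w : Coef F) : F :=
  4 * w.1.1 * w.1.2.2 * w.2.2.2 + w.1.2.1 * w.2.1 * w.2.2.1 - w.1.1 * w.2.2.1 ^ 2 -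
    w.1.2.2 * w.2.1 ^ 2 - w.2.2.2 * w.1.2.1 ^ 2

theorem conicDet_mulCoef (u v : F × F × F) : conicDet (mulCoef u v) = 0 := by
  simp only [conicDet, mulCoef]; ring

open MvPolynomial

/-- The linear form with given coefficients. -/
noncomputable def linForm (u : F × F × F) : MvPolynomial (Fin 3) F :=
  C u.1 * X 0 + C u.2.1 * X 1 + C u.2.2 * X 2

/-- The quadratic form with given coefficients. -/
noncomputable def quadForm (w : Coef F) : MvPolynomial (Fin 3) F :=
  C w.1.1 * X 0 ^ 2 + C w.1.2.1 * (X 0 * X 1) + C w.1.2.2 * X 1 ^ 2 + C w.2.1 * (X 0 * X 2) +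
    C w.2.2.1 * (X 1 * X 2) + C w.2.2.2 * X 2 ^ 2

theorem eval_linForm (u : F × F × F) (x : Fin 3 → F) :
    eval x (linForm u) = u.1 * x 0 + u.2.1 * x 1 + u.2.2 * x 2 := by
  simp [linForm]

theorem eval_quadForm (w : Coef F) (x : Fin 3 → F) :
    eval x (quadForm w) = w.1.1 * x 0 ^ 2 + w.1.2.1 * (x 0 * x 1) + w.1.2.2 * x 1 ^ 2 +
      w.2.1 * (x 0 * x 2) + w.2.2.1 * (x 1 * x 2) + w.2.2.2 * x 2 ^ 2 := by
  simp [quadForm]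

theorem linForm_mul_linForm (u v : F × F × F) :
    linForm u * linForm v = quadForm (mulCoef u v) := by
  simp only [linForm, quadForm, mulCoef, map_add, map_mul]; ring

theorem linForm_isHomogeneous (u : F × F × F) : (linForm u).IsHomogeneous 1 :=
  ((isHomogeneous_C_mul_X _ _).add (isHomogeneous_C_mul_X _ _)).add (isHomogeneous_C_mul_X _ _)

theorem quadForm_isHomogeneous (w : Coef F) : (quadForm w).IsHomogeneous 2 := by
  have hm : ∀ i j : Fin 3, (X i * X j : MvPolynomial (Fin 3) F).IsHomogeneous 2 := fun i j =>
    (isHomogeneous_X _ i).mul (isHomogeneous_X _ j)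
  have hs : ∀ i : Fin 3, (X i ^ 2 : MvPolynomial (Fin 3) F).IsHomogeneous 2 := fun i =>
    isHomogeneous_X_pow i 2
  exact ((((((hs 0).C_mul _).add ((hm 0 1).C_mul _)).add ((hs 1).C_mul _)).add
    ((hm 0 2).C_mul _)).add ((hm 1 2).C_mul _)).add ((hs 2).C_mul _)

theorem monomial_fin_three (d : Fin 3 →₀ ℕ) (r : F) :
    monomial d r = C r * (X 0 ^ d 0 * X 1 ^ d 1 * X 2 ^ d 2) := by
  rw [monomial_eq, Finsupp.prod_fintype _ _ (by simp), Fin.prod_univ_three]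

theorem exists_quadForm_eq {Q : MvPolynomial (Fin 3) F} (hQ : Q.IsHomogeneous 2) :
    ∃ w, quadForm w = Q := by
  let φ : Coef F →+ MvPolynomial (Fin 3) F :=
    { toFun := quadForm
      map_zero' := by simp [quadForm]
      map_add' := fun w w' => by simp [quadForm]; ring }
  suffices Q ∈ AddMonoidHom.mrange φ from this
  rw [Q.as_sum]
  refine AddSubmonoid.sum_mem _ fun d hd => ?_
  have h2 := hQ (mem_support_iff.1 hd)
  rw [Finsupp.weight_apply, Finsupp.sum_fintype _ _ (by simp), Fin.sum_univ_three] at h2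
  simp only [Pi.one_apply, smul_eq_mul, mul_one] at h2
  rw [monomial_fin_three]
  generalize coeff d Q = r
  have h0 : d 0 ≤ 2 := by omega
  have h1 : d 1 ≤ 2 := by omega
  interval_cases hx : d 0 <;> interval_cases hy : d 1 <;> try omega
  · obtain hz : d 2 = 2 := by omega
    exact ⟨((0, 0, 0), (0, 0, r)), by simp [φ, quadForm, hz]⟩
  · obtain hz : d 2 = 1 := by omega
    exact ⟨((0, 0, 0), (0, r, 0)), by simp [φ, quadForm, hz]⟩
  · obtain hz : d 2 = 0 := by omega
    exact ⟨((0, 0, r), (0, 0, 0)), by simp [φ, quadForm, hz]⟩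
  · obtain hz : d 2 = 1 := by omega
    exact ⟨((0, 0, 0), (r, 0, 0)), by simp [φ, quadForm, hz]⟩
  · obtain hz : d 2 = 0 := by omega
    exact ⟨((0, r, 0), (0, 0, 0)), by simp [φ, quadForm, hz]⟩
  · obtain hz : d 2 = 0 := by omega
    exact ⟨((r, 0, 0), (0, 0, 0)), by simp [φ, quadForm, hz]⟩

theorem exists_linForm_eq {Q : MvPolynomial (Fin 3) F} (hQ : Q.IsHomogeneous 1) :
    ∃ u, linForm u = Q := by
  let φ : F × F × F →+ MvPolynomial (Fin 3) F :=
    { toFun := linForm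
      map_zero' := by simp [linForm]
      map_add' := fun w w' => by simp [linForm]; ring }
  suffices Q ∈ AddMonoidHom.mrange φ from this
  rw [Q.as_sum]
  refine AddSubmonoid.sum_mem _ fun d hd => ?_
  have h2 := hQ (mem_support_iff.1 hd)
  rw [Finsupp.weight_apply, Finsupp.sum_fintype _ _ (by simp), Fin.sum_univ_three] at h2
  simp only [Pi.one_apply, smul_eq_mul, mul_one] at h2
  rw [monomial_fin_three]
  generalize coeff d Q = r
  have h0 : d 0 ≤ 1 := by omega
  have h1 : d 1 ≤ 1 := by omega
  interval_cases hx : d 0 <;> interval_cases hy : d 1 <;> try omega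
  · obtain hz : d 2 = 1 := by omega
    exact ⟨(0, 0, r), by simp [φ, linForm, hz]⟩
  · obtain hz : d 2 = 0 := by omega
    exact ⟨(0, r, 0), by simp [φ, linForm, hz]⟩
  · obtain hz : d 2 = 0 := by omega
    exact ⟨(r, 0, 0), by simp [φ, linForm, hz]⟩

theorem linForm_eq_zero {u : F × F × F} : linForm u = 0 ↔ u = 0 := by
  refine ⟨fun h => ?_, fun h => by simp [h, linForm]⟩
  have hx := congrArg (eval ![1, 0, 0]) h
  have hy := congrArg (eval ![0, 1, 0]) h
  have hz := congrArg (eval ![0, 0, 1]) h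
  simp only [eval_linForm] at hx hy hz
  exact Prod.ext (by simpa using hx) (Prod.ext (by simpa using hy) (by simpa using hz))

theorem quadForm_eq_monomials (w : Coef F) : quadForm w =
    monomial (Finsupp.single 0 2) w.1.1 + monomial (Finsupp.single 0 1 + Finsupp.single 1 1) w.1.2.1
    + monomial (Finsupp.single 1 2) w.1.2.2 +
    monomial (Finsupp.single 0 1 + Finsupp.single 2 1) w.2.1 +
    monomial (Finsupp.single 1 1 + Finsupp.single 2 1) w.2.2.1 +
    monomial (Finsupp.single 2 2) w.2.2.2 := by
  simp [quadForm, X, monomial_pow, monomial_mul, C_mul_monomial]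

theorem quadForm_injective : Function.Injective (quadForm : Coef F → _) := by
  rintro ⟨⟨a, b, c⟩, d, e, g⟩ ⟨⟨a', b', c'⟩, d', e', g'⟩ h
  have h2 := fun s => congrArg (coeff s) h
  simp only [quadForm_eq_monomials, coeff_add, coeff_monomial] at h2
  have h00 := h2 (Finsupp.single 0 2)
  have h01 := h2 (Finsupp.single 0 1 + Finsupp.single 1 1)
  have h11 := h2 (Finsupp.single 1 2)
  have h02 := h2 (Finsupp.single 0 1 + Finsupp.single 2 1)
  have h12 := h2 (Finsupp.single 1 1 + Finsupp.single 2 1)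
  have h22 := h2 (Finsupp.single 2 2)
  simp [Finsupp.ext_iff, Fin.forall_fin_succ, Finsupp.single_apply] at h00 h01 h11 h02 h12 h22
  simp [h00, h01, h11, h02, h12, h22]

theorem quadForm_eq_zero {w : Coef F} : quadForm w = 0 ↔ w = 0 := by
  rw [← quadForm_injective.eq_iff (a := w)]
  simp [quadForm]

theorem isConicForm_iff {Q : MvPolynomial (Fin 3) F} :
    IsConicForm Q ↔ ∃ w ≠ 0, quadForm w = Q := by
  constructor
  · rintro ⟨h, h0⟩
    obtain ⟨w, rfl⟩ := exists_quadForm_eq h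
    exact ⟨w, fun hw => h0 (quadForm_eq_zero.2 hw), rfl⟩
  · rintro ⟨w, hw, rfl⟩
    exact ⟨quadForm_isHomogeneous w, fun h => hw (quadForm_eq_zero.1 h)⟩

theorem affineZeros_quadForm (w : Coef F) : affineZeros (quadForm w) = quadZeros w := by
  ext p
  simp only [affineZeros, quadZeros, Set.mem_ofPred_eq, eval_quadForm, quadEval_apply]
  simp [mul_assoc]

theorem conicZeroSets_eq : conicZeroSets F = {X | ∃ w, w ≠ 0 ∧ X = quadZeros w} := by
  ext X
  constructor
  · rintro ⟨Q, hQ, rfl⟩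
    obtain ⟨w, hw, rfl⟩ := isConicForm_iff.1 hQ
    exact ⟨w, hw, affineZeros_quadForm w⟩
  · rintro ⟨w, hw, rfl⟩
    exact ⟨quadForm w, isConicForm_iff.2 ⟨w, hw, rfl⟩, (affineZeros_quadForm w).symm⟩

theorem reedMuller_eq_range : reedMuller F = LinearMap.range (quadEval F) := by
  apply le_antisymm
  · rintro _ ⟨f, hf, rfl⟩
    rw [SetLike.mem_coe, mem_restrictTotalDegree] at hf
    rw [f.as_sum, map_sum]
    refine Submodule.sum_mem _ fun d hd => ?_
    have h2 := (le_totalDegree hd).trans hf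
    rw [Finsupp.sum_fintype _ _ (by simp), Fin.sum_univ_two] at h2
    generalize coeff d f = r
    have hev : evalMap F (monomial d r) = fun p => r * (p 0 ^ d 0 * p 1 ^ d 1) := by
      ext p
      simp [evalMap, aeval_monomial, Finsupp.prod_fintype, Fin.prod_univ_two]
    rw [hev]
    have h0 : d 0 ≤ 2 := by omega
    have h1 : d 1 ≤ 2 := by omega
    interval_cases hx : d 0 <;> interval_cases hy : d 1 <;> try omega
    · exact ⟨((0, 0, 0), (0, 0, r)), by ext; simp [quadEval_apply]⟩
    · exact ⟨((0, 0, 0), (0, r, 0)), by ext; simp [quadEval_apply]⟩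
    · exact ⟨((0, 0, r), (0, 0, 0)), by ext; simp [quadEval_apply]⟩
    · exact ⟨((0, 0, 0), (r, 0, 0)), by ext; simp [quadEval_apply]⟩
    · exact ⟨((0, r, 0), (0, 0, 0)), by ext; simp [quadEval_apply]; ring⟩
    · exact ⟨((r, 0, 0), (0, 0, 0)), by ext; simp [quadEval_apply]⟩
  · rintro _ ⟨w, rfl⟩
    refine ⟨C w.1.1 * X 0 ^ 2 + C w.1.2.1 * (X 0 * X 1) + C w.1.2.2 * X 1 ^ 2 + C w.2.1 * X 0 +
      C w.2.2.1 * X 1 + C w.2.2.2, ?_, ?_⟩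
    · rw [SetLike.mem_coe, mem_restrictTotalDegree]
      have hx : ∀ i : Fin 2, (X i : MvPolynomial (Fin 2) F).totalDegree = 1 := totalDegree_X
      have hm : ∀ (f : MvPolynomial (Fin 2) F) (r : F), f.totalDegree ≤ 2 →
          (C r * f).totalDegree ≤ 2 := fun f r hf =>
        (totalDegree_mul _ _).trans (by rw [totalDegree_C]; omega)
      have ha : ∀ (f g : MvPolynomial (Fin 2) F), f.totalDegree ≤ 2 → g.totalDegree ≤ 2 →
          (f + g).totalDegree ≤ 2 := fun f g hf hg =>
        (totalDegree_add _ _).trans (max_le hf hg)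
      refine ha _ _ (ha _ _ (ha _ _ (ha _ _ (ha _ _ (hm _ _ ?_) (hm _ _ ?_)) (hm _ _ ?_))
        (hm _ _ ?_)) (hm _ _ ?_)) ?_
      · exact (totalDegree_pow _ _).trans (by rw [hx])
      · exact (totalDegree_mul _ _).trans (by rw [hx, hx])
      · exact (totalDegree_pow _ _).trans (by rw [hx])
      · rw [hx]; omega
      · rw [hx]; omega
      · rw [totalDegree_C]; omega
    · ext p
      simp [evalMap, quadEval_apply, mul_assoc]

end Forms

section Irreducibility

open MvPolynomial

theorem not_isUnit_linForm {K : Type*} [Field K] (u : K × K × K) : ¬ IsUnit (linForm u) := by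
  intro h
  obtain ⟨r, hr, he⟩ := isUnit_iff_eq_C_of_isReduced.1 h
  have := congrArg (eval (0 : Fin 3 → K)) he
  rw [eval_linForm, eval_C] at this
  simp only [Pi.zero_apply, mul_zero, add_zero] at this
  exact hr.ne_zero this.symm

theorem irreducible_quadForm {K : Type*} [Field K] {w : Coef K} (hw : conicDet w ≠ 0) :
    Irreducible (quadForm w) := by
  have hw0 : w ≠ 0 := by
    rintro rfl
    simp [conicDet] at hw
  have hQ0 : quadForm w ≠ 0 := fun h => hw0 (quadForm_eq_zero.1 h)
  have hdeg := (quadForm_isHomogeneous w).totalDegree hQ0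
  refine ⟨fun h => ?_, fun f g hfg => ?_⟩
  · obtain ⟨r, hr, he⟩ := isUnit_iff_eq_C_of_isReduced.1 h
    rw [he, totalDegree_C] at hdeg
    omega
  · by_contra! hcon
    have hf0 : f ≠ 0 := by rintro rfl; simp at hfg; exact hQ0 hfg
    have hg0 : g ≠ 0 := by rintro rfl; simp at hfg; exact hQ0 hfg
    have hpos : ∀ f : MvPolynomial (Fin 3) K, f ≠ 0 → ¬ IsUnit f → f.totalDegree ≠ 0 := by
      intro f hf0 hf h
      rw [totalDegree_eq_zero_iff_eq_C] at h
      rw [h] at hf hf0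
      exact hf (IsUnit.map C (IsUnit.mk0 _ fun h => hf0 (by simp [h])))
    have hfp := hpos f hf0 hcon.1
    have hgp := hpos g hg0 hcon.2
    rw [hfg, totalDegree_mul_of_isDomain hf0 hg0] at hdeg
    have hsplit : ∀ f : MvPolynomial (Fin 3) K, f.totalDegree = 1 →
        ∃ u r, f = linForm u + C r := by
      intro f hf
      obtain ⟨u, hu⟩ := exists_linForm_eq (homogeneousComponent_isHomogeneous 1 f)
      refine ⟨u, coeff 0 f, ?_⟩
      have := sum_homogeneousComponent f
      rw [hf, Finset.sum_range_succ, Finset.sum_range_one, homogeneousComponent_zero] at this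
      rw [hu, add_comm, this]
    obtain ⟨u, r, rfl⟩ := hsplit f (by omega)
    obtain ⟨v, s, rfl⟩ := hsplit g (by omega)
    have h1 : (linForm u + C r) * (linForm v + C s) =
        linForm u * linForm v + (C s * linForm u + C r * linForm v) + C (r * s) := by
      rw [C_mul]; ring
    have h2 := congrArg (homogeneousComponent 2) hfg
    have hl : ∀ (c : K) (u : K × K × K), homogeneousComponent 2 (C c * linForm u) = 0 :=
      fun c u => by
        rw [homogeneousComponent_of_mem (n := 1) ((linForm_isHomogeneous u).C_mul c)]; rfl
    rw [h1, map_add, map_add, map_add, hl, hl, linForm_mul_linForm,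
      homogeneousComponent_of_mem (n := 2) (quadForm_isHomogeneous w),
      homogeneousComponent_of_mem (n := 2) (quadForm_isHomogeneous _),
      homogeneousComponent_of_mem (n := 0) (isHomogeneous_C _ _)] at h2
    simp only [if_true, add_zero, OfNat.ofNat_ne_zero, if_false] at h2
    exact hw (quadForm_injective h2 ▸ conicDet_mulCoef u v)

/-- A degenerate conic whose part at infinity is isotropic splits into two lines, unless it is a
pair of conjugate parallel lines. -/
theorem exists_mulCoef_or {K : Type*} [Field K] {w : Coef K} (hD : conicDet w = 0) {x y : K}
    (hxy : x ≠ 0 ∨ y ≠ 0) (hiso : w.1.1 * x ^ 2 + w.1.2.1 * x * y + w.1.2.2 * y ^ 2 = 0) :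
    (∃ u v, w = mulCoef u v) ∨ ∃ l m n α β : K, l ≠ 0 ∧ (∀ t, l * t ^ 2 + m * t + n ≠ 0) ∧
      w = ((l * α ^ 2, 2 * l * α * β, l * β ^ 2), (m * α, m * β, n)) := by
  obtain ⟨⟨a, b, c⟩, d, e, g⟩ := w
  simp only at hiso
  simp only [conicDet] at hD
  have hfac : ∃ γ δ : K, a = y * γ ∧ b = y * δ - x * γ ∧ c = -x * δ := by
    by_cases hx : x = 0
    · subst hx
      have hy : y ≠ 0 := by simpa using hxy
      refine ⟨a / y, b / y, by field_simp, by field_simp; ring, ?_⟩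
      simpa [hy] using hiso
    · refine ⟨(-c * y - b * x) / x ^ 2, -c / x, ?_, ?_, ?_⟩
      · field_simp
        linear_combination hiso
      · field_simp; ring
      · field_simp
  obtain ⟨γ, δ, rfl, rfl, rfl⟩ := hfac
  by_cases hdet : y * δ + x * γ = 0
  · have hl : ∃ l, γ = l * y ∧ δ = -l * x := by
      by_cases hx : x = 0
      · subst hx
        have hy : y ≠ 0 := by simpa using hxy
        refine ⟨γ / y, by field_simp, ?_⟩
        simpa [hy] using hdet
      · refine ⟨-δ / x, ?_, by field_simp⟩
        field_simp
        linear_combination hdet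
    obtain ⟨l, rfl, rfl⟩ := hl
    have h2 : l * (y * e + x * d) ^ 2 = 0 := by linear_combination -hD
    by_cases hl0 : l = 0
    · subst hl0
      exact Or.inl ⟨(0, 0, 1), (d, e, g), by simp [mulCoef]⟩
    have h3 : y * e + x * d = 0 := by simpa [hl0] using h2
    obtain ⟨m, rfl, rfl⟩ : ∃ m, d = m * y ∧ e = m * -x := by
      by_cases hx : x = 0
      · subst hx
        have hy : y ≠ 0 := by simpa using hxy
        refine ⟨d / y, by field_simp, ?_⟩
        simpa [hy] using h3
      · refine ⟨-e / x, ?_, by field_simp⟩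
        field_simp
        linear_combination h3
    by_cases hroot : ∃ t, l * t ^ 2 + m * t + g = 0
    · obtain ⟨t, ht⟩ := hroot
      refine Or.inl ⟨(y, -x, -t), (l * y, -l * x, l * t + m), ?_⟩
      simp only [mulCoef, Prod.mk.injEq]
      refine ⟨⟨trivial, by ring, trivial⟩, by ring, by ring, by linear_combination ht⟩
    · push Not at hroot
      refine Or.inr ⟨l, m, g, y, -x, hl0, hroot, ?_⟩
      simp only [Prod.mk.injEq]
      refine ⟨⟨by ring, by ring, by ring⟩, trivial⟩
  · obtain ⟨s, hs⟩ : ∃ s, (y * δ + x * γ) * s = 1 := ⟨_, mul_inv_cancel₀ hdet⟩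
    refine Or.inl ⟨(y, -x, (y * e + x * d) * s), (γ, δ, (d * δ - e * γ) * s), ?_⟩
    simp only [mulCoef, Prod.mk.injEq]
    refine ⟨⟨trivial, by ring, trivial⟩, ?_, ?_, ?_⟩
    · linear_combination -d * hs
    · linear_combination -e * hs
    · linear_combination -(g * (1 + s * (y * δ + x * γ))) * hs - s ^ 2 * hD

theorem irreducible_quadForm_iff {K : Type*} [Field K] [IsAlgClosed K] (w : Coef K) :
    Irreducible (quadForm w) ↔ conicDet w ≠ 0 := by
  refine ⟨fun h hD => ?_, irreducible_quadForm⟩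
  have hroot : ∀ l m n : K, l ≠ 0 → ∃ t, l * t ^ 2 + m * t + n = 0 := by
    intro l m n hl
    obtain ⟨t, ht⟩ := IsAlgClosed.exists_root
      (Polynomial.C l * Polynomial.X ^ 2 + Polynomial.C m * Polynomial.X + Polynomial.C n)
      (by rw [Polynomial.degree_quadratic hl]; decide)
    exact ⟨t, by simpa [Polynomial.IsRoot] using ht⟩
  obtain ⟨x, y, hxy, hiso⟩ : ∃ x y : K, (x ≠ 0 ∨ y ≠ 0) ∧
      w.1.1 * x ^ 2 + w.1.2.1 * x * y + w.1.2.2 * y ^ 2 = 0 := by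
    by_cases ha : w.1.1 = 0
    · exact ⟨1, 0, by simp, by simp [ha]⟩
    · obtain ⟨t, ht⟩ := hroot _ w.1.2.1 w.1.2.2 ha
      exact ⟨t, 1, by simp, by simpa using ht⟩
  rcases exists_mulCoef_or hD hxy hiso with ⟨u, v, rfl⟩ | ⟨l, m, n, α, β, hl, hno, -⟩
  · rw [← linForm_mul_linForm] at h
    exact (h.isUnit_or_isUnit rfl).elim (not_isUnit_linForm u) (not_isUnit_linForm v)
  · obtain ⟨t, ht⟩ := hroot l m n hl
    exact hno t ht

theorem isIrredConic_quadForm {F : Type*} [Field F] (w : Coef F) :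
    IsIrredConic (quadForm w) ↔ conicDet w ≠ 0 := by
  let i := algebraMap F (AlgebraicClosure F)
  have hmap : MvPolynomial.map i (quadForm w) =
      quadForm ((i w.1.1, i w.1.2.1, i w.1.2.2), (i w.2.1, i w.2.2.1, i w.2.2.2)) := by
    simp [quadForm]
  have hdet : conicDet ((i w.1.1, i w.1.2.1, i w.1.2.2), (i w.2.1, i w.2.2.1, i w.2.2.2)) =
      i (conicDet w) := by
    simp only [conicDet, map_sub, map_add, map_mul, map_pow, map_ofNat]
  have hi : i (conicDet w) ≠ 0 ↔ conicDet w ≠ 0 := by simp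
  rw [IsIrredConic, hmap, irreducible_quadForm_iff, hdet, hi]
  refine and_iff_right_of_imp fun h => isConicForm_iff.2 ⟨w, ?_, rfl⟩
  rintro rfl
  simp [conicDet] at h

end Irreducibility

section Infinity

open MvPolynomial

variable {F : Type*} [Field F]

theorem mk_mem_projZeros_linForm {u : F × F × F} {v : Fin 3 → F} (hv : v ≠ 0) :
    Projectivization.mk F v hv ∈ projZeros (linForm u) ↔ eval v (linForm u) = 0 := by
  obtain ⟨r, hr⟩ := Projectivization.exists_smul_eq_mk_rep F v hv
  have h : eval (Projectivization.mk F v hv).rep (linForm u) = r * eval v (linForm u) := by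
    rw [← hr]
    simp only [eval_linForm, Units.smul_def, Pi.smul_apply, smul_eq_mul]; ring
  rw [projZeros, Set.mem_ofPred_eq, h]
  simp

theorem mk_mem_projZeros_quadForm {w : Coef F} {v : Fin 3 → F} (hv : v ≠ 0) :
    Projectivization.mk F v hv ∈ projZeros (quadForm w) ↔ eval v (quadForm w) = 0 := by
  obtain ⟨r, hr⟩ := Projectivization.exists_smul_eq_mk_rep F v hv
  have h : eval (Projectivization.mk F v hv).rep (quadForm w) =
      r ^ 2 * eval v (quadForm w) := by
    rw [← hr]
    simp only [eval_quadForm, Units.smul_def, Pi.smul_apply, smul_eq_mul]; ring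
  rw [projZeros, Set.mem_ofPred_eq, h]
  simp

theorem lineAtInfinity_eq : lineAtInfinity F = projZeros (linForm (0, 0, 1)) := by
  ext P
  simp [lineAtInfinity, projZeros, eval_linForm]

theorem mk_mem_lineAtInfinity {v : Fin 3 → F} (hv : v ≠ 0) :
    Projectivization.mk F v hv ∈ lineAtInfinity F ↔ v 2 = 0 := by
  rw [lineAtInfinity_eq, mk_mem_projZeros_linForm, eval_linForm]
  simp

/-- Representatives of the directions in the plane. -/
def direction : Option F → F × F
  | none => (1, 0)
  | some t => (t, 1)

theorem direction_ne_zero (o : Option F) : (direction o).1 ≠ 0 ∨ (direction o).2 ≠ 0 := by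
  cases o <;> simp [direction]

theorem exists_eq_smul_direction {x y : F} (h : x ≠ 0 ∨ y ≠ 0) :
    ∃ (o : Option F) (r : F), r ≠ 0 ∧ x = r * (direction o).1 ∧ y = r * (direction o).2 := by
  by_cases hy : y = 0
  · exact ⟨none, x, by simpa [hy] using h, by simp [direction], by simp [direction, hy]⟩
  · exact ⟨some (x / y), y, hy, by simp [direction]; field_simp, by simp [direction]⟩

theorem direction_det_injective {o o' : Option F}
    (h : (direction o).1 * (direction o').2 = (direction o).2 * (direction o').1) : o = o' := by
  cases o <;> cases o' <;> simp_all [direction]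

/-- The value of the leading binary form of a quadratic polynomial. -/
def leadEval (w : Coef F) (x y : F) : F := w.1.1 * x ^ 2 + w.1.2.1 * x * y + w.1.2.2 * y ^ 2

/-- The directions of the points of a conic on the line at infinity. -/
def infinityRoots (w : Coef F) : Set (Option F) :=
  {o | leadEval w (direction o).1 (direction o).2 = 0}

theorem ncard_projZeros_inter_lineAtInfinity (w : Coef F) :
    (projZeros (quadForm w) ∩ lineAtInfinity F).ncard = (infinityRoots w).ncard := by
  have hne : ∀ o : Option F, (![(direction o).1, (direction o).2, 0] : Fin 3 → F) ≠ 0 := by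
    intro o h
    have h0 := congrFun h 0
    have h1 := congrFun h 1
    rcases direction_ne_zero o with h2 | h2
    · exact h2 h0
    · exact h2 h1
  let pt : Option F → Projectivization F (Fin 3 → F) := fun o => Projectivization.mk F _ (hne o)
  have hinj : Function.Injective pt := by
    intro o o' h
    rw [Projectivization.mk_eq_mk_iff'] at h
    obtain ⟨r, hr⟩ := h
    have h0 := congrFun hr 0
    have h1 := congrFun hr 1
    simp at h0 h1
    apply direction_det_injective
    rw [← h0, ← h1]; ring
  rw [← Set.ncard_image_of_injective _ hinj]
  congr 1
  ext P
  constructor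
  · induction P with | h v hv
    rintro ⟨h1, h2⟩
    rw [mk_mem_lineAtInfinity] at h2
    rw [mk_mem_projZeros_quadForm] at h1
    have hv' : v 0 ≠ 0 ∨ v 1 ≠ 0 := by
      by_contra! h
      apply hv
      ext i
      fin_cases i
      · exact h.1
      · exact h.2
      · exact h2
    obtain ⟨o, r, hr, h0, h3⟩ := exists_eq_smul_direction hv'
    refine ⟨o, ?_, ?_⟩
    · rw [eval_quadForm, h0, h3, h2] at h1
      have : r ^ 2 * leadEval w (direction o).1 (direction o).2 = 0 := by
        rw [leadEval]; linear_combination h1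
      exact (mul_eq_zero.1 this).resolve_left (pow_ne_zero 2 hr)
    · rw [Projectivization.mk_eq_mk_iff']
      refine ⟨r⁻¹, ?_⟩
      ext i
      fin_cases i
      · simp [h0, hr]
      · simp [h3, hr]
      · simp [h2]
  · rintro ⟨o, ho, rfl⟩
    refine ⟨?_, ?_⟩
    · rw [mk_mem_projZeros_quadForm, eval_quadForm]
      have : leadEval w (direction o).1 (direction o).2 = 0 := ho
      rw [leadEval] at this
      simp; linear_combination this
    · rw [mk_mem_lineAtInfinity]; rfl

theorem irredConicSets_eq (k : ℕ) : irredConicSets F k =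
    quadZeros '' {w | conicDet w ≠ 0 ∧ (infinityRoots w).ncard = k} := by
  ext X
  constructor
  · rintro ⟨Q, hQ, hk, rfl⟩
    obtain ⟨w, hw, rfl⟩ := isConicForm_iff.1 hQ.1
    exact ⟨w, ⟨(isIrredConic_quadForm w).1 hQ,
      (ncard_projZeros_inter_lineAtInfinity w).symm.trans hk⟩, (affineZeros_quadForm w).symm⟩
  · rintro ⟨w, ⟨hw, hk⟩, rfl⟩
    exact ⟨quadForm w, (isIrredConic_quadForm w).2 hw,
      (ncard_projZeros_inter_lineAtInfinity w).trans hk, (affineZeros_quadForm w).symm⟩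

end Infinity

theorem card_plane {F : Type*} [Fintype F] : Fintype.card (Plane F) = Fintype.card F ^ 2 := by
  simp

section Cardinalities

variable {F : Type*} [Field F]

/-- The discriminant of the leading binary form. -/
def leadDisc (w : Coef F) : F := w.1.2.1 ^ 2 - 4 * w.1.1 * w.1.2.2

theorem lead_ne_zero_of_conicDet {w : Coef F} (h : conicDet w ≠ 0) : w.1 ≠ 0 := by
  intro h0
  apply h
  simp [conicDet, h0]

theorem infinityRoots_cases [Finite F] {w : Coef F} (hw : w.1 ≠ 0) :
    (infinityRoots w = ∅ ∧ leadDisc w ≠ 0) ∨ (∃ o, infinityRoots w = {o} ∧ leadDisc w = 0) ∨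
      ∃ o o', o ≠ o' ∧ infinityRoots w = {o, o'} ∧ leadDisc w ≠ 0 := by
  obtain ⟨⟨a, b, c⟩, r⟩ := w
  have hnone : none ∈ infinityRoots ((a, b, c), r) ↔ a = 0 := by
    simp [infinityRoots, direction, leadEval]
  have hsome : ∀ t, some t ∈ infinityRoots ((a, b, c), r) ↔ a * t ^ 2 + b * t + c = 0 := by
    simp [infinityRoots, direction, leadEval]
  simp only [leadDisc]
  by_cases ha : a = 0
  · subst ha
    by_cases hb : b = 0
    · subst hb
      have hc : c ≠ 0 := by rintro rfl; exact hw rfl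
      refine Or.inr (Or.inl ⟨none, ?_, by ring⟩)
      ext (_ | t)
      · simp [hnone]
      · simp [hsome, hc]
    · refine Or.inr (Or.inr ⟨none, some (-c / b), by simp, ?_, by simpa using hb⟩)
      ext (_ | t)
      · simp [hnone]
      · simp only [hsome, Set.mem_insert_iff, Set.mem_singleton_iff, reduceCtorEq, false_or,
          Option.some.injEq]
        rw [eq_div_iff hb]
        constructor <;> intro h <;> linear_combination h
  · by_cases hex : ∃ t, a * t ^ 2 + b * t + c = 0
    · obtain ⟨t, ht⟩ := hex
      have hroots : infinityRoots ((a, b, c), r) = {some t, some (-b / a - t)} := by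
        ext (_ | s)
        · simp [hnone, ha]
        · simp only [hsome, Set.mem_insert_iff, Set.mem_singleton_iff, Option.some.injEq]
          have h1 : a * s ^ 2 + b * s + c = a * ((s - t) * (s - (-b / a - t))) := by
            field_simp
            linear_combination ht
          rw [h1]
          simp [ha, sub_eq_zero]
      have hdisc : b ^ 2 - 4 * a * c = (2 * a * t + b) ^ 2 := by linear_combination -4 * a * ht
      by_cases h0 : 2 * a * t + b = 0
      · refine Or.inr (Or.inl ⟨some t, ?_, by rw [hdisc, h0]; ring⟩)
        have : -b / a - t = t := by
          field_simp
          linear_combination -h0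
        rw [hroots, this, Set.pair_eq_singleton]
      · refine Or.inr (Or.inr ⟨some t, _, ?_, hroots, by rw [hdisc]; exact pow_ne_zero 2 h0⟩)
        intro h
        rw [Option.some.injEq] at h
        apply h0
        field_simp at h
        linear_combination h
    · refine Or.inl ⟨?_, fun h0 => hex ?_⟩
      · ext (_ | s)
        · simp [hnone, ha]
        · simp only [hsome, Set.mem_empty_iff_false, iff_false]
          exact fun h => hex ⟨s, h⟩
      · by_cases h2 : (2 : F) = 0
        · have hchar : ringChar F = 2 := by
            have := (ringChar.spec F 2).1 (by exact_mod_cast h2)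
            exact ((Nat.prime_dvd_prime_iff_eq (CharP.char_is_prime F (ringChar F))
              Nat.prime_two).1 this)
          have hb : b = 0 := by
            have : b ^ 2 = 0 := by linear_combination h0 + 2 * a * c * h2
            simpa using this
          obtain ⟨t, ht⟩ := FiniteField.isSquare_of_char_two hchar (-c / a)
          refine ⟨t, ?_⟩
          rw [hb, sq, ← ht]
          field_simp
          ring
        · refine ⟨-b / (2 * a), ?_⟩
          field_simp
          linear_combination -h0

/-- The partial derivative of a quadratic polynomial with respect to the first variable. -/
def gradX (w : Coef F) (p : Plane F) : F := 2 * w.1.1 * p 0 + w.1.2.1 * p 1 + w.2.1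

/-- The partial derivative of a quadratic polynomial with respect to the second variable. -/
def gradY (w : Coef F) (p : Plane F) : F := w.1.2.1 * p 0 + 2 * w.1.2.2 * p 1 + w.2.2.1

theorem quadEval_add_smul (w : Coef F) (p : Plane F) (x y t : F) :
    quadEval F w ![p 0 + t * x, p 1 + t * y] =
      quadEval F w p + t * (gradX w p * x + gradY w p * y) + t ^ 2 * leadEval w x y := by
  simp only [quadEval_apply, gradX, gradY, leadEval, Matrix.cons_val_zero, Matrix.cons_val_one]
  ring

theorem conicDet_translate (w : Coef F) (p : Plane F) :
    conicDet w = -leadDisc w * quadEval F w p + w.1.2.1 * gradX w p * gradY w p -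
      w.1.1 * gradY w p ^ 2 - w.1.2.2 * gradX w p ^ 2 := by
  simp only [conicDet, leadDisc, quadEval_apply, gradX, gradY]
  ring

theorem conicDet_eq_zero_of_grad {w : Coef F} {p : Plane F} {x y : F} (hxy : x ≠ 0 ∨ y ≠ 0)
    (hl : leadEval w x y = 0) (hg : gradX w p * x + gradY w p * y = 0)
    (hp : leadDisc w * quadEval F w p = 0) : conicDet w = 0 := by
  have h := conicDet_translate w p
  have hp' : -leadDisc w * quadEval F w p = 0 := by linear_combination -hp
  rw [hp'] at h
  rw [leadEval] at hl
  generalize gradX w p = A at *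
  generalize gradY w p = E at *
  rcases hxy with hx | hy
  · have : x ^ 2 * conicDet w = 0 := by
      rw [h]
      linear_combination (w.1.2.1 * E * x - w.1.2.2 * (A * x - E * y)) * hg - E ^ 2 * hl
    simpa [hx] using this
  · have : y ^ 2 * conicDet w = 0 := by
      rw [h]
      linear_combination (w.1.2.1 * A * y - w.1.1 * (E * y - A * x)) * hg - A ^ 2 * hl
    simpa [hy] using this

variable [Fintype F]

/-- The points of a proper line are parametrized by the field. -/
theorem ncard_lineSet {u : F × F × F} (hu : u.1 ≠ 0 ∨ u.2.1 ≠ 0) :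
    (lineSet u).ncard = Fintype.card F := by
  obtain ⟨a, b, c⟩ := u
  obtain ⟨p, hp⟩ : ∃ p : Plane F, a * p 0 + b * p 1 + c = 0 := by
    rcases hu with h | h
    · exact ⟨![-c / a, 0], by simp at h ⊢; field_simp; ring⟩
    · exact ⟨![0, -c / b], by simp at h ⊢; field_simp; ring⟩
  let φ : F → Plane F := fun t => ![p 0 + t * -b, p 1 + t * a]
  have hinj : Function.Injective φ := by
    intro t s h
    have h0 : p 0 + t * -b = p 0 + s * -b := congrFun h 0
    have h1 : p 1 + t * a = p 1 + s * a := congrFun h 1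
    rcases hu with h2 | h2
    · exact mul_right_cancel₀ h2 (add_left_cancel h1)
    · exact mul_right_cancel₀ (neg_ne_zero.2 h2) (add_left_cancel h0)
  have himg : lineSet (a, b, c) = φ '' Set.univ := by
    ext r
    simp only [mem_lineSet, linEval, Set.image_univ, Set.mem_range]
    constructor
    · intro h
      have h' : a * (r 0 - p 0) + b * (r 1 - p 1) = 0 := by linear_combination h - hp
      by_cases ha : a = 0
      · have hb : b ≠ 0 := by simpa [ha] using hu
        refine ⟨(r 0 - p 0) / -b, ?_⟩
        have : r 1 = p 1 := by simpa [ha, hb, sub_eq_zero] using h'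
        ext i
        fin_cases i
        · simp [φ]; field_simp; ring
        · simp [φ, ha, this]
      · refine ⟨(r 1 - p 1) / a, ?_⟩
        ext i
        fin_cases i
        · simp [φ]; field_simp; linear_combination -h'
        · simp [φ]; field_simp; ring
    · rintro ⟨t, rfl⟩
      simp [φ]
      linear_combination hp
  rw [himg, Set.ncard_image_of_injective _ hinj, Set.ncard_univ, Nat.card_eq_fintype_card]

theorem ncard_compl_lineSet {u : F × F × F} (hu : u.1 ≠ 0 ∨ u.2.1 ≠ 0) :
    (lineSet u)ᶜ.ncard = Fintype.card F ^ 2 - Fintype.card F := by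
  rw [Set.ncard_compl, ncard_lineSet hu, Nat.card_eq_fintype_card, card_plane]

theorem ncard_quadZeros_mul {w : Coef F} (hw : conicDet w ≠ 0) {x y : F} (hxy : x ≠ 0 ∨ y ≠ 0)
    (hl : leadEval w x y = 0) :
    (quadZeros w).ncard * Fintype.card F =
      {p | gradX w p * x + gradY w p * y ≠ 0}.ncard := by
  rw [← Nat.card_eq_fintype_card, ← Set.ncard_univ, ← Set.ncard_prod]
  have hgrad : ∀ (p : Plane F) (t : F),
      gradX w ![p 0 + t * x, p 1 + t * y] * x + gradY w ![p 0 + t * x, p 1 + t * y] * y =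
        gradX w p * x + gradY w p * y := by
    intro p t
    rw [leadEval] at hl
    simp only [gradX, gradY, Matrix.cons_val_zero, Matrix.cons_val_one]
    linear_combination 2 * t * hl
  refine Set.ncard_congr (fun s _ => ![s.1 0 + s.2 * x, s.1 1 + s.2 * y]) ?_ ?_ ?_
  · rintro ⟨p, t⟩ ⟨hp, -⟩
    simp only [Set.mem_ofPred_eq]
    rw [hgrad]
    intro h
    have hp' : quadEval F w p = 0 := hp
    exact hw (conicDet_eq_zero_of_grad hxy hl h (by rw [hp', mul_zero]))
  · rintro ⟨p, t⟩ ⟨r, s⟩ ⟨hp, -⟩ ⟨hr, -⟩ h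
    simp only at h
    have hp' : quadEval F w p = 0 := hp
    have hr' : quadEval F w r = 0 := hr
    have h1 := quadEval_add_smul w p x y t
    have h2 := quadEval_add_smul w r x y s
    have h3 := hgrad p t
    have h4 := hgrad r s
    rw [h] at h1 h3
    rw [h2, hp', hr', hl, ← h3, ← h4] at h1
    have hne : gradX w ![r 0 + s * x, r 1 + s * y] * x +
        gradY w ![r 0 + s * x, r 1 + s * y] * y ≠ 0 := by
      rw [h4]
      exact fun h => hw (conicDet_eq_zero_of_grad hxy hl h (by rw [hr', mul_zero]))
    have hts : t = s := by
      have : (t - s) * (gradX w ![r 0 + s * x, r 1 + s * y] * x +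
        gradY w ![r 0 + s * x, r 1 + s * y] * y) = 0 := by linear_combination -h1
      exact sub_eq_zero.1 ((mul_eq_zero.1 this).resolve_right hne)
    subst hts
    have h0 : p 0 + t * x = r 0 + t * x := congrFun h 0
    have h5 : p 1 + t * y = r 1 + t * y := congrFun h 1
    refine Prod.ext ?_ rfl
    ext i
    fin_cases i
    · exact add_right_cancel h0
    · exact add_right_cancel h5
  · intro r hr
    have hr' : gradX w r * x + gradY w r * y ≠ 0 := hr
    set t := quadEval F w r / (gradX w r * x + gradY w r * y) with ht
    refine ⟨(![r 0 + -t * x, r 1 + -t * y], t), ⟨?_, trivial⟩, ?_⟩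
    · rw [mem_quadZeros, quadEval_add_smul, hl, ht]
      field_simp
      ring
    · ext i
      fin_cases i <;> simp

theorem quadZeros_nonempty {w : Coef F} (h : infinityRoots w = ∅) : (quadZeros w).Nonempty := by
  classical
  obtain ⟨p, hp⟩ := CharP.exists F
  have hdeg : (quadForm w).totalDegree < Fintype.card (Fin 3) :=
    ((quadForm_isHomogeneous w).totalDegree_le).trans_lt (by simp)
  have hdvd := char_dvd_card_solutions p hdeg
  have hp1 : p ≠ 1 := CharP.char_ne_one F p
  obtain ⟨⟨v, hv⟩, hv0⟩ : ∃ v : {x // MvPolynomial.eval x (quadForm w) = 0},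
      v ≠ ⟨0, by rw [eval_quadForm]; simp⟩ := by
    by_contra! hcon
    have : Fintype.card {x // MvPolynomial.eval x (quadForm w) = 0} = 1 :=
      Fintype.card_eq_one_iff.2 ⟨_, hcon⟩
    rw [this] at hdvd
    exact hp1 (Nat.dvd_one.1 hdvd)
  have hv0' : v ≠ 0 := fun h => hv0 (Subtype.ext h)
  rw [eval_quadForm] at hv
  by_cases h2 : v 2 = 0
  · exfalso
    have hv' : v 0 ≠ 0 ∨ v 1 ≠ 0 := by
      by_contra! h
      apply hv0'
      ext i
      fin_cases i
      · exact h.1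
      · exact h.2
      · exact h2
    obtain ⟨o, r, hr, h0, h3⟩ := exists_eq_smul_direction hv'
    have ho : o ∈ infinityRoots w := by
      have : r ^ 2 * leadEval w (direction o).1 (direction o).2 = 0 := by
        rw [leadEval]
        rw [h0, h3, h2] at hv
        linear_combination hv
      exact (mul_eq_zero.1 this).resolve_left (pow_ne_zero 2 hr)
    rw [h] at ho
    exact ho
  · refine ⟨![v 0 / v 2, v 1 / v 2], ?_⟩
    simp only [mem_quadZeros, quadEval_apply, Matrix.cons_val_zero, Matrix.cons_val_one]
    field_simp
    linear_combination hv

theorem ncard_quadZeros_of_infinityRoots_empty {w : Coef F} (hw : conicDet w ≠ 0)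
    (h : infinityRoots w = ∅) : (quadZeros w).ncard = Fintype.card F + 1 := by
  obtain ⟨P, hP⟩ := quadZeros_nonempty h
  rw [mem_quadZeros] at hP
  have hl : ∀ o, leadEval w (direction o).1 (direction o).2 ≠ 0 := fun o ho => by
    have : o ∈ infinityRoots w := ho
    rw [h] at this
    exact this
  let B : Option F → F := fun o => gradX w P * (direction o).1 + gradY w P * (direction o).2
  let s : Option F → F := fun o => -B o / leadEval w (direction o).1 (direction o).2
  let φ : Option F → Plane F := fun o =>
    ![P 0 + s o * (direction o).1, P 1 + s o * (direction o).2]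
  have hgrad : gradX w P = 0 → gradY w P = 0 → False := fun h1 h2 => by
    apply hw
    rw [conicDet_translate w P, hP, h1, h2]
    ring
  have hinj : Function.Injective φ := by
    intro o o' hoo
    have h0 : P 0 + s o * (direction o).1 = P 0 + s o' * (direction o').1 := congrFun hoo 0
    have h1 : P 1 + s o * (direction o).2 = P 1 + s o' * (direction o').2 := congrFun hoo 1
    have h0' := add_left_cancel h0
    have h1' := add_left_cancel h1
    by_contra hne
    have hdet : (direction o).1 * (direction o').2 - (direction o).2 * (direction o').1 ≠ 0 :=
      fun h => hne (direction_det_injective (sub_eq_zero.1 h))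
    have hs : s o = 0 := by
      have : s o * ((direction o).1 * (direction o').2 - (direction o).2 * (direction o').1) = 0 := by
        linear_combination (direction o').2 * h0' - (direction o').1 * h1'
      exact (mul_eq_zero.1 this).resolve_right hdet
    have hs' : s o' = 0 := by
      have : s o' * ((direction o).1 * (direction o').2 - (direction o).2 * (direction o').1) = 0 := by
        linear_combination (direction o).2 * h0' - (direction o).1 * h1'
      exact (mul_eq_zero.1 this).resolve_right hdet
    have hB : B o = 0 := by simpa [s, hl] using hs
    have hB' : B o' = 0 := by simpa [s, hl] using hs'
    simp only [B] at hB hB'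
    refine hgrad ?_ ?_
    · refine (mul_eq_zero.1 (?_ : gradX w P * _ = 0)).resolve_right hdet
      linear_combination (direction o').2 * hB - (direction o).2 * hB'
    · refine (mul_eq_zero.1 (?_ : gradY w P * _ = 0)).resolve_right hdet
      linear_combination -(direction o').1 * hB + (direction o).1 * hB'
  have himg : quadZeros w = φ '' Set.univ := by
    ext r
    simp only [Set.image_univ, Set.mem_range, mem_quadZeros]
    constructor
    · intro hr
      by_cases hrP : r = P
      · obtain ⟨o, ho⟩ : ∃ o, B o = 0 := by
          by_cases hA : gradX w P = 0
          · exact ⟨none, by simp [B, direction, hA]⟩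
          · exact ⟨some (-gradY w P / gradX w P), by simp [B, direction]; field_simp; ring⟩
        refine ⟨o, ?_⟩
        rw [hrP]
        ext i
        fin_cases i <;> simp [φ, s, ho]
      · have hne : r 0 - P 0 ≠ 0 ∨ r 1 - P 1 ≠ 0 := by
          by_contra! h
          apply hrP
          ext i
          fin_cases i
          · exact sub_eq_zero.1 h.1
          · exact sub_eq_zero.1 h.2
        obtain ⟨o, c, hc, h0, h1⟩ := exists_eq_smul_direction hne
        have hr2 : r = ![P 0 + c * (direction o).1, P 1 + c * (direction o).2] := by
          ext i
          fin_cases i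
          · simp [← h0]
          · simp [← h1]
        rw [hr2, quadEval_add_smul, hP] at hr
        have hcs : c = s o := by
          have : B o + c * leadEval w (direction o).1 (direction o).2 = 0 := by
            refine (mul_eq_zero.1 (?_ : c * _ = 0)).resolve_left hc
            simp only [B]
            linear_combination hr
          simp only [s]
          rw [eq_div_iff (hl o)]
          linear_combination this
        exact ⟨o, by rw [hr2, hcs]⟩
    · rintro ⟨o, rfl⟩
      simp only [φ]
      rw [quadEval_add_smul, hP]
      have := hl o
      change 0 + s o * B o + s o ^ 2 * _ = 0
      simp only [s]
      field_simp
      ring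
  rw [himg, Set.ncard_image_of_injective _ hinj, Set.ncard_univ, Nat.card_eq_fintype_card,
    Fintype.card_option]

/-- An irreducible conic with `k` points at infinity has `q + 1 - k` affine points. -/
theorem ncard_quadZeros_add {w : Coef F} (hw : conicDet w ≠ 0) :
    (quadZeros w).ncard + (infinityRoots w).ncard = Fintype.card F + 1 := by
  have hq := Fintype.card_pos (α := F)
  have hB : ∀ x y : F, ∀ p : Plane F, gradX w p * x + gradY w p * y =
      linEval (2 * w.1.1 * x + w.1.2.1 * y, w.1.2.1 * x + 2 * w.1.2.2 * y,
        w.2.1 * x + w.2.2.1 * y) p := by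
    intro x y p
    simp only [gradX, gradY, linEval]; ring
  rcases infinityRoots_cases (lead_ne_zero_of_conicDet hw) with
    ⟨h, hd⟩ | ⟨o, h, hd⟩ | ⟨o, o', hne, h, hd⟩
  · rw [ncard_quadZeros_of_infinityRoots_empty hw h, h, Set.ncard_empty]
  · have hl : leadEval w (direction o).1 (direction o).2 = 0 :=
      (h ▸ Set.mem_singleton o : o ∈ infinityRoots w)
    have h1 := ncard_quadZeros_mul hw (direction_ne_zero o) hl
    have h2 : {p | gradX w p * (direction o).1 + gradY w p * (direction o).2 ≠ 0} = Set.univ :=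
      Set.eq_univ_of_forall fun p h0 => hw
        (conicDet_eq_zero_of_grad (direction_ne_zero o) hl h0 (by rw [hd, zero_mul]))
    rw [h2, Set.ncard_univ, Nat.card_eq_fintype_card, card_plane, sq] at h1
    rw [Nat.eq_of_mul_eq_mul_right hq h1, h, Set.ncard_singleton]
  · have hl : leadEval w (direction o).1 (direction o).2 = 0 :=
      (h ▸ Set.mem_insert o _ : o ∈ infinityRoots w)
    have h1 := ncard_quadZeros_mul hw (direction_ne_zero o) hl
    have h2 : {p | gradX w p * (direction o).1 + gradY w p * (direction o).2 ≠ 0} =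
        (lineSet (2 * w.1.1 * (direction o).1 + w.1.2.1 * (direction o).2,
          w.1.2.1 * (direction o).1 + 2 * w.1.2.2 * (direction o).2,
          w.2.1 * (direction o).1 + w.2.2.1 * (direction o).2))ᶜ := by
      ext p
      simp only [Set.mem_ofPred_eq, Set.mem_compl_iff, mem_lineSet]
      rw [hB]
    rw [h2, ncard_compl_lineSet, sq, ← Nat.sub_one_mul] at h1
    · rw [Nat.eq_of_mul_eq_mul_right hq h1, h, Set.ncard_pair hne]
      omega
    · by_contra! hcon
      obtain ⟨hα, hβ⟩ := hcon
      simp only at hα hβ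
      apply hd
      rw [leadDisc]
      rcases direction_ne_zero o with hx | hx
      · refine (mul_eq_zero.1 (?_ : (direction o).1 * _ = 0)).resolve_left hx
        linear_combination w.1.2.1 * hβ - 2 * w.1.2.2 * hα
      · refine (mul_eq_zero.1 (?_ : (direction o).2 * _ = 0)).resolve_left hx
        linear_combination w.1.2.1 * hα - 2 * w.1.1 * hβ

end Cardinalities

theorem plane_ext {F : Type*} {p r : Plane F} (h0 : p 0 = r 0) (h1 : p 1 = r 1) : p = r := by
  ext i
  fin_cases i
  · exact h0
  · exact h1

section Separation

variable {F : Type*} [Field F]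

/-- A degenerate conic splits into two rational lines or has at most one affine point. -/
theorem exists_mulCoef_or_subsingleton [Finite F] {w : Coef F} (hw : conicDet w = 0) :
    (∃ u v, w = mulCoef u v) ∨ (quadZeros w).Subsingleton := by
  have of_iso : ∀ o, leadEval w (direction o).1 (direction o).2 = 0 →
      (∃ u v, w = mulCoef u v) ∨ (quadZeros w).Subsingleton := by
    intro o ho
    rcases exists_mulCoef_or hw (direction_ne_zero o) ho with h | ⟨l, m, n, α, β, -, h, rfl⟩
    · exact Or.inl h
    · right
      intro p hp
      exfalso
      apply h (α * p 0 + β * p 1)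
      have hp' : quadEval F _ p = 0 := hp
      rw [quadEval_apply] at hp'
      linear_combination hp'
  by_cases h1 : w.1 = 0
  · exact of_iso none (by simp [leadEval, h1])
  rcases infinityRoots_cases h1 with ⟨h, hd⟩ | ⟨o, h, -⟩ | ⟨o, o', -, h, -⟩
  · right
    have grad0 : ∀ p ∈ quadZeros w, gradX w p = 0 ∧ gradY w p = 0 := by
      intro p hp
      have hp' : quadEval F w p = 0 := hp
      have h2 := conicDet_translate w p
      rw [hw, hp'] at h2
      by_contra hcon
      have hne : -gradY w p ≠ 0 ∨ gradX w p ≠ 0 := by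
        by_contra! h3
        exact hcon ⟨h3.2, neg_eq_zero.1 h3.1⟩
      obtain ⟨o, r, hr, h0, h1⟩ := exists_eq_smul_direction hne
      have ho : o ∈ infinityRoots w := by
        have h3 : leadEval w (-gradY w p) (gradX w p) = 0 := by
          rw [leadEval]; linear_combination h2
        have : r ^ 2 * leadEval w (direction o).1 (direction o).2 = 0 := by
          rw [h0, h1] at h3
          simp only [leadEval] at h3 ⊢
          linear_combination h3
        exact (mul_eq_zero.1 this).resolve_left (pow_ne_zero 2 hr)
      rw [h] at ho
      exact ho
    intro p hp r hr
    obtain ⟨h1, h2⟩ := grad0 p hp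
    obtain ⟨h3, h4⟩ := grad0 r hr
    simp only [gradX, gradY] at h1 h2 h3 h4
    rw [leadDisc] at hd
    ext i
    rw [← sub_eq_zero]
    refine (mul_eq_zero.1 (?_ : (w.1.2.1 ^ 2 - 4 * w.1.1 * w.1.2.2) * _ = 0)).resolve_left hd
    fin_cases i <;> simp only [Fin.zero_eta, Fin.mk_one, Fin.isValue]
    · linear_combination w.1.2.1 * (h2 - h4) - 2 * w.1.2.2 * (h1 - h3)
    · linear_combination w.1.2.1 * (h1 - h3) - 2 * w.1.1 * (h2 - h4)
  · exact of_iso o (h ▸ Set.mem_singleton o : o ∈ infinityRoots w)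
  · exact of_iso o (h ▸ Set.mem_insert o _ : o ∈ infinityRoots w)

theorem plane_ne {p r : Plane F} (h : p ≠ r) : r 0 - p 0 ≠ 0 ∨ r 1 - p 1 ≠ 0 := by
  by_contra! hcon
  exact h (plane_ext (sub_eq_zero.1 hcon.1).symm (sub_eq_zero.1 hcon.2).symm)

/-- The determinant detecting collinearity of three points. -/
def det3 (a b c : Plane F) : F := (b 0 - a 0) * (c 1 - a 1) - (b 1 - a 1) * (c 0 - a 0)

/-- The coefficients of the line through two points. -/
def join (a b : Plane F) : F × F × F :=
  (-(b 1 - a 1), b 0 - a 0, (b 1 - a 1) * a 0 - (b 0 - a 0) * a 1)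

theorem linEval_join (a b c : Plane F) : linEval (join a b) c = det3 a b c := by
  simp only [linEval, join, det3]; ring

theorem join_proper {a b : Plane F} (h : a ≠ b) : (join a b).1 ≠ 0 ∨ (join a b).2.1 ≠ 0 := by
  rcases plane_ne h with h | h
  · exact Or.inr h
  · exact Or.inl (neg_ne_zero.2 h)

theorem mem_lineSet_join {a b c : Plane F} : c ∈ lineSet (join a b) ↔ det3 a b c = 0 := by
  rw [mem_lineSet, linEval_join]

theorem det3_self_left (a b : Plane F) : det3 a b a = 0 := by simp [det3]

theorem det3_self_right (a b : Plane F) : det3 a b b = 0 := by simp [det3]; ring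

theorem det3_swap_left (a b c : Plane F) : det3 b a c = -det3 a b c := by
  simp only [det3]; ring

theorem det3_eq_zero_iff {a b : Plane F} (h : a ≠ b) (c : Plane F) :
    det3 a b c = 0 ↔ ∃ t, c = ![a 0 + t * (b 0 - a 0), a 1 + t * (b 1 - a 1)] := by
  constructor
  · intro hd
    rw [det3] at hd
    rcases plane_ne h with hx | hx
    · refine ⟨(c 0 - a 0) / (b 0 - a 0), plane_ext ?_ ?_⟩
      · simp [hx]
      · simp; field_simp; linear_combination hd
    · refine ⟨(c 1 - a 1) / (b 1 - a 1), plane_ext ?_ ?_⟩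
      · simp; field_simp; linear_combination -hd
      · simp [hx]
  · rintro ⟨t, rfl⟩
    simp [det3]; ring

/-- Two lines through `a` which share another point are equal. -/
theorem det3_eq_zero_of_common {a b c p : Plane F} (hp : p ≠ a) (hb : det3 a b p = 0)
    (hc : det3 a c p = 0) : det3 a b c = 0 := by
  simp only [det3] at *
  rcases plane_ne hp.symm with hx | hx
  · refine (mul_eq_zero.1 (?_ : (p 0 - a 0) * _ = 0)).resolve_left hx
    linear_combination -(b 0 - a 0) * hc + (c 0 - a 0) * hb
  · refine (mul_eq_zero.1 (?_ : (p 1 - a 1) * _ = 0)).resolve_left hx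
    linear_combination -(b 1 - a 1) * hc + (c 1 - a 1) * hb

theorem lineSet_eq_join {u : F × F × F} (hu : u.1 ≠ 0 ∨ u.2.1 ≠ 0) {a b : Plane F} (hab : a ≠ b)
    (ha : a ∈ lineSet u) (hb : b ∈ lineSet u) : lineSet u = lineSet (join a b) := by
  ext r
  rw [mem_lineSet_join]
  rw [mem_lineSet, linEval] at *
  constructor
  · intro hr
    rw [det3]
    rcases hu with h | h
    · refine (mul_eq_zero.1 (?_ : u.1 * _ = 0)).resolve_left h
      linear_combination (b 1 - a 1) * (ha - hr) + (r 1 - a 1) * (hb - ha)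
    · refine (mul_eq_zero.1 (?_ : u.2.1 * _ = 0)).resolve_left h
      linear_combination (b 0 - a 0) * (hr - ha) - (r 0 - a 0) * (hb - ha)
  · intro h
    obtain ⟨t, rfl⟩ := (det3_eq_zero_iff hab r).1 h
    simp only [Matrix.cons_val_zero, Matrix.cons_val_one]
    linear_combination ha + t * (hb - ha)

theorem collinear_iff_det3 (a b c : Plane F) : Collinear F {a, b, c} ↔ det3 a b c = 0 := by
  by_cases hab : a = b
  · subst hab
    simp [collinear_pair, det3]
  rw [collinear_iff_of_mem (p₀ := a) (by simp)]
  constructor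
  · rintro ⟨v, hv⟩
    obtain ⟨r, rfl⟩ := hv b (by simp)
    obtain ⟨s, rfl⟩ := hv c (by simp)
    simp [det3]; ring
  · intro h
    obtain ⟨t, rfl⟩ := (det3_eq_zero_iff hab c).1 h
    refine ⟨b - a, ?_⟩
    rintro p (rfl | rfl | rfl)
    · exact ⟨0, by simp⟩
    · exact ⟨1, by simp⟩
    · exact ⟨t, plane_ext (by simp; ring) (by simp; ring)⟩

/-- There is a line through `a` which avoids `p`. -/
theorem exists_line_avoiding {a p : Plane F} (h : p ≠ a) :
    ∃ u : F × F × F, linEval u a = 0 ∧ linEval u p ≠ 0 := by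
  rcases plane_ne h with hx | hx
  · exact ⟨(1, 0, -a 0), by simp [linEval], by
      simp only [linEval]; intro h; apply hx; linear_combination -h⟩
  · exact ⟨(0, 1, -a 1), by simp [linEval], by
      simp only [linEval]; intro h; apply hx; linear_combination -h⟩

/-- Some conic through `X` avoids `p`. -/
def Separated (X : Set (Plane F)) (p : Plane F) : Prop :=
  ∃ w ∈ vanishing (quadEval F) X, quadEval F w p ≠ 0

theorem separated_mul {X : Set (Plane F)} {p : Plane F} (u v : F × F × F)
    (hX : ∀ r ∈ X, linEval u r = 0 ∨ linEval v r = 0) (hu : linEval u p ≠ 0)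
    (hv : linEval v p ≠ 0) : Separated X p :=
  ⟨mulCoef u v, fun r hr => by rw [quadEval_mulCoef, mul_eq_zero]; exact hX r hr, by
    rw [quadEval_mulCoef]; exact mul_ne_zero hu hv⟩

theorem separated_empty (p : Plane F) : Separated ∅ p :=
  separated_mul (0, 0, 1) (0, 0, 1) (by simp) (by simp [linEval]) (by simp [linEval])

theorem separated_pair {a b p : Plane F} (ha : p ≠ a) (hb : p ≠ b) : Separated {a, b} p := by
  obtain ⟨u, hu, hup⟩ := exists_line_avoiding ha
  obtain ⟨v, hv, hvp⟩ := exists_line_avoiding hb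
  refine separated_mul u v ?_ hup hvp
  rintro r (rfl | rfl)
  · exact Or.inl hu
  · exact Or.inr hv

theorem separated_singleton {a p : Plane F} (ha : p ≠ a) : Separated {a} p := by
  simpa using separated_pair ha ha

/-- A line together with one further point is separated from all other points. -/
theorem separated_line_point {X : Set (Plane F)} {u : F × F × F} {b p : Plane F}
    (hX : X ⊆ insert b (lineSet u)) (hp : p ∉ lineSet u) (hpb : p ≠ b) : Separated X p := by
  obtain ⟨v, hv, hvp⟩ := exists_line_avoiding hpb
  refine separated_mul u v ?_ hp hvp
  intro r hr
  rcases hX hr with rfl | h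
  · exact Or.inr hv
  · exact Or.inl h

theorem separated_triple {a b c p : Plane F} (hb : p ≠ b) (ha : p ≠ a) (hc : p ≠ c)
    (h : det3 a b c ≠ 0 ∨ det3 a b p ≠ 0) : Separated {a, b, c} p := by
  by_cases hp : det3 a b p = 0
  · have habc : det3 a b c ≠ 0 := h.resolve_right (not_not.2 hp)
    refine separated_line_point (u := join a c) (b := b) ?_ ?_ hb
    · rintro r (rfl | rfl | rfl)
      · exact Or.inr (mem_lineSet_join.2 (det3_self_left _ _))
      · exact Or.inl rfl
      · exact Or.inr (mem_lineSet_join.2 (det3_self_right _ _))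
    · rw [mem_lineSet_join]
      exact fun h => habc (det3_eq_zero_of_common ha hp h)
  · refine separated_line_point (u := join a b) (b := c) ?_ ?_ hc
    · rintro r (rfl | rfl | rfl)
      · exact Or.inr (mem_lineSet_join.2 (det3_self_left _ _))
      · exact Or.inr (mem_lineSet_join.2 (det3_self_right _ _))
      · exact Or.inl rfl
    · rwa [mem_lineSet_join]

theorem separated_quadruple {a b c d p : Plane F} (ha : p ≠ a) (hb : p ≠ b) (hc : p ≠ c)
    (hd : p ≠ d) (hab : det3 a b p = 0 → det3 a b c ≠ 0 ∧ det3 a b d ≠ 0)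
    (hcd : det3 c d p = 0 → det3 c d a ≠ 0 ∧ det3 c d b ≠ 0) : Separated {a, b, c, d} p := by
  by_cases h : det3 a b p ≠ 0 ∧ det3 c d p ≠ 0
  · refine separated_mul (join a b) (join c d) ?_ (by rw [linEval_join]; exact h.1)
      (by rw [linEval_join]; exact h.2)
    simp [linEval_join, det3_self_left, det3_self_right]
  · have key : det3 a c p ≠ 0 ∧ det3 b d p ≠ 0 := by
      by_cases h1 : det3 a b p = 0
      · obtain ⟨h2, h3⟩ := hab h1
        refine ⟨fun h => h2 (det3_eq_zero_of_common ha h1 h), fun h => h3 ?_⟩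
        rw [← neg_eq_zero, ← det3_swap_left]
        exact det3_eq_zero_of_common hb (by rw [det3_swap_left, h1, neg_zero]) h
      · have h1' : det3 c d p = 0 := by
          by_contra h2
          exact h ⟨h1, h2⟩
        obtain ⟨h2, h3⟩ := hcd h1'
        refine ⟨fun h => h2 ?_, fun h => h3 ?_⟩
        · exact det3_eq_zero_of_common hc h1' (by rw [det3_swap_left, h, neg_zero])
        · rw [← neg_eq_zero, ← det3_swap_left]
          exact det3_eq_zero_of_common hd (by rw [det3_swap_left, h1', neg_zero])
            (by rw [det3_swap_left, h, neg_zero])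
    refine separated_mul (join a c) (join b d) ?_ (by rw [linEval_join]; exact key.1)
      (by rw [linEval_join]; exact key.2)
    simp [linEval_join, det3_self_left, det3_self_right]

/-- The dimension of the space of conics through `X`. -/
noncomputable def conicDim (X : Set (Plane F)) : ℕ :=
  Module.finrank F (vanishing (quadEval F) X)

theorem conicDim_anti {X Y : Set (Plane F)} (h : X ⊆ Y) : conicDim Y ≤ conicDim X :=
  Submodule.finrank_mono (vanishing_anti _ h)

theorem conicDim_insert {X : Set (Plane F)} {p : Plane F} (h : Separated X p) :
    conicDim (insert p X) + 1 = conicDim X := finrank_vanishing_insert _ h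

theorem conicDim_empty : conicDim (∅ : Set (Plane F)) = 6 := by
  have : vanishing (quadEval F) ∅ = ⊤ := by
    ext w
    simp [mem_vanishing]
  rw [conicDim, this, finrank_top]
  simp [Module.finrank_prod]

theorem six_le_conicDim_add_ncard [Finite F] (X : Set (Plane F)) :
    6 ≤ conicDim X + X.ncard := by
  induction X, Set.toFinite X using Set.Finite.induction_on with
  | empty => simp [conicDim_empty]
  | @insert a s ha hs ih =>
    rw [Set.ncard_insert_of_notMem ha hs]
    have := finrank_vanishing_le_insert (quadEval F) s a
    rw [conicDim] at *
    omega

theorem conicDim_singleton (a : Plane F) : conicDim {a} = 5 := by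
  have h := conicDim_insert (separated_empty a)
  rw [conicDim_empty, insert_empty_eq] at h
  omega

theorem conicDim_pair {a b : Plane F} (h : a ≠ b) : conicDim {a, b} = 4 := by
  have h := conicDim_insert (separated_singleton h)
  rw [conicDim_singleton] at h
  omega

theorem conicDim_triple {a b c : Plane F} (hab : a ≠ b) (hac : a ≠ c) (hbc : b ≠ c) :
    conicDim {a, b, c} = 3 := by
  have h := conicDim_insert (separated_pair hab hac)
  rw [conicDim_pair hbc] at h
  omega

theorem conicDim_quadruple {a b c d : Plane F} (hab : a ≠ b) (hac : a ≠ c) (hbc : b ≠ c)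
    (hda : d ≠ a) (hdb : d ≠ b) (hdc : d ≠ c) (h : det3 a b c ≠ 0 ∨ det3 a b d ≠ 0) :
    conicDim {d, a, b, c} = 2 := by
  have h := conicDim_insert (separated_triple hdb hda hdc h)
  rw [conicDim_triple hab hac hbc] at h
  omega

theorem conicDim_le_one_of_five {X : Set (Plane F)} {a b c d e : Plane F} (hab : a ≠ b)
    (hac : a ≠ c) (hbc : b ≠ c) (hda : d ≠ a) (hdb : d ≠ b) (hdc : d ≠ c)
    (h : det3 a b c ≠ 0 ∨ det3 a b d ≠ 0) (he : Separated {d, a, b, c} e)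
    (hX : {e, d, a, b, c} ⊆ X) : conicDim X ≤ 1 := by
  have h1 := conicDim_insert he
  rw [conicDim_quadruple hab hac hbc hda hdb hdc h] at h1
  have h2 := conicDim_anti hX
  omega

/-- A conic with three distinct collinear points contains the line through them. -/
theorem grad_eq_zero_of_three_collinear {w : Coef F} {a b c : Plane F} (hab : a ≠ b) (hac : c ≠ a)
    (hbc : c ≠ b) (h : det3 a b c = 0) (ha : quadEval F w a = 0) (hb : quadEval F w b = 0)
    (hc : quadEval F w c = 0) :
    gradX w a * (b 0 - a 0) + gradY w a * (b 1 - a 1) = 0 ∧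
      leadEval w (b 0 - a 0) (b 1 - a 1) = 0 := by
  obtain ⟨t, rfl⟩ := (det3_eq_zero_iff hab c).1 h
  have h1 := quadEval_add_smul w a (b 0 - a 0) (b 1 - a 1) 1
  have hb' : ![a 0 + 1 * (b 0 - a 0), a 1 + 1 * (b 1 - a 1)] = b :=
    plane_ext (by simp) (by simp)
  rw [hb', hb, ha] at h1
  rw [quadEval_add_smul, ha] at hc
  have ht0 : t ≠ 0 := by
    rintro rfl
    exact hac (plane_ext (by simp) (by simp))
  have ht1 : t - 1 ≠ 0 := by
    intro h
    rw [sub_eq_zero] at h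
    subst h
    exact hbc hb'
  have hl : leadEval w (b 0 - a 0) (b 1 - a 1) = 0 := by
    refine (mul_eq_zero.1 (?_ : (t * (t - 1)) * _ = 0)).resolve_left (mul_ne_zero ht0 ht1)
    linear_combination hc + t * h1
  refine ⟨?_, hl⟩
  rw [hl] at h1
  linear_combination -h1

theorem quadEval_eq_zero_of_three_collinear {w : Coef F} {a b c : Plane F} (hab : a ≠ b)
    (hac : c ≠ a) (hbc : c ≠ b) (h : det3 a b c = 0) (ha : quadEval F w a = 0)
    (hb : quadEval F w b = 0) (hc : quadEval F w c = 0) {r : Plane F} (hr : det3 a b r = 0) :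
    quadEval F w r = 0 := by
  obtain ⟨h1, h2⟩ := grad_eq_zero_of_three_collinear hab hac hbc h ha hb hc
  obtain ⟨t, rfl⟩ := (det3_eq_zero_iff hab r).1 hr
  rw [quadEval_add_smul, ha, h1, h2]
  ring

theorem det3_ne_zero_of_conicDet {w : Coef F} (hw : conicDet w ≠ 0) {a b c : Plane F} (hab : a ≠ b)
    (hac : c ≠ a) (hbc : c ≠ b) (ha : a ∈ quadZeros w) (hb : b ∈ quadZeros w)
    (hc : c ∈ quadZeros w) : det3 a b c ≠ 0 := by
  intro h
  obtain ⟨h1, h2⟩ := grad_eq_zero_of_three_collinear hab hac hbc h ha hb hc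
  rw [mem_quadZeros] at ha
  exact hw (conicDet_eq_zero_of_grad (plane_ne hab) h2 h1 (by rw [ha, mul_zero]))

theorem quadEval_injective [Fintype F] (hq : 3 ≤ Fintype.card F) :
    Function.Injective (quadEval F) := by
  obtain ⟨t, ht0, ht1⟩ : ∃ t : F, t ≠ 0 ∧ t ≠ 1 := by
    classical
    obtain ⟨t, ht⟩ := Finset.exists_mem_notMem_of_card_lt_card (s := ({0, 1} : Finset F))
      (t := Finset.univ) (lt_of_le_of_lt Finset.card_le_two (by rw [Finset.card_univ]; omega))
    exact ⟨t, by simpa using ht⟩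
  rw [injective_iff_map_eq_zero]
  rintro ⟨⟨a, b, c⟩, d, e, g⟩ hw
  have h : ∀ x y : F, a * x ^ 2 + b * x * y + c * y ^ 2 + d * x + e * y + g = 0 := by
    intro x y
    have := congrFun hw ![x, y]
    simpa [quadEval_apply] using this
  have ht1' : t - 1 ≠ 0 := sub_ne_zero.2 ht1
  have hg : g = 0 := by linear_combination h 0 0
  have ha : a = 0 := by
    refine (mul_eq_zero.1 (?_ : (t * (t - 1)) * _ = 0)).resolve_left (mul_ne_zero ht0 ht1')
    linear_combination h t 0 - t * h 1 0 + (t - 1) * hg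
  have hc : c = 0 := by
    refine (mul_eq_zero.1 (?_ : (t * (t - 1)) * _ = 0)).resolve_left (mul_ne_zero ht0 ht1')
    linear_combination h 0 t - t * h 0 1 + (t - 1) * hg
  have hd : d = 0 := by linear_combination h 1 0 - ha - hg
  have he : e = 0 := by linear_combination h 0 1 - hc - hg
  have hb : b = 0 := by linear_combination h 1 1 - ha - hc - hd - he - hg
  simp [ha, hb, hc, hd, he, hg]

end Separation

section Flats

variable {F : Type*} [Field F]

/-- `X` is an intersection of conics, and the conics through `X` form a space of dimension `i`. -/
def IsConicFlat (i : ℕ) (X : Set (Plane F)) : Prop :=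
  conicDim X = i ∧ ∀ p ∉ X, Separated X p

theorem exists_two_points {u : F × F × F} (hu : u.1 ≠ 0 ∨ u.2.1 ≠ 0) :
    ∃ a ∈ lineSet u, ∃ b ∈ lineSet u, a ≠ b := by
  obtain ⟨a, b, c⟩ := u
  obtain ⟨p, hp⟩ : ∃ p : Plane F, a * p 0 + b * p 1 + c = 0 := by
    rcases hu with h | h
    · exact ⟨![-c / a, 0], by simp at h ⊢; field_simp; ring⟩
    · exact ⟨![0, -c / b], by simp at h ⊢; field_simp; ring⟩
  refine ⟨p, hp, ![p 0 - b, p 1 + a], ?_, ?_⟩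
  · rw [mem_lineSet, linEval]
    simp
    linear_combination hp
  · intro h
    have h0 : p 0 = p 0 - b := congrFun h 0
    have h1 : p 1 = p 1 + a := congrFun h 1
    rcases hu with h2 | h2
    · exact h2 (by linear_combination -h1)
    · exact h2 (by linear_combination h0)

theorem exists_eq_join {u : F × F × F} (hu : u.1 ≠ 0 ∨ u.2.1 ≠ 0) :
    ∃ a b, a ≠ b ∧ lineSet u = lineSet (join a b) := by
  obtain ⟨a, ha, b, hb, hab⟩ := exists_two_points hu
  exact ⟨a, b, hab, lineSet_eq_join hu hab ha hb⟩

theorem affineLines_eq : affineLines F = {S | ∃ a b, a ≠ b ∧ S = lineSet (join a b)} := by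
  ext S
  constructor
  · rintro ⟨L, hL, rfl⟩
    obtain ⟨v, hv0, hv⟩ := finrank_eq_one_iff'.1 hL
    have hne : (L : Set (Plane F)).Nonempty := by
      rw [Set.nonempty_iff_ne_empty]
      intro h
      rw [AffineSubspace.coe_eq_bot_iff] at h
      rw [h, AffineSubspace.direction_bot, finrank_bot] at hL
      omega
    obtain ⟨a, ha⟩ := hne
    have hv0' : (v : Plane F) ≠ 0 := fun h => hv0 (Subtype.ext h)
    have hab : a ≠ (v : Plane F) +ᵥ a := by
      intro h
      exact hv0' (by simpa using h)
    refine ⟨a, (v : Plane F) +ᵥ a, hab, ?_⟩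
    ext r
    rw [mem_lineSet_join, det3_eq_zero_iff hab]
    constructor
    · intro hr
      obtain ⟨t, ht⟩ := hv ⟨r -ᵥ a, AffineSubspace.vsub_mem_direction hr ha⟩
      have ht' : t • (v : Plane F) = r - a := congrArg Subtype.val ht
      have h0 : t * (v : Plane F) 0 = r 0 - a 0 := congrFun ht' 0
      have h1 : t * (v : Plane F) 1 = r 1 - a 1 := congrFun ht' 1
      exact ⟨t, plane_ext (by simp [h0]) (by simp [h1])⟩
    · rintro ⟨t, rfl⟩
      have h := AffineSubspace.vadd_mem_of_mem_direction (L.direction.smul_mem t v.2) ha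
      have he : ![a 0 + t * (((v : Plane F) +ᵥ a) 0 - a 0),
          a 1 + t * (((v : Plane F) +ᵥ a) 1 - a 1)] = t • (v : Plane F) +ᵥ a :=
        plane_ext (by simp; ring) (by simp; ring)
      rw [he]
      exact h
  · rintro ⟨a, b, hab, rfl⟩
    refine ⟨AffineSubspace.mk' a (Submodule.span F {b - a}), ?_, ?_⟩
    · rw [AffineSubspace.direction_mk', finrank_span_singleton (sub_ne_zero.2 hab.symm)]
    · ext r
      rw [mem_lineSet_join, det3_eq_zero_iff hab, SetLike.mem_coe, AffineSubspace.mem_mk',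
        Submodule.mem_span_singleton]
      refine exists_congr fun t => ⟨?_, fun h => ?_⟩
      · rintro rfl
        exact plane_ext (by simp) (by simp)
      · have h0 : t * (b 0 - a 0) = r 0 - a 0 := congrFun h 0
        have h1 : t * (b 1 - a 1) = r 1 - a 1 := congrFun h 1
        exact plane_ext (by simp [h0]) (by simp [h1])

theorem affineLines_eq_lineSet : affineLines F =
    {S | ∃ u : F × F × F, (u.1 ≠ 0 ∨ u.2.1 ≠ 0) ∧ S = lineSet u} := by
  rw [affineLines_eq]
  ext S
  constructor
  · rintro ⟨a, b, hab, rfl⟩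
    exact ⟨join a b, join_proper hab, rfl⟩
  · rintro ⟨u, hu, rfl⟩
    exact exists_eq_join hu

theorem exists_third_point [Fintype F] (hq : 3 ≤ Fintype.card F) (a b : Plane F) (hab : a ≠ b) :
    ∃ c, c ≠ a ∧ c ≠ b ∧ det3 a b c = 0 := by
  have h1 : ({a, b} : Set (Plane F)).ncard < (lineSet (join a b)).ncard := by
    rw [ncard_lineSet (join_proper hab)]
    exact (Set.ncard_insert_le _ _).trans_lt (by rw [Set.ncard_singleton]; omega)
  obtain ⟨c, hc, hn⟩ := Set.exists_mem_notMem_of_ncard_lt_ncard h1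
  simp only [Set.mem_insert_iff, Set.mem_singleton_iff, not_or] at hn
  exact ⟨c, hn.1, hn.2, mem_lineSet_join.1 hc⟩

variable [Fintype F]

theorem conicDim_line (hq : 3 ≤ Fintype.card F) {a b : Plane F} (hab : a ≠ b) :
    conicDim (lineSet (join a b)) = 3 := by
  obtain ⟨c, hca, hcb, hc⟩ := exists_third_point hq a b hab
  rw [← conicDim_triple hab hca.symm hcb.symm]
  have : vanishing (quadEval F) (lineSet (join a b)) = vanishing (quadEval F) {a, b, c} := by
    refine le_antisymm (vanishing_anti _ ?_) ?_
    · rintro r (rfl | rfl | rfl)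
      · exact mem_lineSet_join.2 (det3_self_left _ _)
      · exact mem_lineSet_join.2 (det3_self_right _ _)
      · exact mem_lineSet_join.2 hc
    · intro w hw r hr
      exact quadEval_eq_zero_of_three_collinear hab hca hcb hc (hw a (by simp)) (hw b (by simp))
        (hw c (by simp)) (mem_lineSet_join.1 hr)
  rw [conicDim, this]
  rfl

omit [Fintype F] in
theorem separated_line {a b p : Plane F} (hp : p ∉ lineSet (join a b)) :
    Separated (lineSet (join a b)) p := by
  refine separated_line_point (b := a) (fun r hr => Or.inr hr) hp ?_
  rintro rfl
  exact hp (mem_lineSet_join.2 (det3_self_left _ _))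

omit [Fintype F] in
theorem exists_pair_of_conicDim {X : Set (Plane F)} (h : conicDim X ≤ 4) :
    ∃ a b, a ∈ X ∧ b ∈ X ∧ a ≠ b := by
  by_contra! hcon
  rcases Set.Subsingleton.eq_empty_or_singleton (s := X) (fun a ha b hb => hcon a b ha hb) with
    rfl | ⟨a, rfl⟩
  · rw [conicDim_empty] at h; omega
  · rw [conicDim_singleton] at h; omega

omit [Fintype F] in
theorem exists_triple_of_conicDim {X : Set (Plane F)} (h : conicDim X ≤ 3) :
    ∃ a b c, a ∈ X ∧ b ∈ X ∧ c ∈ X ∧ a ≠ b ∧ a ≠ c ∧ b ≠ c := by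
  obtain ⟨a, b, ha, hb, hab⟩ := exists_pair_of_conicDim (by omega : conicDim X ≤ 4)
  by_contra! hcon
  have hX : X = {a, b} := by
    refine Set.Subset.antisymm (fun c hc => ?_) (Set.insert_subset ha (by simpa using hb))
    by_contra hn
    simp only [Set.mem_insert_iff, Set.mem_singleton_iff, not_or] at hn
    exact hn.2 (hcon a b c ha hb hc hab (Ne.symm hn.1)).symm
  rw [hX, conicDim_pair hab] at h
  omega

omit [Fintype F] in
theorem conicDim_le_two {X : Set (Plane F)} {a b c d : Plane F} (ha : a ∈ X) (hb : b ∈ X)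
    (hc : c ∈ X) (hd : d ∈ X) (hab : a ≠ b) (hac : a ≠ c) (hbc : b ≠ c)
    (hda : d ≠ a) (hdb : d ≠ b) (hdc : d ≠ c) (h : det3 a b c ≠ 0 ∨ det3 a b d ≠ 0) :
    conicDim X ≤ 2 := by
  rw [← conicDim_quadruple hab hac hbc hda hdb hdc h]
  apply conicDim_anti
  rintro r (rfl | rfl | rfl | rfl) <;> assumption

omit [Fintype F] in
theorem conicDim_eq_six_iff (X : Set (Plane F)) : conicDim X = 6 ↔ X = ∅ := by
  refine ⟨fun h => ?_, fun h => by rw [h, conicDim_empty]⟩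
  by_contra hne
  obtain ⟨a, ha⟩ := Set.nonempty_iff_ne_empty.2 hne
  have := conicDim_anti (Set.singleton_subset_iff.2 ha)
  rw [conicDim_singleton] at this
  omega

omit [Fintype F] in
theorem isConicFlat_five (X : Set (Plane F)) : IsConicFlat 5 X ↔ ∃ p, X = {p} := by
  constructor
  · rintro ⟨h, -⟩
    obtain ⟨a, ha⟩ : X.Nonempty := by
      rw [Set.nonempty_iff_ne_empty]
      rintro rfl
      rw [conicDim_empty] at h
      omega
    refine ⟨a, Set.eq_singleton_iff_unique_mem.2 ⟨ha, fun b hb => ?_⟩⟩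
    by_contra hba
    have := conicDim_anti (Set.insert_subset hb (Set.singleton_subset_iff.2 ha))
    rw [conicDim_pair hba] at this
    omega
  · rintro ⟨a, rfl⟩
    exact ⟨conicDim_singleton a, fun p hp => separated_singleton hp⟩

omit [Fintype F] in
theorem isConicFlat_four (X : Set (Plane F)) : IsConicFlat 4 X ↔ X.ncard = 2 := by
  rw [Set.ncard_eq_two]
  constructor
  · rintro ⟨h, -⟩
    obtain ⟨a, b, ha, hb, hab⟩ := exists_pair_of_conicDim h.le
    refine ⟨a, b, hab, Set.Subset.antisymm (fun c hc => ?_)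
      (Set.insert_subset ha (by simpa using hb))⟩
    by_contra hn
    simp only [Set.mem_insert_iff, Set.mem_singleton_iff, not_or] at hn
    have : ({c, a, b} : Set (Plane F)) ⊆ X := by
      rintro r (rfl | rfl | rfl) <;> assumption
    have := conicDim_anti this
    rw [conicDim_triple hn.1 hn.2 hab] at this
    omega
  · rintro ⟨a, b, hab, rfl⟩
    refine ⟨conicDim_pair hab, fun p hp => ?_⟩
    simp only [Set.mem_insert_iff, Set.mem_singleton_iff, not_or] at hp
    exact separated_pair hp.1 hp.2

omit [Fintype F] in
theorem mem_triangles {X : Set (Plane F)} :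
    X ∈ triangles F ↔ ∃ a b c, a ≠ b ∧ a ≠ c ∧ b ≠ c ∧ X = {a, b, c} ∧ det3 a b c ≠ 0 := by
  constructor
  · rintro ⟨h3, hc⟩
    obtain ⟨a, b, c, hab, hac, hbc, rfl⟩ := Set.ncard_eq_three.1 h3
    exact ⟨a, b, c, hab, hac, hbc, rfl, fun h => hc ((collinear_iff_det3 a b c).2 h)⟩
  · rintro ⟨a, b, c, hab, hac, hbc, rfl, h⟩
    exact ⟨Set.ncard_eq_three.2 ⟨a, b, c, hab, hac, hbc, rfl⟩,
      fun hc => h ((collinear_iff_det3 a b c).1 hc)⟩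

theorem isConicFlat_three (hq : 3 ≤ Fintype.card F) (X : Set (Plane F)) :
    IsConicFlat 3 X ↔ X ∈ affineLines F ∪ triangles F := by
  constructor
  · rintro ⟨h, hsep⟩
    obtain ⟨a, b, c, ha, hb, hc, hab, hac, hbc⟩ := exists_triple_of_conicDim h.le
    have h4 : ∀ d ∈ X, d ≠ a → d ≠ b → d ≠ c → det3 a b c ≠ 0 ∨ det3 a b d ≠ 0 → False := by
      intro d hd hda hdb hdc hdet
      have := conicDim_le_two ha hb hc hd hab hac hbc hda hdb hdc hdet
      omega
    by_cases hdet : det3 a b c = 0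
    · left
      rw [affineLines_eq]
      refine ⟨a, b, hab, Set.Subset.antisymm (fun d hd => ?_) (fun d hd => ?_)⟩
      · rw [mem_lineSet_join]
        by_contra hdd
        refine h4 d hd ?_ ?_ ?_ (Or.inr hdd)
        · rintro rfl; exact hdd (det3_self_left _ _)
        · rintro rfl; exact hdd (det3_self_right _ _)
        · rintro rfl; exact hdd hdet
      · by_contra hdX
        obtain ⟨w, hw, hwd⟩ := hsep d hdX
        exact hwd (quadEval_eq_zero_of_three_collinear hab hac.symm hbc.symm hdet (hw a ha)
          (hw b hb) (hw c hc) (mem_lineSet_join.1 hd))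
    · right
      rw [mem_triangles]
      refine ⟨a, b, c, hab, hac, hbc, Set.Subset.antisymm (fun d hd => ?_) ?_, hdet⟩
      · by_contra hn
        simp only [Set.mem_insert_iff, Set.mem_singleton_iff, not_or] at hn
        exact h4 d hd hn.1 hn.2.1 hn.2.2 (Or.inl hdet)
      · rintro r (rfl | rfl | rfl) <;> assumption
  · rintro (h | h)
    · rw [affineLines_eq] at h
      obtain ⟨a, b, hab, rfl⟩ := h
      exact ⟨conicDim_line hq hab, fun p hp => separated_line hp⟩
    · obtain ⟨a, b, c, hab, hac, hbc, rfl, hdet⟩ := mem_triangles.1 h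
      refine ⟨conicDim_triple hab hac hbc, fun p hp => ?_⟩
      simp only [Set.mem_insert_iff, Set.mem_singleton_iff, not_or] at hp
      exact separated_triple hp.2.1 hp.1 hp.2.2 (Or.inl hdet)

omit [Fintype F] in
theorem mem_quadrilaterals {X : Set (Plane F)} : X ∈ quadrilaterals F ↔
    X.ncard = 4 ∧ ∀ a ∈ X, ∀ b ∈ X, ∀ c ∈ X, a ≠ b → a ≠ c → b ≠ c → det3 a b c ≠ 0 := by
  refine and_congr_right fun h4 => ⟨fun h a ha b hb c hc hab hac hbc hdet => ?_, fun h T hT h3 => ?_⟩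
  · refine h {a, b, c} ?_ (Set.ncard_eq_three.2 ⟨a, b, c, hab, hac, hbc, rfl⟩)
      ((collinear_iff_det3 a b c).2 hdet)
    rintro r (rfl | rfl | rfl) <;> assumption
  · obtain ⟨a, b, c, hab, hac, hbc, rfl⟩ := Set.ncard_eq_three.1 h3
    rw [collinear_iff_det3]
    exact h a (hT (by simp)) b (hT (by simp)) c (hT (by simp)) hab hac hbc

theorem isConicFlat_two (hq : 3 ≤ Fintype.card F) (X : Set (Plane F)) :
    IsConicFlat 2 X ↔ X ∈ linePlusPoint F ∪ quadrilaterals F := by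
  constructor
  · rintro ⟨h, hsep⟩
    by_cases hcol : ∃ a b c, a ∈ X ∧ b ∈ X ∧ c ∈ X ∧ a ≠ b ∧ a ≠ c ∧ b ≠ c ∧ det3 a b c = 0
    · left
      obtain ⟨a, b, c, ha, hb, hc, hab, hac, hbc, hdet⟩ := hcol
      have hline : lineSet (join a b) ⊆ X := by
        intro d hd
        by_contra hdX
        obtain ⟨w, hw, hwd⟩ := hsep d hdX
        exact hwd (quadEval_eq_zero_of_three_collinear hab hac.symm hbc.symm hdet (hw a ha)
          (hw b hb) (hw c hc) (mem_lineSet_join.1 hd))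
      obtain ⟨p, hp, hpl⟩ : ∃ p ∈ X, p ∉ lineSet (join a b) := by
        by_contra! hcon
        have := conicDim_anti (show X ⊆ lineSet (join a b) from hcon)
        rw [conicDim_line hq hab] at this
        omega
      refine ⟨lineSet (join a b), ?_, p, hpl, Set.Subset.antisymm (fun r hr => ?_)
        (Set.insert_subset hp hline)⟩
      · rw [affineLines_eq]
        exact ⟨a, b, hab, rfl⟩
      · by_contra hn
        simp only [Set.mem_insert_iff, not_or] at hn
        have h1 := conicDim_insert (separated_line_point (u := join a b) (b := p) subset_rfl
          hn.2 hn.1)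
        have h2 := conicDim_insert (separated_line hpl)
        rw [conicDim_line hq hab] at h2
        have h3 := conicDim_anti (Set.insert_subset hr (Set.insert_subset hp hline))
        omega
    · right
      push Not at hcol
      obtain ⟨a, b, c, ha, hb, hc, hab, hac, hbc⟩ :=
        exists_triple_of_conicDim (by omega : conicDim X ≤ 3)
      have habc := hcol a b c ha hb hc hab hac hbc
      obtain ⟨d, hd, hn⟩ : ∃ d ∈ X, d ∉ ({a, b, c} : Set (Plane F)) := by
        by_contra! hcon
        have := conicDim_anti (show X ⊆ {a, b, c} from hcon)
        rw [conicDim_triple hab hac hbc] at this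
        omega
      have hn' := hn
      simp only [Set.mem_insert_iff, Set.mem_singleton_iff, not_or] at hn
      obtain ⟨hda, hdb, hdc⟩ := hn
      have hX : X = {d, a, b, c} := by
        refine Set.Subset.antisymm (fun e he => ?_) ?_
        · by_contra hn
          simp only [Set.mem_insert_iff, Set.mem_singleton_iff, not_or] at hn
          obtain ⟨hed, hea, heb, hec⟩ := hn
          have := conicDim_le_one_of_five (X := X) (e := e) hab hac hbc hda hdb hdc
            (Or.inl habc) (separated_quadruple hed hea heb hec
              (fun h0 => absurd h0 (hcol d a e hd ha he hda (Ne.symm hed) (Ne.symm hea)))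
              (fun h0 => absurd h0 (hcol b c e hb hc he hbc (Ne.symm heb) (Ne.symm hec))))
            (by rintro r (rfl | rfl | rfl | rfl | rfl) <;> assumption)
          omega
        · rintro r (rfl | rfl | rfl | rfl) <;> assumption
      rw [mem_quadrilaterals]
      refine ⟨?_, fun a ha b hb c hc hab hac hbc => hcol a b c ha hb hc hab hac hbc⟩
      rw [hX, Set.ncard_insert_of_notMem hn', Set.ncard_eq_three.2 ⟨a, b, c, hab, hac, hbc, rfl⟩]
  · rintro (⟨L, hL, p, hpl, rfl⟩ | h)
    · rw [affineLines_eq] at hL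
      obtain ⟨a, b, hab, rfl⟩ := hL
      refine ⟨?_, fun r hr => ?_⟩
      · have h2 := conicDim_insert (separated_line hpl)
        rw [conicDim_line hq hab] at h2
        omega
      · simp only [Set.mem_insert_iff, not_or] at hr
        exact separated_line_point (u := join a b) (b := p) subset_rfl hr.2 hr.1
    · rw [mem_quadrilaterals] at h
      obtain ⟨h4, hcol⟩ := h
      obtain ⟨d, Y, hdY, rfl, h3⟩ := (Set.ncard_eq_succ (n := 3)).1 h4
      obtain ⟨a, b, c, hab, hac, hbc, rfl⟩ := Set.ncard_eq_three.1 h3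
      simp only [Set.mem_insert_iff, Set.mem_singleton_iff, not_or] at hdY
      obtain ⟨hda, hdb, hdc⟩ := hdY
      have h1 := hcol a (by simp) b (by simp) c (by simp) hab hac hbc
      have h2 := hcol d (by simp) a (by simp) b (by simp) hda hdb hab
      have h3 := hcol d (by simp) a (by simp) c (by simp) hda hdc hac
      have h4 := hcol b (by simp) c (by simp) d (by simp) hbc (Ne.symm hdb) (Ne.symm hdc)
      have h5 := hcol b (by simp) c (by simp) a (by simp) hbc hab.symm hac.symm
      refine ⟨conicDim_quadruple hab hac hbc hda hdb hdc (Or.inl h1), fun p hp => ?_⟩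
      simp only [Set.mem_insert_iff, Set.mem_singleton_iff, not_or] at hp
      exact separated_quadruple hp.1 hp.2.1 hp.2.2.1 hp.2.2.2 (fun _ => ⟨h2, h3⟩)
        (fun _ => ⟨h4, h5⟩)

end Flats

section Types

variable {F : Type*} [Field F]

theorem lineSet_eq_of_det {u v : F × F × F} (hu : u.1 ≠ 0 ∨ u.2.1 ≠ 0) (hv : v.1 ≠ 0 ∨ v.2.1 ≠ 0)
    (hdet : u.1 * v.2.1 - u.2.1 * v.1 = 0) {p : Plane F} (hpu : p ∈ lineSet u)
    (hpv : p ∈ lineSet v) : lineSet u = lineSet v := by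
  have sub : ∀ {u v : F × F × F}, (u.1 ≠ 0 ∨ u.2.1 ≠ 0) →
      u.1 * v.2.1 - u.2.1 * v.1 = 0 → p ∈ lineSet u → p ∈ lineSet v → lineSet u ⊆ lineSet v := by
    intro u v hu hdet hpu hpv r hr
    rw [mem_lineSet, linEval] at *
    rcases hu with h | h
    · refine (mul_eq_zero.1 (?_ : u.1 * _ = 0)).resolve_left h
      linear_combination v.1 * (hr - hpu) + u.1 * hpv + (r 1 - p 1) * hdet
    · refine (mul_eq_zero.1 (?_ : u.2.1 * _ = 0)).resolve_left h
      linear_combination v.2.1 * (hr - hpu) + u.2.1 * hpv - (r 0 - p 0) * hdet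
  exact Set.Subset.antisymm (sub hu hdet hpu hpv)
    (sub hv (by linear_combination -hdet) hpv hpu)

theorem exists_mem_inter_of_det {u v : F × F × F} (hdet : u.1 * v.2.1 - u.2.1 * v.1 ≠ 0) :
    ∃ p, p ∈ lineSet u ∧ p ∈ lineSet v := by
  refine ⟨![(u.2.1 * v.2.2 - u.2.2 * v.2.1) / (u.1 * v.2.1 - u.2.1 * v.1),
    (u.2.2 * v.1 - u.1 * v.2.2) / (u.1 * v.2.1 - u.2.1 * v.1)], ?_, ?_⟩
  · simp only [mem_lineSet, linEval, Matrix.cons_val_zero, Matrix.cons_val_one]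
    rw [← mul_right_inj' hdet, mul_zero, mul_add, mul_add, mul_left_comm, mul_div_cancel₀ _ hdet,
      mul_left_comm _ u.2.1, mul_div_cancel₀ _ hdet]
    ring
  · simp only [mem_lineSet, linEval, Matrix.cons_val_zero, Matrix.cons_val_one]
    rw [← mul_right_inj' hdet, mul_zero, mul_add, mul_add, mul_left_comm, mul_div_cancel₀ _ hdet,
      mul_left_comm _ v.2.1, mul_div_cancel₀ _ hdet]
    ring

theorem eq_of_mem_affineLines {L L' : Set (Plane F)} (hL : L ∈ affineLines F)
    (hL' : L' ∈ affineLines F) {a b : Plane F} (hab : a ≠ b) (ha : a ∈ L) (hb : b ∈ L)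
    (ha' : a ∈ L') (hb' : b ∈ L') : L = L' := by
  rw [affineLines_eq_lineSet] at hL hL'
  obtain ⟨u, hu, rfl⟩ := hL
  obtain ⟨v, hv, rfl⟩ := hL'
  rw [lineSet_eq_join hu hab ha hb, lineSet_eq_join hv hab ha' hb']

theorem lineSet_ne_of_det {u v : F × F × F} (hdet : u.1 * v.2.1 - u.2.1 * v.1 ≠ 0) :
    lineSet u ≠ lineSet v := by
  intro h
  have hu : u.1 ≠ 0 ∨ u.2.1 ≠ 0 := by
    by_contra! h0
    rw [h0.1, h0.2] at hdet
    simp at hdet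
  obtain ⟨a, ha, b, hb, hab⟩ := exists_two_points hu
  have ha' := h ▸ ha
  have hb' := h ▸ hb
  rw [mem_lineSet, linEval] at *
  rcases plane_ne hab with hx | hx
  · apply hdet
    refine (mul_eq_zero.1 (?_ : (b 0 - a 0) * _ = 0)).resolve_left hx
    linear_combination v.2.1 * (hb - ha) - u.2.1 * (hb' - ha')
  · apply hdet
    refine (mul_eq_zero.1 (?_ : (b 1 - a 1) * _ = 0)).resolve_left hx
    linear_combination u.1 * (hb' - ha') - v.1 * (hb - ha)

theorem isLineForm_iff {l : MvPolynomial (Fin 3) F} :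
    IsLineForm l ↔ ∃ u ≠ 0, linForm u = l := by
  constructor
  · rintro ⟨h, h0⟩
    obtain ⟨u, rfl⟩ := exists_linForm_eq h
    exact ⟨u, fun hu => h0 (linForm_eq_zero.2 hu), rfl⟩
  · rintro ⟨u, hu, rfl⟩
    exact ⟨linForm_isHomogeneous u, fun h => hu (linForm_eq_zero.1 h)⟩

theorem homogenize_ne_zero (p : Plane F) : (![p 0, p 1, 1] : Fin 3 → F) ≠ 0 := fun h =>
  one_ne_zero (congrFun h 2)

/-- The affine plane as a subset of the projective plane. -/
def affinePoint (p : Plane F) : Projectivization F (Fin 3 → F) :=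
  Projectivization.mk F _ (homogenize_ne_zero p)

theorem affinePoint_mem_projZeros {u : F × F × F} {p : Plane F} :
    affinePoint p ∈ projZeros (linForm u) ↔ p ∈ lineSet u := by
  rw [affinePoint, mk_mem_projZeros_linForm, eval_linForm, mem_lineSet, linEval]
  simp

theorem affinePoint_notMem_lineAtInfinity (p : Plane F) : affinePoint p ∉ lineAtInfinity F := by
  rw [affinePoint, mk_mem_lineAtInfinity]
  simp

theorem exists_affinePoint_eq {P : Projectivization F (Fin 3 → F)} (hP : P ∉ lineAtInfinity F) :
    ∃ p, affinePoint p = P := by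
  induction P with | h v hv
  rw [mk_mem_lineAtInfinity] at hP
  refine ⟨![v 0 / v 2, v 1 / v 2], ?_⟩
  rw [affinePoint, Projectivization.mk_eq_mk_iff']
  refine ⟨(v 2)⁻¹, ?_⟩
  ext i
  fin_cases i
  · simp; field_simp
  · simp; field_simp
  · simp [hP]

theorem lineSet_eq_of_projZeros {u v : F × F × F}
    (h : projZeros (linForm u) = projZeros (linForm v)) : lineSet u = lineSet v := by
  ext p
  rw [← affinePoint_mem_projZeros, h, affinePoint_mem_projZeros]

theorem proper_of_projZeros_ne {u : F × F × F} (hu : u ≠ 0)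
    (h : projZeros (linForm u) ≠ lineAtInfinity F) : u.1 ≠ 0 ∨ u.2.1 ≠ 0 := by
  by_contra! h0
  apply h
  have h2 : u.2.2 ≠ 0 := fun h2 => hu (Prod.ext h0.1 (Prod.ext h0.2 h2))
  ext P
  induction P with | h v hv
  rw [mk_mem_lineAtInfinity, mk_mem_projZeros_linForm, eval_linForm, h0.1, h0.2]
  simp [h2]

theorem projZeros_ne_of_proper {u : F × F × F} (hu : u.1 ≠ 0 ∨ u.2.1 ≠ 0) :
    projZeros (linForm u) ≠ lineAtInfinity F := by
  obtain ⟨a, ha, -⟩ := exists_two_points hu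
  intro h
  exact affinePoint_notMem_lineAtInfinity a (h ▸ affinePoint_mem_projZeros.2 ha)

theorem crossingPairs_eq : crossingPairs F = {X | ∃ L ∈ affineLines F, ∃ L' ∈ affineLines F,
    L ≠ L' ∧ (L ∩ L').Nonempty ∧ X = L ∪ L'} := by
  rw [affineLines_eq_lineSet]
  ext X
  constructor
  · rintro ⟨_, l, m, ⟨hl, hm, hne, rfl⟩, hdis, rfl⟩
    obtain ⟨u, hu, rfl⟩ := isLineForm_iff.1 hl
    obtain ⟨v, hv, rfl⟩ := isLineForm_iff.1 hm
    rw [linForm_mul_linForm, affineZeros_quadForm, quadZeros_mulCoef]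
    have hdet : u.1 * v.2.1 - u.2.1 * v.1 ≠ 0 := by
      intro hdet
      obtain ⟨x, y, hxy, h1, h2⟩ : ∃ x y : F, (x ≠ 0 ∨ y ≠ 0) ∧ u.1 * x + u.2.1 * y = 0 ∧
          v.1 * x + v.2.1 * y = 0 := by
        by_cases hu' : u.1 ≠ 0 ∨ u.2.1 ≠ 0
        · exact ⟨-u.2.1, u.1, by simpa [or_comm] using hu', by ring, by linear_combination hdet⟩
        · push Not at hu'
          by_cases hv' : v.1 ≠ 0 ∨ v.2.1 ≠ 0
          · exact ⟨-v.2.1, v.1, by simpa [or_comm] using hv', by rw [hu'.1, hu'.2]; ring, by ring⟩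
          · push Not at hv'
            exact ⟨1, 0, by simp, by rw [hu'.1, hu'.2]; ring, by rw [hv'.1, hv'.2]; ring⟩
      have hxy0 : (![x, y, 0] : Fin 3 → F) ≠ 0 := by
        intro h
        rcases hxy with h0 | h0
        · exact h0 (congrFun h 0)
        · exact h0 (congrFun h 1)
      refine Set.disjoint_left.1 hdis
        (show Projectivization.mk F _ hxy0 ∈ _ from ⟨?_, ?_⟩) ((mk_mem_lineAtInfinity _).2 rfl)
      · rw [mk_mem_projZeros_linForm, eval_linForm]
        simpa using h1
      · rw [mk_mem_projZeros_linForm, eval_linForm]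
        simpa using h2
    have hu' : u.1 ≠ 0 ∨ u.2.1 ≠ 0 := by
      by_contra! h0
      rw [h0.1, h0.2] at hdet
      simp at hdet
    have hv' : v.1 ≠ 0 ∨ v.2.1 ≠ 0 := by
      by_contra! h0
      rw [h0.1, h0.2] at hdet
      simp at hdet
    exact ⟨_, ⟨u, hu', rfl⟩, _, ⟨v, hv', rfl⟩, lineSet_ne_of_det hdet,
      exists_mem_inter_of_det hdet, rfl⟩
  · rintro ⟨_, ⟨u, hu, rfl⟩, _, ⟨v, hv, rfl⟩, hne, ⟨p, hpu, hpv⟩, rfl⟩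
    have hu0 : u ≠ 0 := by rintro rfl; simp at hu
    have hv0 : v ≠ 0 := by rintro rfl; simp at hv
    have hdet : u.1 * v.2.1 - u.2.1 * v.1 ≠ 0 := fun h =>
      hne (lineSet_eq_of_det hu hv h hpu hpv)
    refine ⟨_, linForm u, linForm v, ⟨isLineForm_iff.2 ⟨u, hu0, rfl⟩, isLineForm_iff.2 ⟨v, hv0, rfl⟩,
      fun h => hne (lineSet_eq_of_projZeros h), rfl⟩, ?_, ?_⟩
    · rw [Set.disjoint_left]
      intro P
      induction P with | h x hx
      rintro ⟨h1, h2⟩ h3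
      rw [mk_mem_lineAtInfinity] at h3
      rw [mk_mem_projZeros_linForm, eval_linForm, h3] at h1 h2
      apply hx
      ext i
      fin_cases i
      · refine (mul_eq_zero.1 (?_ : (u.1 * v.2.1 - u.2.1 * v.1) * _ = 0)).resolve_left hdet
        simp only [Fin.zero_eta]
        linear_combination v.2.1 * h1 - u.2.1 * h2
      · refine (mul_eq_zero.1 (?_ : (u.1 * v.2.1 - u.2.1 * v.1) * _ = 0)).resolve_left hdet
        simp only [Fin.mk_one]
        linear_combination u.1 * h2 - v.1 * h1
      · exact h3
    · rw [linForm_mul_linForm, affineZeros_quadForm, quadZeros_mulCoef]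

theorem parallelPairs_eq : parallelPairs F = {X | ∃ L ∈ affineLines F, ∃ L' ∈ affineLines F,
    Disjoint L L' ∧ X = L ∪ L'} := by
  rw [affineLines_eq_lineSet]
  ext X
  constructor
  · rintro ⟨_, l, m, ⟨hl, hm, hne, rfl⟩, hlL, hmL, hsub, rfl⟩
    obtain ⟨u, hu, rfl⟩ := isLineForm_iff.1 hl
    obtain ⟨v, hv, rfl⟩ := isLineForm_iff.1 hm
    rw [linForm_mul_linForm, affineZeros_quadForm, quadZeros_mulCoef]
    refine ⟨_, ⟨u, proper_of_projZeros_ne hu hlL, rfl⟩, _, ⟨v, proper_of_projZeros_ne hv hmL, rfl⟩,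
      Set.disjoint_left.2 fun p hp hp' => ?_, rfl⟩
    exact affinePoint_notMem_lineAtInfinity p
      (hsub ⟨affinePoint_mem_projZeros.2 hp, affinePoint_mem_projZeros.2 hp'⟩)
  · rintro ⟨_, ⟨u, hu, rfl⟩, _, ⟨v, hv, rfl⟩, hdis, rfl⟩
    have hu0 : u ≠ 0 := by rintro rfl; simp at hu
    have hv0 : v ≠ 0 := by rintro rfl; simp at hv
    refine ⟨_, linForm u, linForm v, ⟨isLineForm_iff.2 ⟨u, hu0, rfl⟩, isLineForm_iff.2 ⟨v, hv0, rfl⟩,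
      fun h => ?_, rfl⟩, projZeros_ne_of_proper hu, projZeros_ne_of_proper hv, ?_, ?_⟩
    · obtain ⟨a, ha, -⟩ := exists_two_points hu
      exact Set.disjoint_left.1 hdis ha (lineSet_eq_of_projZeros h ▸ ha)
    · rintro P ⟨h1, h2⟩
      by_contra h3
      obtain ⟨p, rfl⟩ := exists_affinePoint_eq h3
      exact Set.disjoint_left.1 hdis (affinePoint_mem_projZeros.1 h1)
        (affinePoint_mem_projZeros.1 h2)
    · rw [linForm_mul_linForm, affineZeros_quadForm, quadZeros_mulCoef]

variable [Fintype F]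

theorem ncard_affineLine {L : Set (Plane F)} (hL : L ∈ affineLines F) :
    L.ncard = Fintype.card F := by
  rw [affineLines_eq_lineSet] at hL
  obtain ⟨u, hu, rfl⟩ := hL
  exact ncard_lineSet hu

theorem ncard_parallelPair {X : Set (Plane F)} (hX : X ∈ parallelPairs F) :
    X.ncard = 2 * Fintype.card F := by
  rw [parallelPairs_eq] at hX
  obtain ⟨L, hL, L', hL', hdis, rfl⟩ := hX
  rw [Set.ncard_union_eq hdis, ncard_affineLine hL, ncard_affineLine hL', two_mul]

omit [Fintype F] in
theorem subsingleton_inter {L L' : Set (Plane F)} (hL : L ∈ affineLines F)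
    (hL' : L' ∈ affineLines F) (hne : L ≠ L') : (L ∩ L').Subsingleton := by
  intro a ha b hb
  by_contra hab
  exact hne (eq_of_mem_affineLines hL hL' hab ha.1 hb.1 ha.2 hb.2)

theorem ncard_crossingPair {X : Set (Plane F)} (hX : X ∈ crossingPairs F) :
    X.ncard = 2 * Fintype.card F - 1 := by
  rw [crossingPairs_eq] at hX
  obtain ⟨L, hL, L', hL', hne, hnon, rfl⟩ := hX
  have h := Set.ncard_union_add_ncard_inter L L'
  obtain ⟨p, hp⟩ := (subsingleton_inter hL hL' hne).eq_empty_or_singleton.resolve_left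
    hnon.ne_empty
  rw [hp, Set.ncard_singleton, ncard_affineLine hL, ncard_affineLine hL'] at h
  omega

theorem ncard_irredConicSet {k : ℕ} {X : Set (Plane F)} (hX : X ∈ irredConicSets F k) :
    X.ncard + k = Fintype.card F + 1 := by
  rw [irredConicSets_eq] at hX
  obtain ⟨w, ⟨hw, rfl⟩, rfl⟩ := hX
  exact ncard_quadZeros_add hw

omit [Fintype F] in
theorem isConicFlat_one_of_le {w : Coef F} (hw : w ≠ 0) (h : conicDim (quadZeros w) ≤ 1) :
    IsConicFlat 1 (quadZeros w) := by
  have hmem : w ∈ vanishing (quadEval F) (quadZeros w) := fun p hp => hp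
  refine ⟨le_antisymm h ?_, fun p hp => ⟨w, hmem, hp⟩⟩
  have : Nontrivial (vanishing (quadEval F) (quadZeros w)) :=
    ⟨⟨w, hmem⟩, 0, fun h => hw (congrArg Subtype.val h)⟩
  exact Module.finrank_pos

omit [Fintype F] in
theorem mulCoef_ne_zero {u v : F × F × F} (hu : u ≠ 0) (hv : v ≠ 0) : mulCoef u v ≠ 0 := by
  intro h
  rw [← quadForm_eq_zero, ← linForm_mul_linForm, mul_eq_zero, linForm_eq_zero,
    linForm_eq_zero] at h
  exact h.elim hu hv

theorem exists_two_off_line (hq : 3 ≤ Fintype.card F) {L L' : Set (Plane F)}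
    (hL : L ∈ affineLines F) (hL' : L' ∈ affineLines F) (hne : L ≠ L') :
    ∃ d ∈ L', ∃ e ∈ L', d ∉ L ∧ e ∉ L ∧ d ≠ e := by
  have h := Set.ncard_inter_add_ncard_sdiff_eq_ncard L' L
  have h1 : (L' ∩ L).ncard ≤ 1 :=
    (Set.ncard_le_one_iff_subsingleton).2 (subsingleton_inter hL' hL hne.symm)
  rw [ncard_affineLine hL'] at h
  obtain ⟨d, e, hd, he, hde⟩ := (Set.one_lt_ncard_iff).1 (by omega : 1 < (L' \ L).ncard)
  exact ⟨d, hd.1, e, he.1, hd.2, he.2, hde⟩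

theorem isConicFlat_one_of_lines (hq : 3 ≤ Fintype.card F) {L L' : Set (Plane F)}
    (hL : L ∈ affineLines F) (hL' : L' ∈ affineLines F) (hne : L ≠ L') :
    IsConicFlat 1 (L ∪ L') := by
  obtain ⟨d, hd, e, he, hdL, heL, hde⟩ := exists_two_off_line hq hL hL' hne
  rw [affineLines_eq_lineSet] at hL hL'
  obtain ⟨u, hu, rfl⟩ := hL
  obtain ⟨v, hv, rfl⟩ := hL'
  have hu0 : u ≠ 0 := by rintro rfl; simp at hu
  have hv0 : v ≠ 0 := by rintro rfl; simp at hv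
  rw [← quadZeros_mulCoef]
  apply isConicFlat_one_of_le (mulCoef_ne_zero hu0 hv0)
  rw [quadZeros_mulCoef]
  obtain ⟨a, b, c, ha, hb, hc, hab, hac, hbc⟩ := (Set.two_lt_ncard_iff (Set.toFinite _)).1
    (show 2 < (lineSet u).ncard by rw [ncard_lineSet hu]; omega)
  have hj := lineSet_eq_join hu hab ha hb
  refine conicDim_le_one_of_five hab hac hbc (d := d) (e := e) ?_ ?_ ?_ (Or.inr ?_)
    (separated_line_point (u := u) (b := d) ?_ heL hde.symm) ?_
  · rintro rfl; exact hdL ha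
  · rintro rfl; exact hdL hb
  · rintro rfl; exact hdL hc
  · rwa [Ne, ← mem_lineSet_join, ← hj]
  · rintro r (rfl | rfl | rfl | rfl)
    · exact Or.inl rfl
    · exact Or.inr ha
    · exact Or.inr hb
    · exact Or.inr hc
  · rintro r (rfl | rfl | rfl | rfl | rfl)
    · exact Or.inr he
    · exact Or.inr hd
    · exact Or.inl ha
    · exact Or.inl hb
    · exact Or.inl hc

theorem isConicFlat_one_of_irreducible {w : Coef F} (hw : conicDet w ≠ 0)
    (h5 : 5 ≤ (quadZeros w).ncard) : IsConicFlat 1 (quadZeros w) := by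
  have hw0 : w ≠ 0 := by rintro rfl; simp [conicDet] at hw
  apply isConicFlat_one_of_le hw0
  obtain ⟨a, b, c, ha, hb, hc, hab, hac, hbc⟩ := (Set.two_lt_ncard_iff (Set.toFinite _)).1
    (show 2 < (quadZeros w).ncard by omega)
  have h3 : ({a, b, c} : Set (Plane F)).ncard = 3 :=
    Set.ncard_eq_three.2 ⟨a, b, c, hab, hac, hbc, rfl⟩
  obtain ⟨d, hd, hdn⟩ := Set.exists_mem_notMem_of_ncard_lt_ncard
    (show ({a, b, c} : Set (Plane F)).ncard < (quadZeros w).ncard by omega)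
  have h4 : ({d, a, b, c} : Set (Plane F)).ncard = 4 := by
    rw [Set.ncard_insert_of_notMem hdn, h3]
  obtain ⟨e, he, hen⟩ := Set.exists_mem_notMem_of_ncard_lt_ncard
    (show ({d, a, b, c} : Set (Plane F)).ncard < (quadZeros w).ncard by omega)
  simp only [Set.mem_insert_iff, Set.mem_singleton_iff, not_or] at hdn hen
  refine conicDim_le_one_of_five hab hac hbc hdn.1 hdn.2.1 hdn.2.2
    (Or.inl (det3_ne_zero_of_conicDet hw hab hac.symm hbc.symm ha hb hc))
    (separated_quadruple hen.1 hen.2.1 hen.2.2.1 hen.2.2.2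
      (fun h => absurd h (det3_ne_zero_of_conicDet hw hdn.1 hen.1 hen.2.1 hd ha he))
      (fun h => absurd h (det3_ne_zero_of_conicDet hw hbc hen.2.2.1 hen.2.2.2 hb hc he))) ?_
  rintro r (rfl | rfl | rfl | rfl | rfl) <;> assumption

theorem isConicFlat_one_iff_maximal (hq : 3 ≤ Fintype.card F) (X : Set (Plane F)) :
    IsConicFlat 1 X ↔ Maximal (· ∈ conicZeroSets F) X := by
  rw [conicZeroSets_eq]
  exact finrank_vanishing_eq_one_iff_maximal (quadEval_injective hq) X

theorem not_subset_lineSet_of_maximal (hq : 3 ≤ Fintype.card F) {X : Set (Plane F)}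
    (hX : Maximal (· ∈ conicZeroSets F) X) {u : F × F × F} (hu : u ≠ 0) : ¬ X ⊆ lineSet u := by
  intro hsub
  obtain ⟨p, hp⟩ : ∃ p, p ∉ lineSet u := by
    by_contra! h
    refine mulCoef_ne_zero hu (v := (0, 0, 1)) (by simp) (quadEval_injective hq ?_)
    ext p
    rw [quadEval_mulCoef, (h p : linEval u p = 0)]
    simp
  have h : quadZeros (mulCoef u (1, 0, -p 0)) ∈ conicZeroSets F := by
    rw [conicZeroSets_eq]
    exact ⟨_, mulCoef_ne_zero hu (by simp), rfl⟩
  rw [quadZeros_mulCoef] at h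
  have hp2 : p ∈ X := hX.2 h (fun r hr => Or.inl (hsub hr)) (Or.inr (by
    simp [mem_lineSet, linEval]))
  exact hp (hsub hp2)

theorem isConicFlat_one (hq : 3 ≤ Fintype.card F) (X : Set (Plane F)) : IsConicFlat 1 X ↔
    X ∈ parallelPairs F ∪ crossingPairs F ∨
      ∃ w : Coef F, conicDet w ≠ 0 ∧ X = quadZeros w ∧ 5 ≤ X.ncard := by
  constructor
  · intro h
    have hmax := (isConicFlat_one_iff_maximal hq X).1 h
    obtain ⟨w, hw, rfl⟩ : ∃ w, w ≠ 0 ∧ X = quadZeros w := by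
      have := hmax.1
      rwa [conicZeroSets_eq] at this
    have h5 := six_le_conicDim_add_ncard (quadZeros w)
    rw [h.1] at h5
    by_cases hD : conicDet w = 0
    · left
      rcases exists_mulCoef_or_subsingleton hD with ⟨u, v, rfl⟩ | hsub
      · rw [quadZeros_mulCoef] at hmax ⊢
        have hu0 : u ≠ 0 := by rintro rfl; exact hw (by simp [mulCoef])
        have hv0 : v ≠ 0 := by rintro rfl; exact hw (by simp [mulCoef])
        have improper : ∀ u : F × F × F, u ≠ 0 → ¬ (u.1 ≠ 0 ∨ u.2.1 ≠ 0) → lineSet u = ∅ := by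
          intro u hu0 hu
          push Not at hu
          have h2 : u.2.2 ≠ 0 := fun h2 => hu0 (Prod.ext hu.1 (Prod.ext hu.2 h2))
          ext p
          simp [mem_lineSet, linEval, hu.1, hu.2, h2]
        by_cases hu : u.1 ≠ 0 ∨ u.2.1 ≠ 0
        · by_cases hv : v.1 ≠ 0 ∨ v.2.1 ≠ 0
          · by_cases hdis : Disjoint (lineSet u) (lineSet v)
            · left
              rw [parallelPairs_eq, affineLines_eq_lineSet]
              exact ⟨_, ⟨u, hu, rfl⟩, _, ⟨v, hv, rfl⟩, hdis, rfl⟩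
            · right
              rw [crossingPairs_eq, affineLines_eq_lineSet]
              refine ⟨_, ⟨u, hu, rfl⟩, _, ⟨v, hv, rfl⟩, fun he => ?_,
                Set.not_disjoint_iff_nonempty_inter.1 hdis, rfl⟩
              rw [he, Set.union_self] at hmax
              exact not_subset_lineSet_of_maximal hq hmax hv0 subset_rfl
          · exfalso
            rw [improper v hv0 hv, Set.union_empty] at hmax
            exact not_subset_lineSet_of_maximal hq hmax hu0 subset_rfl
        · exfalso
          rw [improper u hu0 hu, Set.empty_union] at hmax
          exact not_subset_lineSet_of_maximal hq hmax hv0 subset_rfl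
      · exfalso
        have := Set.ncard_le_one_iff_subsingleton.2 hsub
        omega
    · exact Or.inr ⟨w, hD, rfl, by omega⟩
  · rintro ((h | h) | ⟨w, hw, rfl, h5⟩)
    · rw [parallelPairs_eq] at h
      obtain ⟨L, hL, L', hL', hdis, rfl⟩ := h
      refine isConicFlat_one_of_lines hq hL hL' ?_
      rintro rfl
      rw [disjoint_self, Set.bot_eq_empty] at hdis
      have := ncard_affineLine hL
      rw [hdis, Set.ncard_empty] at this
      omega
    · rw [crossingPairs_eq] at h
      obtain ⟨L, hL, L', hL', hne, -, rfl⟩ := h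
      exact isConicFlat_one_of_lines hq hL hL' hne
    · exact isConicFlat_one_of_irreducible hw h5

theorem isConicFlat_one_iff_types (hq : 3 ≤ Fintype.card F) (X : Set (Plane F)) :
    IsConicFlat 1 X ↔ X ∈ parallelPairs F ∪ crossingPairs F ∨
      ∃ k ≤ 2, k + 4 ≤ Fintype.card F ∧ X ∈ irredConicSets F k := by
  rw [isConicFlat_one hq]
  refine or_congr_right ⟨?_, ?_⟩
  · rintro ⟨w, hw, rfl, h5⟩
    have hX : quadZeros w ∈ irredConicSets F (infinityRoots w).ncard := by
      rw [irredConicSets_eq]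
      exact ⟨w, ⟨hw, rfl⟩, rfl⟩
    refine ⟨_, ?_, ?_, hX⟩
    · rcases infinityRoots_cases (lead_ne_zero_of_conicDet hw) with
        ⟨h, -⟩ | ⟨o, h, -⟩ | ⟨o, o', hne, h, -⟩
      · rw [h, Set.ncard_empty]; omega
      · rw [h, Set.ncard_singleton]; omega
      · rw [h, Set.ncard_pair hne]
    · have := ncard_irredConicSet hX
      omega
  · rintro ⟨k, -, hk, hX⟩
    have := ncard_irredConicSet hX
    rw [irredConicSets_eq] at hX
    obtain ⟨w, ⟨hw, rfl⟩, rfl⟩ := hX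
    exact ⟨w, hw, rfl, by omega⟩

end Types

section DoubleCounting

theorem ncard_mul_eq_ncard_mul {α β : Type*} [Finite α] [Finite β] {A : Set α} {B : Set β}
    (r : α → β → Prop) {m n : ℕ} (hA : ∀ a ∈ A, {b | b ∈ B ∧ r a b}.ncard = m)
    (hB : ∀ b ∈ B, {a | a ∈ A ∧ r a b}.ncard = n) : A.ncard * m = B.ncard * n := by
  classical
  have := Fintype.ofFinite α
  have := Fintype.ofFinite β
  rw [Set.ncard_eq_toFinset_card', Set.ncard_eq_toFinset_card']
  refine Finset.card_mul_eq_card_mul r (fun a ha => ?_) (fun b hb => ?_)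
  · rw [← hA a (by simpa using ha), Set.ncard_eq_toFinset_card']
    congr 1
    ext b
    simp [Finset.bipartiteAbove]
  · rw [← hB b (by simpa using hb), Set.ncard_eq_toFinset_card']
    congr 1
    ext a
    simp [Finset.bipartiteBelow]

/-- If the members of `ℬ` have `n` elements and all sets obtained by deleting one element are in
`𝒜`, and every member of `𝒜` can be extended in `m` ways, then `#𝒜 * m = #ℬ * n`. -/
theorem ncard_mul_eq_of_extend {α : Type*} [Finite α] {𝒜 ℬ : Set (Set α)} {m n : ℕ}
    (hℬ : ∀ T ∈ ℬ, T.ncard = n ∧ ∀ x ∈ T, T \ {x} ∈ 𝒜)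
    (h𝒜 : ∀ S ∈ 𝒜, {p | p ∉ S ∧ insert p S ∈ ℬ}.ncard = m) : 𝒜.ncard * m = ℬ.ncard * n := by
  refine ncard_mul_eq_ncard_mul (fun S T => ∃ x, x ∉ S ∧ T = insert x S) (fun S hS => ?_)
    (fun T hT => ?_)
  · have : {T | T ∈ ℬ ∧ ∃ x, x ∉ S ∧ T = insert x S} =
        (fun p => insert p S) '' {p | p ∉ S ∧ insert p S ∈ ℬ} := by
      ext T
      constructor
      · rintro ⟨hT, x, hx, rfl⟩
        exact ⟨x, ⟨hx, hT⟩, rfl⟩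
      · rintro ⟨x, ⟨hx, hT⟩, rfl⟩
        exact ⟨hT, x, hx, rfl⟩
    rw [this, Set.InjOn.ncard_image, h𝒜 S hS]
    rintro x ⟨hx, -⟩ y ⟨hy, -⟩ h
    have : x ∈ insert y S := by
      rw [show insert y S = insert x S from h.symm]
      exact Set.mem_insert x S
    exact this.resolve_right hx
  · have : {S | S ∈ 𝒜 ∧ ∃ x, x ∉ S ∧ T = insert x S} = (fun x => T \ {x}) '' T := by
      ext S
      constructor
      · rintro ⟨hS, x, hx, rfl⟩
        exact ⟨x, Set.mem_insert _ _, by simp [hx]⟩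
      · rintro ⟨x, hx, rfl⟩
        exact ⟨(hℬ T hT).2 x hx, x, by simp, by simp [Set.insert_eq_of_mem hx]⟩
    rw [this, Set.InjOn.ncard_image, (hℬ T hT).1]
    intro x hx y hy h
    by_contra hne
    have : y ∈ T \ {x} := ⟨hy, fun h => hne h.symm⟩
    rw [show T \ {x} = T \ {y} from h] at this
    exact this.2 rfl

theorem ncard_setOf_ncard_eq_two {α : Type*} [Fintype α] :
    {S : Set α | S.ncard = 2}.ncard = (Fintype.card α).choose 2 := by
  classical
  have : {S : Set α | S.ncard = 2} =
      (fun s : Finset α => (s : Set α)) '' (Finset.univ.powersetCard 2 : Finset (Finset α)) := by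
    ext S
    simp only [Set.mem_ofPred_eq, Set.mem_image, SetLike.mem_coe, Finset.mem_powersetCard_univ]
    constructor
    · intro h
      exact ⟨S.toFinset, by rwa [← Set.ncard_eq_toFinset_card'], by simp⟩
    · rintro ⟨s, hs, rfl⟩
      rwa [Set.ncard_coe_finset]
  rw [this, Set.ncard_image_of_injective _ Finset.coe_injective, Set.ncard_coe_finset,
    Finset.card_powersetCard, Finset.card_univ]

theorem ncard_ne_zero {F : Type*} [Field F] [Fintype F] :
    {c : F | c ≠ 0}.ncard = Fintype.card F - 1 := by
  have : {c : F | c ≠ 0} = {0}ᶜ := rfl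
  rw [this, Set.ncard_compl, Set.ncard_singleton, Nat.card_eq_fintype_card]

end DoubleCounting

section Counting

variable {F : Type*} [Field F] [Fintype F]

theorem ncard_lines_through (p : Plane F) :
    {L | L ∈ affineLines F ∧ p ∈ L}.ncard = Fintype.card F + 1 := by
  let φ : Option F → Set (Plane F) := fun o =>
    lineSet (join p ![p 0 + (direction o).1, p 1 + (direction o).2])
  have hne : ∀ o : Option F, p ≠ ![p 0 + (direction o).1, p 1 + (direction o).2] := by
    intro o h
    have h0 : p 0 = p 0 + (direction o).1 := congrFun h 0
    have h1 : p 1 = p 1 + (direction o).2 := congrFun h 1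
    rcases direction_ne_zero o with h2 | h2
    · exact h2 (by linear_combination -h0)
    · exact h2 (by linear_combination -h1)
  have hinj : Function.Injective φ := by
    intro o o' h
    have h1 : ![p 0 + (direction o').1, p 1 + (direction o').2] ∈ φ o := by
      rw [h]
      exact mem_lineSet_join.2 (det3_self_right _ _)
    rw [mem_lineSet_join] at h1
    simp [det3] at h1
    exact direction_det_injective (sub_eq_zero.1 h1)
  have himg : {L | L ∈ affineLines F ∧ p ∈ L} = φ '' Set.univ := by
    ext L
    constructor
    · rintro ⟨hL, hp⟩
      obtain ⟨b, hb, hbp⟩ : ∃ b ∈ L, b ≠ p := by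
        rw [affineLines_eq_lineSet] at hL
        obtain ⟨u, hu, rfl⟩ := hL
        obtain ⟨a, ha, b, hb, hab⟩ := exists_two_points hu
        by_cases h : a = p
        · exact ⟨b, hb, fun h' => hab (h.trans h'.symm)⟩
        · exact ⟨a, ha, h⟩
      obtain ⟨o, r, hr, h0, h1⟩ := exists_eq_smul_direction (plane_ne hbp.symm)
      refine ⟨o, trivial, ?_⟩
      refine eq_of_mem_affineLines (a := p) (b := b) ?_ hL hbp.symm
        (mem_lineSet_join.2 (det3_self_left _ _)) (mem_lineSet_join.2 ?_) hp hb
      · rw [affineLines_eq]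
        exact ⟨_, _, hne o, rfl⟩
      · simp [det3, h0, h1]
        ring
    · rintro ⟨o, -, rfl⟩
      refine ⟨?_, mem_lineSet_join.2 (det3_self_left _ _)⟩
      rw [affineLines_eq]
      exact ⟨_, _, hne o, rfl⟩
  rw [himg, Set.ncard_image_of_injective _ hinj, Set.ncard_univ, Nat.card_eq_fintype_card,
    Fintype.card_option]

theorem ncard_affineLines : (affineLines F).ncard = Fintype.card F ^ 2 + Fintype.card F := by
  have h := ncard_mul_eq_ncard_mul (A := affineLines F) (B := (Set.univ : Set (Plane F)))
    (fun L p => p ∈ L) (m := Fintype.card F) (n := Fintype.card F + 1)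
    (fun L hL => by simpa using ncard_affineLine hL) (fun p _ => ncard_lines_through p)
  rw [Set.ncard_univ, Nat.card_eq_fintype_card, card_plane] at h
  have hq := Fintype.card_pos (α := F)
  apply Nat.eq_of_mul_eq_mul_right hq
  rw [h]; ring

theorem ncard_disjoint_lines {L : Set (Plane F)} (hL : L ∈ affineLines F) :
    {L' | L' ∈ affineLines F ∧ Disjoint L L'}.ncard = Fintype.card F - 1 := by
  rw [affineLines_eq_lineSet] at hL ⊢
  obtain ⟨⟨a, b, c⟩, hu, rfl⟩ := hL
  have himg : {L' | L' ∈ {S | ∃ u : F × F × F, (u.1 ≠ 0 ∨ u.2.1 ≠ 0) ∧ S = lineSet u} ∧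
      Disjoint (lineSet (a, b, c)) L'} = (fun s => lineSet (a, b, s)) '' {c}ᶜ := by
    ext L'
    constructor
    · rintro ⟨⟨v, hv, rfl⟩, hdis⟩
      have hdet : a * v.2.1 - b * v.1 = 0 := by
        by_contra hdet
        obtain ⟨p, hp, hp'⟩ := exists_mem_inter_of_det (u := (a, b, c)) hdet
        exact Set.disjoint_left.1 hdis hp hp'
      obtain ⟨p, hp, -⟩ := exists_two_points hv
      have hs : p ∈ lineSet (a, b, -(a * p 0 + b * p 1)) := by simp [mem_lineSet, linEval]
      refine ⟨-(a * p 0 + b * p 1), ?_, lineSet_eq_of_det (u := (a, b, -(a * p 0 + b * p 1))) hu hv hdet hs hp⟩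
      intro h
      rw [Set.mem_singleton_iff] at h
      rw [h] at hs
      exact Set.disjoint_left.1 hdis hs hp
    · rintro ⟨s, hs, rfl⟩
      refine ⟨⟨(a, b, s), hu, rfl⟩, Set.disjoint_left.2 fun p hp hp' => hs ?_⟩
      rw [mem_lineSet, linEval] at hp hp'
      rw [Set.mem_singleton_iff]
      linear_combination hp' - hp
  rw [himg, Set.InjOn.ncard_image, Set.ncard_compl, Set.ncard_singleton, Nat.card_eq_fintype_card]
  intro s _ t _ h
  obtain ⟨p, hp, -⟩ := exists_two_points (u := (a, b, s)) hu
  have hp' : p ∈ lineSet (a, b, t) := by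
    rw [show lineSet (a, b, t) = lineSet (a, b, s) from h.symm]; exact hp
  rw [mem_lineSet, linEval] at hp hp'
  linear_combination hp - hp'

theorem ncard_meeting_lines {L : Set (Plane F)} (hL : L ∈ affineLines F) :
    {L' | L' ∈ affineLines F ∧ (L ≠ L' ∧ (L ∩ L').Nonempty)}.ncard = Fintype.card F ^ 2 := by
  have hdis := ncard_disjoint_lines hL
  have hq := Fintype.card_pos (α := F)
  have hLne : L.Nonempty := by
    rw [Set.nonempty_iff_ne_empty]
    rintro rfl
    have := ncard_affineLine hL
    rw [Set.ncard_empty] at this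
    omega
  have hpart : affineLines F = insert L ({L' | L' ∈ affineLines F ∧ Disjoint L L'} ∪
      {L' | L' ∈ affineLines F ∧ (L ≠ L' ∧ (L ∩ L').Nonempty)}) := by
    ext L'
    constructor
    · intro h
      by_cases h1 : L' = L
      · exact Or.inl h1
      · by_cases h2 : Disjoint L L'
        · exact Or.inr (Or.inl ⟨h, h2⟩)
        · exact Or.inr (Or.inr ⟨h, Ne.symm h1, Set.not_disjoint_iff_nonempty_inter.1 h2⟩)
    · rintro (rfl | h | h)
      · exact hL
      · exact h.1
      · exact h.1
  have hcard := congrArg Set.ncard hpart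
  rw [Set.ncard_insert_of_notMem, Set.ncard_union_eq, hdis, ncard_affineLines] at hcard
  · omega
  · rw [Set.disjoint_left]
    rintro L' ⟨-, h1⟩ ⟨-, -, h2⟩
    exact Set.not_disjoint_iff_nonempty_inter.2 h2 h1
  · rintro (h | h)
    · rw [Set.mem_ofPred_eq, disjoint_self, Set.bot_eq_empty] at h
      exact hLne.ne_empty h.2
    · exact h.2.1 rfl

theorem eq_or_eq_of_subset_union (hq : 3 ≤ Fintype.card F) {L L' K : Set (Plane F)}
    (hL : L ∈ affineLines F) (hL' : L' ∈ affineLines F) (hK : K ∈ affineLines F)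
    (h : K ⊆ L ∪ L') : K = L ∨ K = L' := by
  by_cases hKL : K = L
  · exact Or.inl hKL
  · obtain ⟨d, hd, e, he, hdL, heL, hde⟩ := exists_two_off_line hq hL hK (Ne.symm hKL)
    exact Or.inr (eq_of_mem_affineLines hK hL' hde hd he ((h hd).resolve_left hdL)
      ((h he).resolve_left heL))

/-- Counting unordered pairs of lines via their unions. -/
theorem ncard_line_pairs (hq : 3 ≤ Fintype.card F) (R : Set (Plane F) → Set (Plane F) → Prop)
    (hsymm : ∀ L L', R L L' → R L' L) (hne : ∀ L ∈ affineLines F, ¬ R L L) {m : ℕ}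
    (hm : ∀ L ∈ affineLines F, {L' | L' ∈ affineLines F ∧ R L L'}.ncard = m) :
    (affineLines F).ncard * m =
      {X | ∃ L ∈ affineLines F, ∃ L' ∈ affineLines F, R L L' ∧ X = L ∪ L'}.ncard * 2 := by
  refine ncard_mul_eq_ncard_mul (fun L X => L ⊆ X) (fun L hL => ?_) ?_
  · rw [← hm L hL]
    have himg : {X | X ∈ {X | ∃ L ∈ affineLines F, ∃ L' ∈ affineLines F, R L L' ∧ X = L ∪ L'} ∧
        L ⊆ X} = (fun L' => L ∪ L') '' {L' | L' ∈ affineLines F ∧ R L L'} := by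
      ext X
      constructor
      · rintro ⟨⟨K, hK, K', hK', hR, rfl⟩, hsub⟩
        rcases eq_or_eq_of_subset_union hq hK hK' hL hsub with rfl | rfl
        · exact ⟨K', ⟨hK', hR⟩, rfl⟩
        · exact ⟨K, ⟨hK, hsymm _ _ hR⟩, Set.union_comm _ _⟩
      · rintro ⟨L', ⟨hL', hR⟩, rfl⟩
        exact ⟨⟨L, hL, L', hL', hR, rfl⟩, Set.subset_union_left⟩
    rw [himg, Set.InjOn.ncard_image]
    rintro K ⟨hK, hRK⟩ K' ⟨hK', hRK'⟩ h
    have hsub : K ⊆ L ∪ K' := by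
      rw [show L ∪ K' = L ∪ K from h.symm]
      exact Set.subset_union_right
    rcases eq_or_eq_of_subset_union hq hL hK' hK hsub with rfl | h
    · exact absurd hRK (hne _ hK)
    · exact h
  · rintro _ ⟨L, hL, L', hL', hR, rfl⟩
    have : {K | K ∈ affineLines F ∧ K ⊆ L ∪ L'} = {L, L'} := by
      ext K
      constructor
      · rintro ⟨hK, hsub⟩
        exact eq_or_eq_of_subset_union hq hL hL' hK hsub
      · rintro (rfl | rfl)
        · exact ⟨hL, Set.subset_union_left⟩
        · exact ⟨hL', Set.subset_union_right⟩
    rw [this, Set.ncard_pair]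
    rintro rfl
    exact hne _ hL hR

theorem ncard_parallelPairs (hq : 3 ≤ Fintype.card F) :
    (Fintype.card F ^ 2 + Fintype.card F) * (Fintype.card F - 1) =
      (parallelPairs F).ncard * 2 := by
  rw [← ncard_affineLines, parallelPairs_eq]
  refine ncard_line_pairs hq Disjoint (fun _ _ h => h.symm) (fun L hL h => ?_)
    (fun L hL => ncard_disjoint_lines hL)
  rw [disjoint_self, Set.bot_eq_empty] at h
  have := ncard_affineLine hL
  rw [h, Set.ncard_empty] at this
  omega

theorem ncard_crossingPairs (hq : 3 ≤ Fintype.card F) :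
    (Fintype.card F ^ 2 + Fintype.card F) * Fintype.card F ^ 2 =
      (crossingPairs F).ncard * 2 := by
  rw [← ncard_affineLines, crossingPairs_eq]
  have := ncard_line_pairs hq (fun L L' : Set (Plane F) => L ≠ L' ∧ (L ∩ L').Nonempty)
    (fun _ _ h => ⟨h.1.symm, by rw [Set.inter_comm]; exact h.2⟩) (fun L hL h => h.1 rfl)
    (fun L hL => ncard_meeting_lines hL)
  simpa only [and_assoc] using this

theorem ncard_linePlusPoint (hq : 3 ≤ Fintype.card F) :
    (Fintype.card F ^ 2 + Fintype.card F) * (Fintype.card F ^ 2 - Fintype.card F) =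
      (linePlusPoint F).ncard := by
  rw [← ncard_affineLines, ← mul_one (linePlusPoint F).ncard]
  refine ncard_mul_eq_ncard_mul (fun L S => ∃ p, p ∉ L ∧ S = insert p L) (fun L hL => ?_) ?_
  · have himg : {S | S ∈ linePlusPoint F ∧ ∃ p, p ∉ L ∧ S = insert p L} =
        (fun p => insert p L) '' Lᶜ := by
      ext S
      constructor
      · rintro ⟨-, p, hp, rfl⟩
        exact ⟨p, hp, rfl⟩
      · rintro ⟨p, hp, rfl⟩
        exact ⟨⟨L, hL, p, hp, rfl⟩, p, hp, rfl⟩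
    rw [himg, Set.InjOn.ncard_image, Set.ncard_compl, ncard_affineLine hL,
      Nat.card_eq_fintype_card, card_plane]
    intro p hp r _ h
    have : p ∈ insert r L := by
      rw [show insert r L = insert p L from h.symm]
      exact Set.mem_insert _ _
    exact this.resolve_right hp
  · rintro _ ⟨L, hL, p, hp, rfl⟩
    rw [Set.ncard_eq_one]
    refine ⟨L, Set.eq_singleton_iff_unique_mem.2 ⟨⟨hL, p, hp, rfl⟩, ?_⟩⟩
    rintro K ⟨hK, r, hr, h⟩
    by_contra hne
    obtain ⟨d, hd, e, he, hdL, heL, hde⟩ := exists_two_off_line hq hL hK (Ne.symm hne)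
    have hsub : K ⊆ insert p L := h ▸ Set.subset_insert _ _
    exact hde (((hsub hd).resolve_right hdL).trans ((hsub he).resolve_right heL).symm)

theorem ncard_triangles :
    (Fintype.card F ^ 2).choose 2 * (Fintype.card F ^ 2 - Fintype.card F) =
      (triangles F).ncard * 3 := by
  rw [← card_plane, ← ncard_setOf_ncard_eq_two, card_plane]
  refine ncard_mul_eq_of_extend (fun T hT => ⟨hT.1, fun x hx => ?_⟩) (fun S hS => ?_)
  · rw [Set.mem_ofPred_eq, Set.ncard_sdiff_singleton_of_mem hx, hT.1]
  · obtain ⟨a, b, hab, rfl⟩ := Set.ncard_eq_two.1 hS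
    rw [← ncard_compl_lineSet (join_proper hab)]
    congr 1
    ext p
    rw [Set.mem_compl_iff, mem_lineSet_join]
    have hcyc : det3 p a b = det3 a b p := by simp only [det3]; ring
    constructor
    · rintro ⟨-, hT⟩ h
      exact hT.2 ((collinear_iff_det3 p a b).2 (hcyc.trans h))
    · intro h
      have hpa : p ≠ a := by rintro rfl; exact h (det3_self_left _ _)
      have hpb : p ≠ b := by rintro rfl; exact h (det3_self_right _ _)
      refine ⟨by simp [hpa, hpb], ?_, fun hc => h (hcyc ▸ (collinear_iff_det3 p a b).1 hc)⟩
      exact Set.ncard_eq_three.2 ⟨p, a, b, hpa, hpb, hab, rfl⟩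

theorem ncard_quadrilaterals :
    (triangles F).ncard * (Fintype.card F ^ 2 - (3 * Fintype.card F - 3)) =
      (quadrilaterals F).ncard * 4 := by
  refine ncard_mul_eq_of_extend (fun T hT => ⟨hT.1, fun x hx => ?_⟩) (fun S hS => ?_)
  · have h3 : (T \ {x}).ncard = 3 := by
      rw [Set.ncard_sdiff_singleton_of_mem hx, hT.1]
    exact ⟨h3, hT.2 _ Set.sdiff_subset h3⟩
  · obtain ⟨a, b, c, hab, hac, hbc, rfl, hdet⟩ := mem_triangles.1 hS
    have line : ∀ {a b : Plane F}, a ≠ b → lineSet (join a b) ∈ affineLines F := fun h => by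
      rw [affineLines_eq]
      exact ⟨_, _, h, rfl⟩
    have left_mem : ∀ a b : Plane F, a ∈ lineSet (join a b) := fun a b =>
      mem_lineSet_join.2 (det3_self_left _ _)
    have right_mem : ∀ a b : Plane F, b ∈ lineSet (join a b) := fun a b =>
      mem_lineSet_join.2 (det3_self_right _ _)
    have hcab : c ∉ lineSet (join a b) := fun h => hdet (mem_lineSet_join.1 h)
    have h12 : lineSet (join a b) ≠ lineSet (join a c) := fun h => hcab (h ▸ right_mem a c)
    have h13 : lineSet (join a b) ≠ lineSet (join b c) := fun h => hcab (h ▸ right_mem b c)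
    have h23 : lineSet (join a c) ≠ lineSet (join b c) := fun h => hcab (by
      rw [eq_of_mem_affineLines (line hab) (line hac) hab (left_mem _ _) (right_mem _ _)
        (left_mem _ _) (h ▸ left_mem b c)]
      exact right_mem a c)
    have hcross : lineSet (join a b) ∪ lineSet (join a c) ∈ crossingPairs F := by
      rw [crossingPairs_eq]
      exact ⟨_, line hab, _, line hac, h12, ⟨a, left_mem _ _, left_mem _ _⟩, rfl⟩
    have hinter : (lineSet (join a b) ∪ lineSet (join a c)) ∩ lineSet (join b c) = {b, c} := by
      ext r
      constructor
      · rintro ⟨h | h, h'⟩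
        · exact Or.inl (subsingleton_inter (line hab) (line hbc) h13 ⟨h, h'⟩
            ⟨right_mem _ _, left_mem _ _⟩)
        · exact Or.inr (subsingleton_inter (line hac) (line hbc) h23 ⟨h, h'⟩
            ⟨right_mem _ _, right_mem _ _⟩)
      · rintro (rfl | rfl)
        · exact ⟨Or.inl (right_mem _ _), left_mem _ _⟩
        · exact ⟨Or.inr (right_mem _ _), right_mem _ _⟩
    have hunion := Set.ncard_union_add_ncard_inter (lineSet (join a b) ∪ lineSet (join a c))
      (lineSet (join b c))
    rw [hinter, Set.ncard_pair hbc, ncard_crossingPair hcross, ncard_lineSet (join_proper hbc)]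
      at hunion
    have hset : {p | p ∉ ({a, b, c} : Set (Plane F)) ∧ insert p {a, b, c} ∈ quadrilaterals F} =
        ((lineSet (join a b) ∪ lineSet (join a c)) ∪ lineSet (join b c))ᶜ := by
      ext p
      have hmem : p ∈ ((lineSet (join a b) ∪ lineSet (join a c)) ∪ lineSet (join b c))ᶜ ↔
          det3 a b p ≠ 0 ∧ det3 a c p ≠ 0 ∧ det3 b c p ≠ 0 := by
        simp [mem_lineSet_join, and_assoc]
      rw [hmem]
      constructor
      · rintro ⟨hp, hQ⟩
        simp only [Set.mem_insert_iff, Set.mem_singleton_iff, not_or] at hp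
        obtain ⟨hpa, hpb, hpc⟩ := hp
        have h := (mem_quadrilaterals.1 hQ).2
        exact ⟨h a (by simp) b (by simp) p (by simp) hab (Ne.symm hpa) (Ne.symm hpb),
          h a (by simp) c (by simp) p (by simp) hac (Ne.symm hpa) (Ne.symm hpc),
          h b (by simp) c (by simp) p (by simp) hbc (Ne.symm hpb) (Ne.symm hpc)⟩
      · rintro ⟨h1, h2, h3⟩
        have hpa : p ≠ a := by rintro rfl; exact h1 (det3_self_left _ _)
        have hpb : p ≠ b := by rintro rfl; exact h1 (det3_self_right _ _)
        have hpc : p ≠ c := by rintro rfl; exact h2 (det3_self_right _ _)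
        have hp : p ∉ ({a, b, c} : Set (Plane F)) := by simp [hpa, hpb, hpc]
        refine ⟨hp, ?_, fun T hT hT3 => ?_⟩
        · rw [Set.ncard_insert_of_notMem hp, Set.ncard_eq_three.2 ⟨a, b, c, hab, hac, hbc, rfl⟩]
        · have h4 : (insert p {a, b, c} : Set (Plane F)).ncard = 4 := by
            rw [Set.ncard_insert_of_notMem hp, Set.ncard_eq_three.2 ⟨a, b, c, hab, hac, hbc, rfl⟩]
          obtain ⟨x, hx, hxT⟩ := Set.exists_mem_notMem_of_ncard_lt_ncard
            (show T.ncard < (insert p {a, b, c} : Set (Plane F)).ncard by omega)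
          have hTeq : T = insert p {a, b, c} \ {x} := by
            refine Set.eq_of_subset_of_ncard_le (fun r hr => ⟨hT hr, fun h => ?_⟩) ?_
            · rw [Set.mem_singleton_iff] at h
              exact hxT (h ▸ hr)
            · rw [Set.ncard_sdiff_singleton_of_mem hx, h4, hT3]
          have hcol : ∀ u v w : Plane F, u ∈ T → v ∈ T → w ∈ T → det3 u v w ≠ 0 →
              ¬ Collinear F T := by
            intro u v w hu hv hw h hc
            refine h ((collinear_iff_det3 u v w).1 (hc.subset ?_))
            rintro r (rfl | rfl | rfl) <;> assumption
          rw [hTeq] at hcol ⊢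
          rcases hx with rfl | rfl | rfl | rfl
          · exact hcol a b c ⟨by simp, Ne.symm hpa⟩ ⟨by simp, Ne.symm hpb⟩ ⟨by simp, Ne.symm hpc⟩
              hdet
          · exact hcol b c p ⟨by simp, Ne.symm hab⟩ ⟨by simp, Ne.symm hac⟩ ⟨by simp, hpa⟩ h3
          · exact hcol a c p ⟨by simp, hab⟩ ⟨by simp, Ne.symm hbc⟩ ⟨by simp, hpb⟩ h2
          · exact hcol a b p ⟨by simp, hac⟩ ⟨by simp, hbc⟩ ⟨by simp, hpc⟩ h1
    rw [hset, Set.ncard_compl, Nat.card_eq_fintype_card, card_plane]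
    have hq := Fintype.one_lt_card (α := F)
    congr 1
    omega

end Counting

section IrreducibleCounting

variable {F : Type*} [Field F] [Fintype F]

theorem ncard_prod_ne {α : Type*} [Fintype α] : {p : α × α | p.1 ≠ p.2}.ncard =
    Fintype.card α * (Fintype.card α - 1) := by
  classical
  have : {p : α × α | p.1 ≠ p.2} = ((Finset.univ : Finset α).offDiag : Set (α × α)) := by
    ext p
    simp
  rw [this, Set.ncard_coe_finset, Finset.offDiag_card, Finset.card_univ, Nat.mul_sub_one]

/-- The binary form which vanishes at two given points of the projective line. -/
def pairForm (o o' : Option F) (c : F) : F × F × F :=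
  (c * ((direction o).2 * (direction o').2),
    -c * ((direction o).1 * (direction o').2 + (direction o).2 * (direction o').1),
    c * ((direction o).1 * (direction o').1))

omit [Fintype F] in
theorem leadEval_pairForm (o o' : Option F) (c : F) (r : F × F × F) (x y : F) :
    leadEval (pairForm o o' c, r) x y =
      c * ((direction o).2 * x - (direction o).1 * y) *
        ((direction o').2 * x - (direction o').1 * y) := by
  simp only [leadEval, pairForm]; ring

omit [Fintype F] in
theorem infinityRoots_pairForm (o o' : Option F) {c : F} (hc : c ≠ 0) (r : F × F × F) :
    infinityRoots (pairForm o o' c, r) = {o, o'} := by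
  ext s
  rw [infinityRoots, Set.mem_ofPred_eq, leadEval_pairForm]
  simp only [mul_eq_zero, hc, false_or, Set.mem_insert_iff, Set.mem_singleton_iff]
  have key : ∀ t : Option F, (direction t).2 * (direction s).1 -
      (direction t).1 * (direction s).2 = 0 ↔ s = t := fun t =>
    ⟨fun h => direction_det_injective (by linear_combination h), fun h => by rw [h]; ring⟩
  rw [key, key]

omit [Fintype F] in
theorem pairForm_injective (o o' : Option F) : Function.Injective (pairForm o o') := by
  intro c c' h
  simp only [pairForm, Prod.mk.injEq] at h
  obtain ⟨h1, h2, h3⟩ := h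
  cases o <;> cases o' <;> simp [direction] at h1 h2 h3 <;> assumption

omit [Fintype F] in
theorem exists_pairForm_eq {f : F × F × F} (hf : f ≠ 0) {o : Option F}
    (ho : o ∈ infinityRoots (f, 0)) : ∃ o' c, c ≠ 0 ∧ f = pairForm o o' c := by
  obtain ⟨a, b, c⟩ := f
  have ho' : leadEval ((a, b, c), 0) (direction o).1 (direction o).2 = 0 := ho
  simp only [leadEval] at ho'
  obtain ⟨γ, δ, rfl, rfl, rfl⟩ : ∃ γ δ : F, a = (direction o).2 * γ ∧
      b = (direction o).2 * δ - (direction o).1 * γ ∧ c = -(direction o).1 * δ := by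
    cases o with
    | none =>
      simp only [direction] at ho' ⊢
      exact ⟨-b, -c, by linear_combination ho', by ring, by ring⟩
    | some t =>
      simp only [direction] at ho' ⊢
      exact ⟨a, b + t * a, by ring, by ring, by linear_combination ho'⟩
  have hne : -δ ≠ 0 ∨ γ ≠ 0 := by
    by_contra! h
    apply hf
    rw [neg_eq_zero.1 h.1, h.2]
    simp
  obtain ⟨o', r, hr, h0, h1⟩ := exists_eq_smul_direction hne
  refine ⟨o', r, hr, ?_⟩
  have h0' : δ = -(r * (direction o').1) := by rw [← h0]; ring
  simp only [pairForm, Prod.mk.injEq, h0', h1]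
  refine ⟨by ring, by ring, by ring⟩

/-- Nonzero binary quadratic forms with `k` rational zeros. -/
def binaryForms (F : Type*) [Field F] (k : ℕ) : Set (F × F × F) :=
  {f | f ≠ 0 ∧ (infinityRoots (f, 0)).ncard = k}

theorem ncard_forms_with_roots (o o' : Option F) :
    {f : F × F × F | f ≠ 0 ∧ infinityRoots (f, 0) = {o, o'}}.ncard = Fintype.card F - 1 := by
  have himg : {f : F × F × F | f ≠ 0 ∧ infinityRoots (f, 0) = {o, o'}} =
      pairForm o o' '' {c | c ≠ 0} := by
    ext f
    constructor
    · rintro ⟨hf, hroots⟩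
      obtain ⟨s, c, hc, rfl⟩ := exists_pairForm_eq hf (o := o) (by rw [hroots]; simp)
      rw [infinityRoots_pairForm _ _ hc] at hroots
      have hs : s = o' := by
        have h1 : s ∈ ({o, o'} : Set (Option F)) := by rw [← hroots]; simp
        have h2 : o' ∈ ({o, s} : Set (Option F)) := by rw [hroots]; simp
        rcases h1 with h1 | h1
        · rcases h2 with h2 | h2
          · rw [h1, h2]
          · exact h2.symm
        · exact h1
      exact ⟨c, hc, by rw [hs]⟩
    · rintro ⟨c, hc, rfl⟩
      refine ⟨fun h => hc ?_, infinityRoots_pairForm o o' hc 0⟩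
      exact pairForm_injective o o' (h.trans (by simp [pairForm]; rfl))
  rw [himg, Set.ncard_image_of_injective _ (pairForm_injective o o'), ncard_ne_zero]

theorem ncard_binaryForms_two : (binaryForms F 2).ncard * 2 =
    (Fintype.card F + 1) * Fintype.card F * (Fintype.card F - 1) := by
  have h := ncard_mul_eq_ncard_mul (A := binaryForms F 2)
    (B := {p : Option F × Option F | p.1 ≠ p.2})
    (fun f p => infinityRoots (f, 0) = {p.1, p.2}) (m := 2) (n := Fintype.card F - 1)
    ?_ ?_
  · rw [h, ncard_prod_ne, Fintype.card_option, Nat.add_sub_cancel]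
  · rintro f ⟨hf, h2⟩
    obtain ⟨o, o', hne, hoo⟩ := Set.ncard_eq_two.1 h2
    have : {p : Option F × Option F | p ∈ {p : Option F × Option F | p.1 ≠ p.2} ∧
        infinityRoots (f, 0) = {p.1, p.2}} = {(o, o'), (o', o)} := by
      ext ⟨s, s'⟩
      simp only [hoo, Set.mem_ofPred_eq, Set.mem_insert_iff, Set.mem_singleton_iff, Prod.mk.injEq]
      constructor
      · rintro ⟨-, h⟩
        rcases Set.pair_eq_pair_iff.1 h with ⟨rfl, rfl⟩ | ⟨rfl, rfl⟩
        · exact Or.inl ⟨rfl, rfl⟩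
        · exact Or.inr ⟨rfl, rfl⟩
      · rintro (⟨rfl, rfl⟩ | ⟨rfl, rfl⟩)
        · exact ⟨hne, rfl⟩
        · exact ⟨hne.symm, Set.pair_comm _ _⟩
    rw [this, Set.ncard_pair]
    intro h
    exact hne (congrArg Prod.fst h)
  · rintro ⟨o, o'⟩ hne
    rw [← ncard_forms_with_roots o o']
    congr 1
    ext f
    refine ⟨fun h => ⟨h.1.1, h.2⟩, fun h => ⟨⟨h.1, ?_⟩, h.2⟩⟩
    rw [h.2, Set.ncard_pair hne]

theorem ncard_binaryForms_one : (binaryForms F 1).ncard =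
    (Fintype.card F + 1) * (Fintype.card F - 1) := by
  have h := ncard_mul_eq_ncard_mul (A := binaryForms F 1)
    (B := (Set.univ : Set (Option F)))
    (fun f o => infinityRoots (f, 0) = {o}) (m := 1) (n := Fintype.card F - 1) ?_ ?_
  · rw [mul_one, Set.ncard_univ, Nat.card_eq_fintype_card, Fintype.card_option] at h
    exact h
  · rintro f ⟨hf, h1⟩
    obtain ⟨o, ho⟩ := Set.ncard_eq_one.1 h1
    rw [Set.ncard_eq_one]
    refine ⟨o, Set.eq_singleton_iff_unique_mem.2 ⟨⟨trivial, ho⟩, ?_⟩⟩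
    rintro s ⟨-, hs⟩
    rw [ho] at hs
    exact (Set.singleton_eq_singleton_iff.1 hs).symm
  · rintro o -
    rw [← ncard_forms_with_roots o o, Set.pair_eq_singleton]
    congr 1
    ext f
    refine ⟨fun h => ⟨h.1.1, h.2⟩, fun h => ⟨⟨h.1, ?_⟩, h.2⟩⟩
    rw [h.2, Set.ncard_singleton]

theorem ncard_binaryForms_zero : (binaryForms F 0).ncard + (binaryForms F 1).ncard +
    (binaryForms F 2).ncard + 1 = Fintype.card F ^ 3 := by
  have hdis : ∀ j k, j ≠ k → Disjoint (binaryForms F j) (binaryForms F k) := fun j k h =>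
    Set.disjoint_left.2 fun f hf hf' => h (hf.2.symm.trans hf'.2)
  have hpart : ({0}ᶜ : Set (F × F × F)) =
      (binaryForms F 0 ∪ binaryForms F 1) ∪ binaryForms F 2 := by
    ext f
    constructor
    · intro hf
      have hf0 : f ≠ 0 := hf
      rcases infinityRoots_cases (w := (f, 0)) hf0 with
        ⟨h, -⟩ | ⟨o, h, -⟩ | ⟨o, o', hne, h, -⟩
      · exact Or.inl (Or.inl ⟨hf0, by rw [h, Set.ncard_empty]⟩)
      · exact Or.inl (Or.inr ⟨hf0, by rw [h, Set.ncard_singleton]⟩)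
      · exact Or.inr ⟨hf0, by rw [h, Set.ncard_pair hne]⟩
    · rintro ((h | h) | h) <;> exact h.1
  have hcard := congrArg Set.ncard hpart
  rw [Set.ncard_union_eq, Set.ncard_union_eq (hdis 0 1 (by omega)), Set.ncard_compl,
    Set.ncard_singleton, Nat.card_eq_fintype_card, Fintype.card_prod, Fintype.card_prod] at hcard
  · have hq := Fintype.card_pos (α := F)
    have : 0 < Fintype.card F * (Fintype.card F * Fintype.card F) := by positivity
    rw [← hcard, show Fintype.card F ^ 3 = Fintype.card F * (Fintype.card F * Fintype.card F) by
      ring]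
    omega
  · rw [Set.disjoint_union_left]
    exact ⟨hdis 0 2 (by omega), hdis 1 2 (by omega)⟩

/-- For a fixed nonzero leading form, `q²` of the quadratic polynomials are degenerate. -/
theorem ncard_degenerate {f : F × F × F} (hf : f ≠ 0) :
    {r : F × F × F | conicDet (f, r) = 0}.ncard = Fintype.card F ^ 2 := by
  have of_param : ∀ φ : F × F → F × F × F, Function.Injective φ →
      {r : F × F × F | conicDet (f, r) = 0} = φ '' Set.univ →
      {r : F × F × F | conicDet (f, r) = 0}.ncard = Fintype.card F ^ 2 := by
    intro φ hφ h
    rw [h, Set.ncard_image_of_injective _ hφ, Set.ncard_univ, Nat.card_eq_fintype_card,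
      Fintype.card_prod, sq]
  have of_disc : leadDisc (f, (0 : F × F × F)) ≠ 0 →
      {r : F × F × F | conicDet (f, r) = 0}.ncard = Fintype.card F ^ 2 := by
    intro hd
    rw [leadDisc] at hd
    refine of_param (fun s => (s.1, s.2, (f.2.1 * s.1 * s.2 - f.1 * s.2 ^ 2 - f.2.2 * s.1 ^ 2) /
      (f.2.1 ^ 2 - 4 * f.1 * f.2.2))) ?_ ?_
    · intro s s' h
      simp only [Prod.mk.injEq] at h
      exact Prod.ext h.1 h.2.1
    · ext ⟨d, e, g⟩
      simp only [Set.mem_ofPred_eq, conicDet, Set.image_univ, Set.mem_range, Prod.mk.injEq,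
        Prod.exists]
      constructor
      · intro h
        refine ⟨d, e, rfl, rfl, ?_⟩
        rw [div_eq_iff hd]
        linear_combination h
      · rintro ⟨d', e', rfl, rfl, h⟩
        rw [div_eq_iff hd] at h
        linear_combination h
  rcases infinityRoots_cases (w := (f, 0)) hf with ⟨-, hd⟩ | ⟨o, h, hd⟩ | ⟨o, o', -, -, hd⟩
  · exact of_disc hd
  · have ho : o ∈ infinityRoots (f, 0) := by rw [h]; rfl
    obtain ⟨o', c, hc, rfl⟩ := exists_pairForm_eq hf ho
    rw [infinityRoots_pairForm _ _ hc] at h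
    have hoo : o' = o := by
      have : o' ∈ ({o} : Set (Option F)) := by rw [← h]; simp
      exact this
    subst hoo
    have hdet : ∀ d e g : F, conicDet (pairForm o' o' c, (d, e, g)) = 0 ↔
        d * (direction o').1 + e * (direction o').2 = 0 := by
      intro d e g
      have : conicDet (pairForm o' o' c, (d, e, g)) =
          -c * (d * (direction o').1 + e * (direction o').2) ^ 2 := by
        simp only [conicDet, pairForm]; ring
      rw [this]
      simp [hc]
    cases o' with
    | none =>
      refine of_param (fun s => (0, s.1, s.2)) ?_ ?_
      · intro s s' h
        simp only [Prod.mk.injEq] at h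
        exact Prod.ext h.2.1 h.2.2
      · ext ⟨d, e, g⟩
        rw [Set.mem_ofPred_eq, hdet]
        simp [direction, eq_comm]
    | some t =>
      refine of_param (fun s => (s.1, -(s.1 * t), s.2)) ?_ ?_
      · intro s s' h
        simp only [Prod.mk.injEq] at h
        exact Prod.ext h.1 h.2.2
      · ext ⟨d, e, g⟩
        rw [Set.mem_ofPred_eq, hdet]
        simp only [direction, Set.image_univ, Set.mem_range, Prod.mk.injEq, Prod.exists]
        constructor
        · intro h
          exact ⟨d, g, rfl, by linear_combination -h, rfl⟩
        · rintro ⟨d', g', rfl, rfl, rfl⟩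
          ring
  · exact of_disc hd

/-- Coefficients of the irreducible conics with `k` points at infinity. -/
def irredCoefs (F : Type*) [Field F] (k : ℕ) : Set (Coef F) :=
  {w | conicDet w ≠ 0 ∧ (infinityRoots w).ncard = k}

theorem ncard_irredCoefs (k : ℕ) : (irredCoefs F k).ncard =
    (binaryForms F k).ncard * (Fintype.card F ^ 3 - Fintype.card F ^ 2) := by
  rw [← mul_one (irredCoefs F k).ncard]
  refine (ncard_mul_eq_ncard_mul (fun (f : F × F × F) (w : Coef F) => w.1 = f) ?_ ?_).symm
  · rintro f ⟨hf, hk⟩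
    have himg : {w | w ∈ irredCoefs F k ∧ w.1 = f} =
        (fun r => (f, r)) '' {r | conicDet (f, r) = 0}ᶜ := by
      ext ⟨f', r⟩
      constructor
      · rintro ⟨⟨h1, h2⟩, rfl⟩
        exact ⟨r, h1, rfl⟩
      · rintro ⟨r, hr, h⟩
        obtain ⟨rfl, rfl⟩ := Prod.mk.inj h
        exact ⟨⟨hr, hk⟩, rfl⟩
    rw [himg, Set.ncard_image_of_injective _ (fun r r' h => (Prod.mk.inj h).2), Set.ncard_compl,
      ncard_degenerate hf, Nat.card_eq_fintype_card, Fintype.card_prod, Fintype.card_prod]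
    congr 1
    ring
  · rintro w ⟨hw, hk⟩
    rw [Set.ncard_eq_one]
    refine ⟨w.1, Set.eq_singleton_iff_unique_mem.2 ⟨⟨⟨lead_ne_zero_of_conicDet hw, hk⟩, rfl⟩, ?_⟩⟩
    rintro f ⟨-, rfl⟩
    rfl

theorem ncard_irredCoefs_eq {k : ℕ} (hk : k + 4 ≤ Fintype.card F) : (irredCoefs F k).ncard =
    (irredConicSets F k).ncard * (Fintype.card F - 1) := by
  rw [irredConicSets_eq, ← mul_one (irredCoefs F k).ncard]
  refine ncard_mul_eq_ncard_mul (fun (w : Coef F) X => quadZeros w = X) ?_ ?_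
  · rintro w hw
    rw [Set.ncard_eq_one]
    refine ⟨quadZeros w, Set.eq_singleton_iff_unique_mem.2 ⟨⟨⟨w, hw, rfl⟩, rfl⟩, ?_⟩⟩
    rintro X ⟨-, rfl⟩
    rfl
  · rintro _ ⟨w, ⟨hw, hwk⟩, rfl⟩
    have hw0 : w ≠ 0 := by rintro rfl; simp [conicDet] at hw
    have hcard := ncard_quadZeros_add hw
    have hflat := isConicFlat_one_of_irreducible hw (by omega)
    have himg : {w' | w' ∈ irredCoefs F k ∧ quadZeros w' = quadZeros w} =
        (fun c : F => c • w) '' {c | c ≠ 0} := by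
      ext w'
      constructor
      · rintro ⟨⟨hw', -⟩, h⟩
        have hmem : w ∈ vanishing (quadEval F) (quadZeros w) := fun p hp => hp
        have hmem' : w' ∈ vanishing (quadEval F) (quadZeros w) := fun p hp => by
          rw [← h] at hp
          exact hp
        obtain ⟨c, hc⟩ := (finrank_eq_one_iff_of_nonzero' (⟨w, hmem⟩ : vanishing (quadEval F) _)
          (fun h => hw0 (congrArg Subtype.val h))).1 hflat.1 ⟨w', hmem'⟩
        have hc' : c • w = w' := congrArg Subtype.val hc
        refine ⟨c, ?_, hc'⟩
        rintro rfl
        rw [zero_smul] at hc'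
        rw [← hc'] at hw'
        simp [conicDet] at hw'
      · rintro ⟨c, hc, rfl⟩
        have hc0 : c ≠ 0 := hc
        refine ⟨⟨?_, ?_⟩, ?_⟩
        · have : conicDet (c • w) = c ^ 3 * conicDet w := by
            simp [conicDet]; ring
          rw [this]
          exact mul_ne_zero (pow_ne_zero 3 hc0) hw
        · rw [← hwk]
          congr 1
          ext o
          have : leadEval (c • w) (direction o).1 (direction o).2 =
              c * leadEval w (direction o).1 (direction o).2 := by
            simp [leadEval]; ring
          simp only [infinityRoots, Set.mem_ofPred_eq]
          rw [this]
          simp [hc0]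
        · ext p
          simp [mem_quadZeros, hc0]
    rw [himg, Set.ncard_image_of_injective, ncard_ne_zero]
    exact smul_left_injective F hw0

theorem ncard_irredConicSets {k : ℕ} (hk : k + 4 ≤ Fintype.card F) :
    (irredConicSets F k).ncard = (binaryForms F k).ncard * Fintype.card F ^ 2 := by
  have h1 := ncard_irredCoefs_eq hk
  rw [ncard_irredCoefs] at h1
  apply Nat.eq_of_mul_eq_mul_right (show 0 < Fintype.card F - 1 by omega)
  rw [← h1, mul_assoc, Nat.mul_sub_one, ← pow_succ]

end IrreducibleCounting

section Binary

variable {F : Type*} [Field F] [Fintype F]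

theorem eq_zero_or_eq_one (hq : Fintype.card F = 2) (x : F) : x = 0 ∨ x = 1 := by
  classical
  by_contra! h
  have := Finset.card_le_univ ({0, 1, x} : Finset F)
  rw [Finset.card_eq_three.2 ⟨0, 1, x, zero_ne_one, h.1.symm, h.2.symm, rfl⟩] at this
  omega

theorem quadEval_eq_single [DecidableEq (Plane F)] (hq : Fintype.card F = 2) (p : Plane F) :
    quadEval F (mulCoef (1, 0, p 0 + 1) (0, 1, p 1 + 1)) = Pi.single p 1 := by
  have : DecidableEq F := Classical.decEq F
  have h11 : (1 : F) + 1 = 0 :=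
    (eq_zero_or_eq_one hq _).resolve_right fun h => one_ne_zero (add_eq_left.1 h)
  ext r
  rw [quadEval_mulCoef, Pi.single_apply]
  have key : ∀ x y : F, x + (y + 1) = if x = y then 1 else 0 := by
    intro x y
    rcases eq_zero_or_eq_one hq x with rfl | rfl <;>
      rcases eq_zero_or_eq_one hq y with rfl | rfl <;> simp [h11]
  have h0 : linEval (1, 0, p 0 + 1) r = if r 0 = p 0 then 1 else 0 := by
    rw [← key]; simp [linEval]
  have h1 : linEval (0, 1, p 1 + 1) r = if r 1 = p 1 then 1 else 0 := by
    rw [← key]; simp [linEval]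
  have hr : r = p ↔ r 0 = p 0 ∧ r 1 = p 1 :=
    ⟨fun h => by simp [h], fun h => plane_ext h.1 h.2⟩
  rw [h0, h1]
  by_cases h2 : r 0 = p 0 <;> by_cases h3 : r 1 = p 1 <;> simp [hr, h2, h3]

theorem range_quadEval_eq_top (hq : Fintype.card F = 2) : LinearMap.range (quadEval F) = ⊤ := by
  classical
  rw [eq_top_iff, ← (Pi.basisFun F (Plane F)).span_eq, Submodule.span_le]
  rintro _ ⟨p, rfl⟩
  exact ⟨_, (quadEval_eq_single hq p).trans (by simp)⟩

theorem nullity_of_card_two (hq : Fintype.card F = 2) {κ : Type*} {H : Matrix κ (Plane F) F}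
    (hH : IsParityCheckMatrix H (LinearMap.range (quadEval F))) (σ : Set (Plane F)) :
    nullity (vectorMatroid H) σ = σ.ncard := by
  classical
  have hcol : ∀ p, H.col p = 0 := fun p => by
    rw [← Matrix.mulVec_single_one, ← hH, range_quadEval_eq_top hq]
    trivial
  have hspan : Submodule.span F (H.col '' σ) = ⊥ := by
    rw [Submodule.span_eq_bot]
    rintro _ ⟨p, -, rfl⟩
    exact hcol p
  rw [nullity, toNat_eRk_vectorMatroid, hspan, finrank_bot, Nat.sub_zero]

theorem minNullSets_of_card_two (hq : Fintype.card F = 2) {κ : Type*} {H : Matrix κ (Plane F) F}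
    (hH : IsParityCheckMatrix H (LinearMap.range (quadEval F))) (i : ℕ) :
    minNullSets (vectorMatroid H) i = {σ | σ.ncard = i} := by
  have hN : nullSets (vectorMatroid H) i = {σ | σ.ncard = i} := by
    ext σ
    simp [nullSets, vectorMatroid_ground, nullity_of_card_two hq hH]
  rw [minNullSets, hN]
  ext σ
  refine ⟨fun h => h.1, fun h => ⟨h, fun τ hτ hle => ?_⟩⟩
  have h1 : σ.ncard = i := h
  have h2 : τ.ncard = i := hτ
  exact (Set.eq_of_subset_of_ncard_le hle (by omega)).ge

omit [Field F] [Fintype F] in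
theorem mem_complements {𝒜 : Set (Set (Plane F))} {σ : Set (Plane F)} :
    σ ∈ complements 𝒜 ↔ σᶜ ∈ 𝒜 := by
  constructor
  · rintro ⟨X, hX, rfl⟩
    rwa [compl_compl]
  · intro h
    exact ⟨_, h, compl_compl σ⟩

omit [Field F] [Fintype F] in
theorem ncard_complements (𝒜 : Set (Set (Plane F))) : (complements 𝒜).ncard = 𝒜.ncard :=
  Set.ncard_image_of_injective _ compl_injective

omit [Field F] [Fintype F] in
theorem complements_union (𝒜 ℬ : Set (Set (Plane F))) :
    complements (𝒜 ∪ ℬ) = complements 𝒜 ∪ complements ℬ := Set.image_union _ _ _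

theorem mem_conicZeroSets_of_card_two (hq : Fintype.card F = 2) {X : Set (Plane F)}
    (hX : X ≠ Set.univ) : X ∈ conicZeroSets F := by
  classical
  obtain ⟨w, hw⟩ : (fun p => if p ∈ X then (0 : F) else 1) ∈ LinearMap.range (quadEval F) := by
    rw [range_quadEval_eq_top hq]; trivial
  have hXw : X = quadZeros w := by
    ext p
    rw [mem_quadZeros, hw]
    by_cases h : p ∈ X <;> simp [h]
  rw [conicZeroSets_eq]
  refine ⟨w, ?_, hXw⟩
  rintro rfl
  exact hX (hXw.trans (Set.eq_univ_of_forall fun p => by simp [mem_quadZeros]))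

theorem complements_maximal_of_card_two (hq : Fintype.card F = 2) :
    complements {X | Maximal (fun Y => Y ∈ conicZeroSets F ∧ Y ≠ Set.univ) X} =
      {σ | σ.ncard = 1} := by
  have hiff : ∀ Y : Set (Plane F), Y ∈ conicZeroSets F ∧ Y ≠ Set.univ ↔ Y ≠ Set.univ :=
    fun Y => and_iff_right_of_imp (mem_conicZeroSets_of_card_two hq)
  ext σ
  rw [mem_complements]
  simp only [hiff, Set.mem_ofPred_eq, Set.ncard_eq_one]
  constructor
  · rintro ⟨h1, h2⟩
    obtain ⟨a, ha⟩ : σ.Nonempty := by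
      rw [Set.nonempty_iff_ne_empty]
      rintro rfl
      exact h1 Set.compl_empty
    refine ⟨a, Set.eq_singleton_iff_unique_mem.2 ⟨ha, fun b hb => ?_⟩⟩
    by_contra hba
    refine h2 (y := {a}ᶜ) (fun h => ?_) (Set.compl_subset_compl.2 (by simpa using ha))
      (show b ∈ ({a}ᶜ : Set (Plane F)) from hba) hb
    have : a ∈ ({a}ᶜ : Set (Plane F)) := by rw [h]; trivial
    exact this rfl
  · rintro ⟨a, rfl⟩
    refine ⟨fun h => ?_, fun Y hY hle p hp hpa => ?_⟩
    · have : a ∈ ({a}ᶜ : Set (Plane F)) := by rw [h]; trivial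
      exact this rfl
    · rw [Set.mem_singleton_iff] at hpa
      subst hpa
      apply hY
      refine Set.eq_univ_of_forall fun r => ?_
      by_cases hr : r = p
      · rw [hr]; exact hp
      · exact hle hr

theorem complements_crossingPairs_union_ellipses_of_card_two (hq : Fintype.card F = 2) :
    complements (crossingPairs F ∪ ellipses F) = {σ | σ.ncard = 1} := by
  classical
  ext σ
  rw [mem_complements]
  have hcompl : σ.ncard + σᶜ.ncard = 4 := by
    rw [Set.ncard_add_ncard_compl, Nat.card_eq_fintype_card, card_plane, hq]; norm_num
  constructor
  · rintro (h | h)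
    · have := ncard_crossingPair h
      simp only [Set.mem_ofPred_eq]
      omega
    · have := ncard_irredConicSet (k := 0) h
      simp only [Set.mem_ofPred_eq]
      omega
  · intro h
    obtain ⟨p, rfl⟩ := Set.ncard_eq_one.1 h
    left
    have hX : ({p}ᶜ : Set (Plane F)) = lineSet (1, 0, p 0 + 1) ∪ lineSet (0, 1, p 1 + 1) := by
      rw [← quadZeros_mulCoef]
      ext r
      rw [mem_quadZeros, quadEval_eq_single hq, Pi.single_apply]
      simp
    have hdet : ((1, 0, p 0 + 1) : F × F × F).1 * ((0, 1, p 1 + 1) : F × F × F).2.1 -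
        ((1, 0, p 0 + 1) : F × F × F).2.1 * ((0, 1, p 1 + 1) : F × F × F).1 ≠ 0 := by simp
    rw [crossingPairs_eq, affineLines_eq_lineSet, hX]
    exact ⟨_, ⟨(1, 0, p 0 + 1), by simp, rfl⟩, _, ⟨(0, 1, p 1 + 1), by simp, rfl⟩,
      lineSet_ne_of_det hdet, exists_mem_inter_of_det hdet, rfl⟩

end Binary

section Assembly

variable {F : Type*} [Field F] [Fintype F]

theorem minNullSets_eq_flats (hq : 3 ≤ Fintype.card F) {κ : Type*} {H : Matrix κ (Plane F) F}
    (hH : IsParityCheckMatrix H (LinearMap.range (quadEval F))) (i : ℕ) :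
    minNullSets (vectorMatroid H) i = complements {X | IsConicFlat i X} :=
  minNullSets_eq_complements hH (quadEval_injective hq) i

theorem setOf_isConicFlat_one (hq : 3 ≤ Fintype.card F) :
    {X : Set (Plane F) | IsConicFlat 1 X} = parallelPairs F ∪ crossingPairs F ∪
      {X | ∃ k ≤ 2, k + 4 ≤ Fintype.card F ∧ X ∈ irredConicSets F k} := by
  ext X
  exact isConicFlat_one_iff_types hq X

theorem nullSets_six (hq : 3 ≤ Fintype.card F) {κ : Type*} {H : Matrix κ (Plane F) F}
    (hH : IsParityCheckMatrix H (LinearMap.range (quadEval F))) :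
    nullSets (vectorMatroid H) 6 = {Set.univ} := by
  ext σ
  rw [nullSets, Set.mem_ofPred_eq, nullity_vectorMatroid hH (quadEval_injective hq),
    vectorMatroid_ground, and_iff_right (Set.subset_univ _)]
  refine (conicDim_eq_six_iff σᶜ).trans ?_
  simp

theorem ncard_quadrilaterals_rat (hq : 3 ≤ Fintype.card F) :
    ((quadrilaterals F).ncard : ℚ) = (Fintype.card F : ℚ) ^ 2 * ((Fintype.card F : ℚ) ^ 2 - 1) *
      ((Fintype.card F : ℚ) ^ 2 - Fintype.card F) *
        ((Fintype.card F : ℚ) ^ 2 - 3 * Fintype.card F + 3) / 24 ∧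
    ((triangles F).ncard : ℚ) = (Fintype.card F : ℚ) ^ 2 * ((Fintype.card F : ℚ) ^ 2 - 1) *
      ((Fintype.card F : ℚ) ^ 2 - Fintype.card F) / 6 := by
  have h3 := congrArg (Nat.cast : ℕ → ℚ) (ncard_triangles (F := F))
  have h4 := congrArg (Nat.cast : ℕ → ℚ) (ncard_quadrilaterals (F := F))
  generalize Fintype.card F = q at *
  have hle : q ≤ q ^ 2 := Nat.le_self_pow two_ne_zero q
  have hle' : 3 * q - 3 ≤ q ^ 2 := by
    have : 3 * q ≤ q ^ 2 := by nlinarith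
    omega
  rw [Nat.cast_mul, Nat.cast_mul, Nat.cast_choose_two, Nat.cast_sub hle] at h3
  rw [Nat.cast_mul, Nat.cast_mul, Nat.cast_sub hle', Nat.cast_sub (by omega)] at h4
  push_cast at h3 h4
  constructor
  · linear_combination -h4 / 4 - ((q : ℚ) ^ 2 - (3 * q - 3)) * h3 / 12
  · linear_combination -h3 / 3

theorem ncard_irredConicSets_rat :
    (4 ≤ Fintype.card F → ((irredConicSets F 0).ncard : ℚ) =
      (Fintype.card F : ℚ) ^ 3 * ((Fintype.card F : ℚ) - 1) ^ 2 / 2) ∧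
    (5 ≤ Fintype.card F → ((irredConicSets F 1).ncard : ℚ) =
      (Fintype.card F : ℚ) ^ 2 * ((Fintype.card F : ℚ) ^ 2 - 1)) ∧
    (6 ≤ Fintype.card F → ((irredConicSets F 2).ncard : ℚ) =
      (Fintype.card F : ℚ) ^ 3 * ((Fintype.card F : ℚ) ^ 2 - 1) / 2) := by
  have h0 := congrArg (Nat.cast : ℕ → ℚ) (ncard_binaryForms_zero (F := F))
  have h1 := congrArg (Nat.cast : ℕ → ℚ) (ncard_binaryForms_one (F := F))
  have h2 := congrArg (Nat.cast : ℕ → ℚ) (ncard_binaryForms_two (F := F))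
  have hk : ∀ k, k + 4 ≤ Fintype.card F → ((irredConicSets F k).ncard : ℚ) =
      (binaryForms F k).ncard * (Fintype.card F : ℚ) ^ 2 := fun k hk => by
    rw [ncard_irredConicSets hk]; push_cast; rfl
  have hpos := Fintype.card_pos (α := F)
  generalize Fintype.card F = q at *
  push_cast [Nat.cast_sub (show 1 ≤ q from hpos)] at h0 h1 h2
  refine ⟨fun h => ?_, fun h => ?_, fun h => ?_⟩
  · rw [hk 0 h]
    linear_combination (q : ℚ) ^ 2 * (h0 - h1 - h2 / 2)
  · rw [hk 1 h]
    linear_combination (q : ℚ) ^ 2 * h1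
  · rw [hk 2 h]
    linear_combination (q : ℚ) ^ 2 * h2 / 2

end Assembly

end RM22

theorem theorem5p2 {F : Type*} [Field F] [Fintype F] (q : ℕ) (hq : Fintype.card F = q)
    {s : ℕ} (H : Matrix (Fin s) (RM22.Plane F) F)
    (hH : RM22.IsParityCheckMatrix H (RM22.reedMuller F))
    (M : Matroid (RM22.Plane F)) (hM : M = RM22.vectorMatroid H) :
    -- the minimal sets of nullity `1` come from the maximal (proper) zero sets of conics
    ((3 ≤ q → RM22.minNullSets M 1 =
        RM22.complements {X | Maximal (· ∈ RM22.conicZeroSets F) X}) ∧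
      (q = 2 → RM22.minNullSets M 1 = RM22.complements
        {X | Maximal (fun Y => Y ∈ RM22.conicZeroSets F ∧ Y ≠ Set.univ) X}) ∧
      -- classification of the minimal sets of nullity `1` by types of conics
      (7 ≤ q → RM22.minNullSets M 1 = RM22.complements
        (RM22.parallelPairs F ∪ RM22.crossingPairs F ∪ RM22.ellipses F ∪
          RM22.parabolas F ∪ RM22.hyperbolas F)) ∧
      (q = 5 → RM22.minNullSets M 1 = RM22.complements
        (RM22.parallelPairs F ∪ RM22.crossingPairs F ∪ RM22.ellipses F ∪ RM22.parabolas F)) ∧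
      (q = 4 → RM22.minNullSets M 1 = RM22.complements
        (RM22.parallelPairs F ∪ RM22.crossingPairs F ∪ RM22.ellipses F)) ∧
      (q = 3 → RM22.minNullSets M 1 = RM22.complements
        (RM22.parallelPairs F ∪ RM22.crossingPairs F)) ∧
      (q = 2 → RM22.minNullSets M 1 = RM22.complements
        (RM22.crossingPairs F ∪ RM22.ellipses F)) ∧
      -- sizes of the zero sets, for every `q`
      (∀ X ∈ RM22.parallelPairs F, X.ncard = 2 * q) ∧
      (∀ X ∈ RM22.crossingPairs F, X.ncard = 2 * q - 1) ∧
      (∀ X ∈ RM22.ellipses F, X.ncard = q + 1) ∧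
      (∀ X ∈ RM22.parabolas F, X.ncard = q) ∧
      (∀ X ∈ RM22.hyperbolas F, X.ncard = q - 1) ∧
      -- numbers of zero sets of each type occurring in the classification
      (3 ≤ q → ((RM22.complements (RM22.parallelPairs F)).ncard : ℚ) =
        (q : ℚ) * ((q : ℚ) ^ 2 - 1) / 2) ∧
      (3 ≤ q → ((RM22.complements (RM22.crossingPairs F)).ncard : ℚ) =
        ((q : ℚ) ^ 4 + (q : ℚ) ^ 3) / 2) ∧
      (4 ≤ q → ((RM22.complements (RM22.ellipses F)).ncard : ℚ) =
        (q : ℚ) ^ 3 * ((q : ℚ) - 1) ^ 2 / 2) ∧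
      (5 ≤ q → ((RM22.complements (RM22.parabolas F)).ncard : ℚ) =
        (q : ℚ) ^ 2 * ((q : ℚ) ^ 2 - 1)) ∧
      (7 ≤ q → ((RM22.complements (RM22.hyperbolas F)).ncard : ℚ) =
        (q : ℚ) ^ 3 * ((q : ℚ) ^ 2 - 1) / 2)) ∧
    -- nullities `2` to `6` for `q ≥ 3`
    (3 ≤ q →
      (RM22.minNullSets M 2 =
          RM22.complements (RM22.linePlusPoint F) ∪ RM22.complements (RM22.quadrilaterals F) ∧
        ((RM22.complements (RM22.linePlusPoint F)).ncard : ℚ) =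
          ((q : ℚ) ^ 2 + q) * ((q : ℚ) ^ 2 - q) ∧
        ((RM22.complements (RM22.quadrilaterals F)).ncard : ℚ) =
          (q : ℚ) ^ 2 * ((q : ℚ) ^ 2 - 1) * ((q : ℚ) ^ 2 - q) *
            ((q : ℚ) ^ 2 - 3 * q + 3) / 24) ∧
      (RM22.minNullSets M 3 =
          RM22.complements (RM22.affineLines F) ∪ RM22.complements (RM22.triangles F) ∧
        ((RM22.complements (RM22.affineLines F)).ncard : ℚ) = (q : ℚ) ^ 2 + q ∧
        ((RM22.complements (RM22.triangles F)).ncard : ℚ) =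
          (q : ℚ) ^ 2 * ((q : ℚ) ^ 2 - 1) * ((q : ℚ) ^ 2 - q) / 6) ∧
      (RM22.minNullSets M 4 = RM22.complements {S | S.ncard = 2} ∧
        (RM22.minNullSets M 4).ncard = (q ^ 2).choose 2) ∧
      (RM22.minNullSets M 5 = RM22.complements {S | ∃ p, S = {p}} ∧
        (RM22.minNullSets M 5).ncard = q ^ 2) ∧
      (RM22.nullSets M 6 = {Set.univ} ∧ RM22.minNullSets M 6 = {Set.univ})) ∧
    -- the case `q = 2`
    (q = 2 → ∀ i ≤ 4, RM22.minNullSets M i = {σ | σ.ncard = i}) := by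
  subst hM
  subst hq
  rw [RM22.reedMuller_eq_range] at hH
  have htwo : Fintype.card F = 2 → ∀ i, RM22.minNullSets (RM22.vectorMatroid H) i =
      {σ | σ.ncard = i} := fun hq i => RM22.minNullSets_of_card_two hq hH i
  have hone : 3 ≤ Fintype.card F → RM22.minNullSets (RM22.vectorMatroid H) 1 =
      RM22.complements (RM22.parallelPairs F ∪ RM22.crossingPairs F ∪
        {X | ∃ k ≤ 2, k + 4 ≤ Fintype.card F ∧ X ∈ RM22.irredConicSets F k}) := fun hq => by
    rw [RM22.minNullSets_eq_flats hq hH, RM22.setOf_isConicFlat_one hq]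
  have hline := RM22.ncard_affineLines (F := F)
  obtain ⟨hell, hpar, hhyp⟩ := RM22.ncard_irredConicSets_rat (F := F)
  have hq1 : 1 ≤ Fintype.card F := Fintype.card_pos
  have hle : Fintype.card F ≤ Fintype.card F ^ 2 := Nat.le_self_pow two_ne_zero _
  refine ⟨⟨fun hq => ?_, fun hq => ?_, fun hq => ?_, fun hq => ?_, fun hq => ?_, fun hq => ?_,
    fun hq => ?_, fun X hX => ?_, fun X hX => ?_, fun X hX => ?_, fun X hX => ?_, fun X hX => ?_,
    fun hq => ?_, fun hq => ?_, fun hq => ?_, fun hq => ?_, fun hq => ?_⟩, fun hq => ?_,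
    fun hq i _ => htwo hq i⟩
  · rw [RM22.minNullSets_eq_flats hq hH]
    congr 1
    ext X
    exact RM22.isConicFlat_one_iff_maximal hq X
  · rw [htwo hq, RM22.complements_maximal_of_card_two hq]
  · rw [hone (by omega), Set.union_assoc _ (RM22.ellipses F) (RM22.parabolas F),
      Set.union_assoc _ (RM22.ellipses F ∪ RM22.parabolas F)]
    congr 2
    ext X
    constructor
    · rintro ⟨k, hk, -, hX⟩
      interval_cases k
      · exact Or.inl (Or.inl hX)
      · exact Or.inl (Or.inr hX)
      · exact Or.inr hX
    · rintro ((hX | hX) | hX)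
      · exact ⟨0, by omega, by omega, hX⟩
      · exact ⟨1, by omega, by omega, hX⟩
      · exact ⟨2, by omega, by omega, hX⟩
  · rw [hone (by omega), Set.union_assoc _ (RM22.ellipses F)]
    congr 2
    ext X
    constructor
    · rintro ⟨k, -, hk, hX⟩
      have hk1 : k ≤ 1 := by omega
      interval_cases k
      · exact Or.inl hX
      · exact Or.inr hX
    · rintro (hX | hX)
      · exact ⟨0, by omega, by omega, hX⟩
      · exact ⟨1, by omega, by omega, hX⟩
  · rw [hone (by omega)]
    congr 2
    ext X
    constructor
    · rintro ⟨k, -, hk, hX⟩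
      obtain rfl : k = 0 := by omega
      exact hX
    · intro hX
      exact ⟨0, by omega, by omega, hX⟩
  · rw [hone (by omega)]
    congr 1
    rw [Set.union_eq_left]
    rintro X ⟨k, -, hk, -⟩
    omega
  · rw [htwo hq, RM22.complements_crossingPairs_union_ellipses_of_card_two hq]
  · exact RM22.ncard_parallelPair hX
  · exact RM22.ncard_crossingPair hX
  · exact RM22.ncard_irredConicSet hX
  · have := RM22.ncard_irredConicSet hX
    omega
  · have := RM22.ncard_irredConicSet hX
    omega
  · have h := congrArg (Nat.cast : ℕ → ℚ) (RM22.ncard_parallelPairs hq)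
    push_cast [Nat.cast_sub hq1] at h
    rw [RM22.ncard_complements]
    linear_combination -h / 2
  · have h := congrArg (Nat.cast : ℕ → ℚ) (RM22.ncard_crossingPairs hq)
    push_cast at h
    rw [RM22.ncard_complements]
    linear_combination -h / 2
  · rw [RM22.ncard_complements]
    exact hell hq
  · rw [RM22.ncard_complements]
    exact hpar hq
  · rw [RM22.ncard_complements]
    exact hhyp (by omega)
  · have hflats := RM22.minNullSets_eq_flats hq hH
    have hsets : ∀ {i : ℕ} {𝒜 : Set (Set (RM22.Plane F))},
        (∀ X, RM22.IsConicFlat i X ↔ X ∈ 𝒜) →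
        RM22.minNullSets (RM22.vectorMatroid H) i = RM22.complements 𝒜 := fun h => by
      rw [hflats]
      congr 1
      ext X
      exact h X
    have h4 : RM22.minNullSets (RM22.vectorMatroid H) 4 = RM22.complements {S | S.ncard = 2} :=
      hsets RM22.isConicFlat_four
    have h5 : RM22.minNullSets (RM22.vectorMatroid H) 5 = RM22.complements {S | ∃ p, S = {p}} :=
      hsets RM22.isConicFlat_five
    obtain ⟨hquad, htri⟩ := RM22.ncard_quadrilaterals_rat hq
    refine ⟨⟨?_, ?_, ?_⟩, ⟨?_, ?_, ?_⟩, ⟨h4, ?_⟩, ⟨h5, ?_⟩, RM22.nullSets_six hq hH, ?_⟩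
    · rw [← RM22.complements_union]
      exact hsets (RM22.isConicFlat_two hq)
    · rw [RM22.ncard_complements, ← RM22.ncard_linePlusPoint hq]
      push_cast [Nat.cast_sub hle]
      rfl
    · rw [RM22.ncard_complements, hquad]
    · rw [← RM22.complements_union]
      exact hsets (RM22.isConicFlat_three hq)
    · rw [RM22.ncard_complements, hline]
      push_cast
      rfl
    · rw [RM22.ncard_complements, htri]
    · rw [h4, RM22.ncard_complements, RM22.ncard_setOf_ncard_eq_two, RM22.card_plane]
    · have hsingle : {S : Set (RM22.Plane F) | ∃ p, S = {p}} = (fun p => {p}) '' Set.univ := by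
        ext S
        simp [eq_comm]
      rw [h5, RM22.ncard_complements, hsingle,
        Set.ncard_image_of_injective _ Set.singleton_injective, Set.ncard_univ,
        Nat.card_eq_fintype_card, RM22.card_plane]
    · rw [RM22.minNullSets, RM22.nullSets_six hq hH]
      ext σ
      refine ⟨fun h => h.1, fun h => ⟨h, fun τ hτ _ => ?_⟩⟩
      rw [Set.mem_singleton_iff] at h hτ
      rw [h, hτ]
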